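/- **Setting.** Let $\mathbb F$ be a field of characteristic $p>3$, let $m>1$ and $n>3$ be integers, and let $t=(t_1,\dots,t_{2m})$ be a tuple of positive integers. Put $Y_0=\{1,\dots,2m\}$, $Y_1=\{2m+1,\dots,2m+n\}$, $Y=Y_0\cup Y_1$, $\pi_i=p^{t_i}-1$ for $i\in Y_0$, $\pi=(\pi_1,\dots,\pi_{2m})$ and $\mathbb A=\{\alpha\in\mathbb N_0^{2m}\mid \alpha_i\le\pi_i \text{ for all } i\}$. Let $\mathcal O(2m,n)$ be the tensor product of the divided power algebra with basis $x^{(\alpha)}$, $\alpha\in\mathbb N_0^{2m}$ (so $x^{(\alpha)}x^{(\beta)}=\binom{\alpha+\beta}{\alpha}x^{(\alpha+\beta)}$), and the exterior algebra in the variables $x_j$, $j\in Y_1$, with basis $x^u$, $u\subseteq Y_1$ (the product of the $x_j$, $j\in u$, in increasing order); the element $x^{(\alpha)}x^u$ has parity $|u| \bmod 2$ and degree $|\alpha|+|u|$. Let $\omega=Y_1$. Let $\partial_i$ $(i\in Y)$ be the partial derivatives, i.e. $\partial_i(x^{(\alpha)}x^u)=x^{(\alpha-\varepsilon_i)}x^u$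 for $i\in Y_0$ (zero if $\alpha_i=0$), and $\partial_i$ is the left odd derivative with respect to $x_i$ for $i\in Y_1$; put $\mu(i)=0$ for $i\in Y_0$ and $\mu(i)=1$ for $i\in Y_1$. Let $\mathcal O(2m,n;t)$ be the span of the $x^{(\alpha)}x^u$ with $\alpha\in\mathbb A$. Let $\mathcal W$ be the Lie algebra (under the commutator) of all even operators $\sum_{i\in Y}a_i\partial_i$, that is, with $a_i\in\mathcal O(2m,n;t)$ of parity $\mu(i)$ (the even part of the generalized Witt superalgebra $W(2m,n;t)$). It is $\mathbb Z$-graded, $\mathcal W_{[d]}$ consisting of those $\sum_i a_i\partial_i$ in which every $a_i$ is homogeneous of degree $d+1$. For homogeneous $f\in\mathcal O(2m,n)$ of parity $\mathrm p(f)$ put $$D_H(f)=\sum_{i\in Y}\tau(i)(-1)^{\mu(i)\mathrm p(f)}\,\partial_i(f)\,\partial_{i'},$$ where $i'=i+m$, $\tau(i)=1$ for $1\le i\le m$; $i'=i-m$, $\tau(i)=-1$ for $m<i\le 2m$; and $i'=i$, $\tau(i)=1$ for $i\in Y_1$. Let $$\mathfrak N=\mathrm{span}_{\mathbb F}\{D_H(x^{(\alpha)}x^u)\mid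 \alpha\in\mathbb A,\ |u|\text{ even},\ (\alpha,u)\ne(\pi,\omega),\ (\alpha,u)\ne(\pi,\emptyset)\},$$ a graded Lie subalgebra of $\mathcal W$ with $\mathfrak N_{[i]}=\mathfrak N\cap\mathcal W_{[i]}$. Let $\mathrm{Der}(\mathfrak N,\mathcal W)$ be the space of linear maps $D:\mathfrak N\to\mathcal W$ with $D([x,y])=[x,D(y)]-[y,D(x)]$ for all $x,y\in\mathfrak N$. Let $\mathrm{Der}_{[r]}(\mathfrak N,\mathcal W)$ be the subspace of those $D$ with $D(\mathfrak N_{[i]})\subseteq\mathcal W_{[r+i]}$ for all $i\in\mathbb Z$, and put $\mathrm{Der}^-(\mathfrak N,\mathcal W)=\bigoplus_{r\le-1}\mathrm{Der}_{[r]}(\mathfrak N,\mathcal W)$. All $\mathrm{ad}\,w$ $(w\in\mathcal W)$ and $(\mathrm{ad}\,\partial_r)^{p^s}$ below are restricted to maps $\mathfrak N\to\mathcal W$. If $n$ is even, define for $r\in Y_0$ and $s\ge1$ the linear maps $\mathfrak N\to\mathcal W$ $$\Phi_r^{(s)}:D_H(f)\mapsto\partial_r^{p^s}(f)\,D_H(x^\omega),\qquad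 \Theta_r^{(s)}:D\mapsto x^\omega\,(\mathrm{ad}\,\partial_r)^{p^s}(D),$$ where $f$ runs over the span of the $x^{(\alpha)}x^u$ in the definition of $\mathfrak N$. **Theorem.** If $n$ is even, then $$\mathrm{Der}^-(\mathfrak N,\mathcal W)=\mathrm{ad}\,\mathcal W_{[-1]}+\sum_{r\in Y_0}\ \sum_{\substack{1\le s\le t_r-1\\ n-p^{s}<0}}\bigl(\mathbb F\,\Phi_r^{(s)}+\mathbb F\,\Theta_r^{(s)}\bigr)+\sum_{r\in Y_0}\ \sum_{1\le s\le t_r-1}\mathbb F\,(\mathrm{ad}\,\partial_r)^{p^{s}}.$$ If $n$ is odd, then $$\mathrm{Der}^-(\mathfrak N,\mathcal W)=\mathrm{ad}\,\mathcal W_{[-1]}+\sum_{r\in Y_0}\ \sum_{1\le s\le t_r-1}\mathbb F\,(\mathrm{ad}\,\partial_r)^{p^{s}}.$$ -/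

import Mathlib

namespace HamSuper

open Finset

/-! ### The index sets and the superalgebra `𝒪(2m,n)` -/

/-- The even index set `Y₀`, of size `2m`: `Sum.inl i` is the index `i` and
`Sum.inr i` is the index `i' = i + m`, for `1 ≤ i ≤ m`. -/
abbrev Y0 (m : ℕ) : Type := Fin m ⊕ Fin m

/-- The full index set `Y = Y₀ ∪ Y₁`, where `Y₁ = Fin n` numbers the odd variables. -/
abbrev Y (m n : ℕ) : Type := Y0 m ⊕ Fin n

/-- The index set of the standard basis: `(α, u)` stands for `x^(α) x^u`. -/
abbrev Idx (m n : ℕ) : Type := (Y0 m → ℕ) × Finset (Fin n)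

/-- The space `𝒪(2m,n)`, the tensor product of the divided power algebra in `2m` variables and
the exterior algebra in `n` variables, with basis `x^(α) x^u`. Its product is `mulO` below. -/
abbrev O (F : Type*) [Field F] (m n : ℕ) : Type _ := Idx m n →₀ F

/-- `x^u x^v = sgn u v • x^(u ∪ v)` in the exterior algebra: the sign is `-1` to the number of
pairs that have to be swapped, and it is `0` if a variable occurs twice. -/
def sgn {n : ℕ} (u v : Finset (Fin n)) : ℤ :=
  if Disjoint u v then (-1) ^ #{x ∈ u ×ˢ v | x.2 < x.1} else 0

/-- The multi-binomial coefficient `(α + β choose α)`. -/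
def binom {m : ℕ} (α β : Y0 m → ℕ) : ℕ := ∏ i, (α i + β i).choose (α i)

section
variable {F : Type*} [Field F] {m n : ℕ}

/-- The basis element `x^(α) x^u`. -/
noncomputable def mono (a : Idx m n) : O F m n := Finsupp.single a 1

/-- The product of `𝒪(2m,n)`, as a bilinear map; `mulO f` is left multiplication by `f`. -/
noncomputable def mulO : O F m n →ₗ[F] O F m n →ₗ[F] O F m n :=
  Finsupp.linearCombination F fun a : Idx m n =>
    Finsupp.linearCombination F fun b : Idx m n =>
      ((binom a.1 b.1 : F) * ((sgn a.2 b.2 : ℤ) : F)) • mono (a.1 + b.1, a.2 ∪ b.2)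

/-- The parity automorphism, `f ↦ (-1)^p(f) f` on homogeneous elements. -/
noncomputable def par : Module.End F (O F m n) :=
  Finsupp.linearCombination F fun a : Idx m n => ((-1 : F) ^ #a.2) • mono a

/-- The partial derivative with respect to an even variable: `x^(α) x^u ↦ x^(α - ε_i) x^u`
(zero if `α i = 0`). -/
noncomputable def dEven (i : Y0 m) : Module.End F (O F m n) :=
  Finsupp.linearCombination F fun a : Idx m n =>
    if a.1 i = 0 then 0 else mono (Function.update a.1 i (a.1 i - 1), a.2)

/-- The (left) partial derivative with respect to an odd variable. -/
noncomputable def dOdd (k : Fin n) : Module.End F (O F m n) :=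
  Finsupp.linearCombination F fun a : Idx m n =>
    if k ∈ a.2 then ((-1 : F) ^ #{l ∈ a.2 | l < k}) • mono (a.1, a.2.erase k) else 0

/-- The partial derivatives `∂_i`, `i ∈ Y`. -/
noncomputable def pd : Y m n → Module.End F (O F m n) := Sum.elim dEven dOdd

/-- The parity of the index `i ∈ Y`. -/
def mu : Y m n → ZMod 2 := Sum.elim (fun _ => 0) (fun _ => 1)

/-- The involution `i ↦ i'` of `Y`. -/
def prm : Y m n → Y m n := Sum.map Sum.swap id

/-- The signs `τ(i)`. -/
def tau : Y m n → ℤ := Sum.elim (Sum.elim (fun _ => 1) (fun _ => -1)) (fun _ => 1)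

/-- `f ↦ (-1)^(μ(i) p(f)) f` on homogeneous elements. -/
noncomputable def sg : Y m n → Module.End F (O F m n) := Sum.elim (fun _ => 1) (fun _ => par)

/-- The vector field `∑ i, f i ∂_i` with coefficients `f`, as an endomorphism of `𝒪(2m,n)`. -/
noncomputable def vf : (Y m n → O F m n) →ₗ[F] Module.End F (O F m n) :=
  ∑ i, LinearMap.mulRight F (pd i) ∘ₗ mulO ∘ₗ LinearMap.proj i

/-- The linear map `D_H`, `D_H(f) = ∑ i, τ(i) (-1)^(μ(i) p(f)) ∂_i(f) ∂_{i'}`. -/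
noncomputable def DH : O F m n →ₗ[F] Module.End F (O F m n) :=
  ∑ i : Y m n, tau i • (LinearMap.mulRight F (pd (prm i)) ∘ₗ mulO ∘ₗ pd i ∘ₗ sg i)

end

/-! ### Basic identities in `𝒪(2m,n)` -/

section
variable {F : Type*} [Field F] {m n : ℕ}

lemma mulO_mono (a b : Idx m n) : mulO (mono a) (mono b : O F m n) =
    ((binom a.1 b.1 : F) * ((sgn a.2 b.2 : ℤ) : F)) • mono (a.1 + b.1, a.2 ∪ b.2) := by
  simp [mulO, mono, Finsupp.linearCombination_single]

lemma par_mono (a : Idx m n) : par (mono a : O F m n) = ((-1 : F) ^ #a.2) • mono a := by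
  simp [par, mono, Finsupp.linearCombination_single]

lemma dEven_mono (i : Y0 m) (a : Idx m n) : dEven i (mono a : O F m n) =
    if a.1 i = 0 then 0 else mono (Function.update a.1 i (a.1 i - 1), a.2) := by
  simp [dEven, mono, Finsupp.linearCombination_single]

lemma dOdd_mono (k : Fin n) (a : Idx m n) : dOdd k (mono a : O F m n) =
    if k ∈ a.2 then ((-1 : F) ^ #{l ∈ a.2 | l < k}) • mono (a.1, a.2.erase k) else 0 := by
  simp [dOdd, mono, Finsupp.linearCombination_single]

lemma mono_induction {P : O F m n → Prop} (f : O F m n) (h0 : P 0)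
    (hadd : ∀ f g, P f → P g → P (f + g)) (hsmul : ∀ (c : F) a, P (c • mono a)) : P f := by
  induction f using Finsupp.induction_linear with
  | zero => exact h0
  | add f g hf hg => exact hadd f g hf hg
  | single a c =>
    have := hsmul c a
    simpa [mono] using this

lemma sgn_assoc (u v w : Finset (Fin n)) :
    sgn u v * sgn (u ∪ v) w = sgn v w * sgn u (v ∪ w) := by
  unfold sgn
  simp only [disjoint_union_left, disjoint_union_right]
  by_cases h1 : Disjoint u v <;> by_cases h2 : Disjoint u w <;> by_cases h3 : Disjoint v w <;>
    simp only [h1, h2, h3, if_true, if_false, and_self, and_true, and_false,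
      mul_zero, zero_mul]
  rw [← pow_add, ← pow_add]
  congr 1
  have e1 : #{x ∈ (u ∪ v) ×ˢ w | x.2 < x.1}
      = #{x ∈ u ×ˢ w | x.2 < x.1} + #{x ∈ v ×ˢ w | x.2 < x.1} := by
    rw [union_product, filter_union, card_union_of_disjoint]
    exact disjoint_filter_filter (disjoint_product.2 (Or.inl h1))
  have e2 : #{x ∈ u ×ˢ (v ∪ w) | x.2 < x.1}
      = #{x ∈ u ×ˢ v | x.2 < x.1} + #{x ∈ u ×ˢ w | x.2 < x.1} := by
    rw [product_union, filter_union, card_union_of_disjoint]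
    exact disjoint_filter_filter (disjoint_product.2 (Or.inr h3))
  rw [e1, e2]; ring

lemma binom_assoc (α β γ : Y0 m → ℕ) :
    binom α β * binom (α + β) γ = binom β γ * binom α (β + γ) := by
  unfold binom
  rw [← prod_mul_distrib, ← prod_mul_distrib]
  refine prod_congr rfl fun i _ => ?_
  simp only [Pi.add_apply]
  generalize α i = a; generalize β i = b; generalize γ i = c
  have h := Nat.choose_mul (n := a + b + c) (k := a + b) (s := a)
  rw [show a + b + c - a = b + c by omega, show a + b - a = b by omega] at h
  rw [show a + (b + c) = a + b + c by ring]
  nlinarith [h (by omega)]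

lemma mulO_assoc (f g h : O F m n) : mulO (mulO f g) h = mulO f (mulO g h) := by
  induction f using mono_induction with
  | h0 => simp
  | hadd f f' h1 h2 => simp [h1, h2]
  | hsmul c a =>
  induction g using mono_induction with
  | h0 => simp
  | hadd f f' h1 h2 => simp only [map_add, LinearMap.add_apply, h1, h2]
  | hsmul c' b =>
  induction h using mono_induction with
  | h0 => simp
  | hadd f f' h1 h2 => simp only [map_add, h1, h2]
  | hsmul c'' d =>
  simp only [map_smul, LinearMap.smul_apply, mulO_mono, smul_smul, add_assoc, union_assoc]
  congr 1
  have e1 : (binom a.1 b.1 : F) * binom (a.1 + b.1) d.1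
      = binom b.1 d.1 * binom a.1 (b.1 + d.1) := by
    rw [← Nat.cast_mul, ← Nat.cast_mul, binom_assoc]
  have e2 : ((sgn a.2 b.2 : ℤ) : F) * (sgn (a.2 ∪ b.2) d.2 : ℤ)
      = (sgn b.2 d.2 : ℤ) * (sgn a.2 (b.2 ∪ d.2) : ℤ) := by
    rw [← Int.cast_mul, ← Int.cast_mul, sgn_assoc]
  linear_combination (c * c' * c'' * (sgn a.2 b.2 : ℤ) * (sgn (a.2 ∪ b.2) d.2 : ℤ)) * e1
    + (c * c' * c'' * (binom b.1 d.1 : F) * binom a.1 (b.1 + d.1)) * e2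

lemma sgn_comm (u v : Finset (Fin n)) : sgn u v = (-1) ^ (#u * #v) * sgn v u := by
  unfold sgn
  by_cases h : Disjoint u v
  · rw [if_pos h, if_pos h.symm, ← card_product, ← card_filter_add_card_filter_not
      (s := u ×ˢ v) (fun x => x.2 < x.1), pow_add, mul_assoc, ← pow_add]
    have : #{x ∈ u ×ˢ v | ¬ x.2 < x.1} = #{x ∈ v ×ˢ u | x.2 < x.1} := by
      refine card_bij (fun x _ => (x.2, x.1)) ?_ ?_ ?_
      · rintro ⟨a, b⟩ hx
        simp only [mem_filter, mem_product, not_lt] at hx ⊢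
        refine ⟨⟨hx.1.2, hx.1.1⟩, lt_of_le_of_ne hx.2 ?_⟩
        rintro rfl
        exact disjoint_left.1 h hx.1.1 hx.1.2
      · rintro ⟨a, b⟩ _ ⟨c, d⟩ _ hx
        simp only [Prod.mk.injEq] at hx ⊢
        exact ⟨hx.2, hx.1⟩
      · rintro ⟨a, b⟩ hx
        simp only [mem_filter, mem_product] at hx
        exact ⟨(b, a), by simp [hx.1.1, hx.1.2, hx.2.le], rfl⟩
    rw [this, ← two_mul, pow_mul]; simp
  · rw [if_neg h, if_neg (fun h' => h h'.symm)]; simp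

lemma binom_comm (α β : Y0 m → ℕ) : binom α β = binom β α := by
  unfold binom
  refine prod_congr rfl fun i _ => ?_
  rw [add_comm (β i), Nat.choose_symm_add]

lemma mulO_mono_comm (a b : Idx m n) : mulO (mono a) (mono b : O F m n) =
    ((-1 : F) ^ (#a.2 * #b.2)) • mulO (mono b) (mono a) := by
  rw [mulO_mono, mulO_mono, smul_smul, sgn_comm a.2 b.2, binom_comm, add_comm, union_comm]
  congr 1
  push_cast; ring

lemma mulO_par_comm (f g : O F m n) : mulO (par f) (par g) = par (mulO f g) := by
  induction f using mono_induction with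
  | h0 => simp
  | hadd f f' h1 h2 => simp only [map_add, LinearMap.add_apply, h1, h2]
  | hsmul c a =>
  induction g using mono_induction with
  | h0 => simp
  | hadd f f' h1 h2 => simp only [map_add, h1, h2]
  | hsmul c' b =>
  simp only [map_smul, LinearMap.smul_apply, mulO_mono, par_mono, smul_smul]
  by_cases h : Disjoint a.2 b.2
  · congr 1
    rw [card_union_of_disjoint h, pow_add]; ring
  · simp [sgn, h]

lemma par_par (f : O F m n) : par (par f) = f := by
  induction f using mono_induction with
  | h0 => simp
  | hadd f f' h1 h2 => simp only [map_add, h1, h2]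
  | hsmul c a =>
  simp only [map_smul, par_mono, smul_smul, ← pow_add, ← two_mul, mul_assoc]
  simp [pow_mul]

lemma binom_update_left (α β : Y0 m → ℕ) (i : Y0 m) (x : ℕ) :
    binom (Function.update α i x) β
      = (x + β i).choose x * ∏ j ∈ univ.erase i, (α j + β j).choose (α j) := by
  unfold binom
  rw [← mul_prod_erase univ _ (mem_univ i)]
  congr 1
  · simp
  · refine prod_congr rfl fun j hj => ?_
    rw [Function.update_of_ne (ne_of_mem_erase hj)]

lemma binom_update_right (α β : Y0 m → ℕ) (i : Y0 m) (x : ℕ) :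
    binom α (Function.update β i x)
      = (α i + x).choose (α i) * ∏ j ∈ univ.erase i, (α j + β j).choose (α j) := by
  unfold binom
  rw [← mul_prod_erase univ _ (mem_univ i)]
  congr 1
  · simp
  · refine prod_congr rfl fun j hj => ?_
    rw [Function.update_of_ne (ne_of_mem_erase hj)]

lemma binom_split (α β : Y0 m → ℕ) (i : Y0 m) :
    binom α β
      = (α i + β i).choose (α i) * ∏ j ∈ univ.erase i, (α j + β j).choose (α j) := by
  unfold binom
  rw [← mul_prod_erase univ _ (mem_univ i)]

lemma update_add_left (α β : Y0 m → ℕ) (i : Y0 m) (h : α i ≠ 0) :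
    Function.update α i (α i - 1) + β = Function.update (α + β) i ((α + β) i - 1) := by
  ext j
  by_cases hj : j = i
  · subst hj; simp; omega
  · simp [hj]

lemma update_add_right (α β : Y0 m → ℕ) (i : Y0 m) (h : β i ≠ 0) :
    α + Function.update β i (β i - 1) = Function.update (α + β) i ((α + β) i - 1) := by
  rw [add_comm, update_add_left β α i h, add_comm]

lemma dEven_mul (i : Y0 m) (f g : O F m n) :
    dEven i (mulO f g) = mulO (dEven i f) g + mulO f (dEven i g) := by
  induction f using mono_induction with
  | h0 => simp
  | hadd f f' h1 h2 => simp only [map_add, LinearMap.add_apply, h1, h2]; abel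
  | hsmul c a =>
  induction g using mono_induction with
  | h0 => simp
  | hadd f f' h1 h2 => simp only [map_add, h1, h2]; abel
  | hsmul c' b =>
  obtain ⟨α, u⟩ := a
  obtain ⟨β, v⟩ := b
  simp only [map_smul, LinearMap.smul_apply, ← smul_add]
  congr 2
  rw [mulO_mono, map_smul, dEven_mono, dEven_mono, dEven_mono]
  simp only [Pi.add_apply]
  by_cases ha : α i = 0
  · by_cases hb : β i = 0
    · simp [ha, hb]
    · rw [if_neg (by omega), if_pos ha, if_neg hb, mulO_mono]
      simp only [map_zero, LinearMap.zero_apply, zero_add, update_add_right α β i hb,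
        Pi.add_apply]
      rw [binom_update_right, binom_split α β i, ha]
      simp
  · by_cases hb : β i = 0
    · rw [if_neg (by omega), if_neg ha, if_pos hb, mulO_mono]
      simp only [map_zero, add_zero, update_add_left α β i ha, Pi.add_apply]
      rw [binom_update_left, binom_split α β i, hb]
      simp
    · rw [if_neg (by omega), if_neg ha, if_neg hb, mulO_mono, mulO_mono]
      simp only [update_add_left α β i ha, update_add_right α β i hb, Pi.add_apply]
      rw [← add_smul, binom_update_left, binom_update_right, binom_split α β i]
      congr 1
      obtain ⟨x, hx⟩ := Nat.exists_eq_succ_of_ne_zero ha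
      obtain ⟨y, hy⟩ := Nat.exists_eq_succ_of_ne_zero hb
      rw [hx, hy]
      have : (x.succ + y.succ).choose x.succ
          = (x.succ - 1 + y.succ).choose (x.succ - 1)
            + (x.succ + (y.succ - 1)).choose x.succ := by
        rw [show x.succ + y.succ = (x + y.succ) + 1 by omega, Nat.succ_eq_add_one x,
          Nat.choose_succ_succ]
        congr 2
        simp; omega
      rw [this]
      push_cast; ring

lemma sgn_insert_left {k : Fin n} {u v : Finset (Fin n)} (hu : k ∉ u) :
    sgn (insert k u) v = if k ∈ v then 0 else (-1) ^ #{l ∈ v | l < k} * sgn u v := by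
  unfold sgn
  by_cases hv : k ∈ v
  · rw [if_neg (by simp [hv]), if_pos hv]
  · rw [if_neg hv]
    by_cases h : Disjoint u v
    · rw [if_pos (by simp [hv, h]), if_pos h, ← pow_add]
      congr 1
      rw [insert_eq, union_product, filter_union, card_union_of_disjoint
        (disjoint_filter_filter (disjoint_product.2 (Or.inl (by simpa using hu))))]
      congr 1
      refine card_bij (fun x _ => x.2) ?_ ?_ ?_
      · rintro ⟨a, b⟩ hx
        simp only [mem_filter, mem_product, mem_singleton] at hx ⊢
        exact ⟨hx.1.2, hx.1.1 ▸ hx.2⟩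
      · rintro ⟨a, b⟩ hx ⟨c, d⟩ hy he
        simp only [mem_filter, mem_product, mem_singleton] at hx hy he ⊢
        rw [hx.1.1, hy.1.1, he]
      · intro b hb
        simp only [mem_filter] at hb
        exact ⟨(k, b), by simp [hb.1, hb.2], rfl⟩
    · rw [if_neg (by simp [h]), if_neg h, mul_zero]

lemma card_lt_add_card_gt {k : Fin n} {u : Finset (Fin n)} (hu : k ∉ u) :
    #{l ∈ u | l < k} + #{l ∈ u | k < l} = #u := by
  rw [← card_filter_add_card_filter_not (s := u) (fun l => l < k)]
  congr 2
  refine filter_congr fun l hl => ?_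
  have : l ≠ k := by rintro rfl; exact hu hl
  simp only [not_lt]
  exact ⟨le_of_lt, fun h => lt_of_le_of_ne h this.symm⟩

lemma sgn_insert_right {k : Fin n} {u v : Finset (Fin n)} (hv : k ∉ v) :
    sgn u (insert k v) = if k ∈ u then 0 else (-1) ^ #{l ∈ u | k < l} * sgn u v := by
  rw [sgn_comm, sgn_insert_left hv, sgn_comm u v, card_insert_of_notMem hv]
  by_cases hu : k ∈ u
  · simp [hu]
  · simp only [hu, if_false]
    rw [← card_lt_add_card_gt hu]
    have h2 : ((-1 : ℤ) ^ #{l ∈ u | l < k}) * (-1) ^ #{l ∈ u | l < k} = 1 := by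
      rw [← pow_add, ← two_mul, pow_mul]; simp
    rw [mul_add, mul_one, pow_add, pow_add]
    linear_combination ((-1) ^ ((#{l ∈ u | l < k} + #{l ∈ u | k < l}) * #v)
      * (-1) ^ #{l ∈ u | k < l} * sgn v u) * h2

lemma dOdd_mono_insert {k : Fin n} {α : Y0 m → ℕ} {u : Finset (Fin n)} (hu : k ∉ u) :
    dOdd k (mono (α, insert k u) : O F m n) = ((-1 : F) ^ #{l ∈ u | l < k}) • mono (α, u) := by
  rw [dOdd_mono, if_pos (mem_insert_self _ _)]
  simp only [erase_insert hu, filter_insert, lt_irrefl, if_false]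

lemma dOdd_mono_of_notMem {k : Fin n} {α : Y0 m → ℕ} {u : Finset (Fin n)} (hu : k ∉ u) :
    dOdd k (mono (α, u) : O F m n) = 0 := by
  rw [dOdd_mono, if_neg hu]

lemma neg_one_sq_pow (a : ℕ) : ((-1 : F) ^ a) * (-1) ^ a = 1 := by
  rw [← pow_add, ← two_mul, pow_mul]; simp

lemma card_filter_union_of_sgn_ne {k : Fin n} {u v : Finset (Fin n)} (h : Disjoint u v) :
    #{l ∈ u ∪ v | l < k} = #{l ∈ u | l < k} + #{l ∈ v | l < k} := by
  rw [filter_union, card_union_of_disjoint (disjoint_filter_filter h)]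

lemma dOdd_mul (k : Fin n) (f g : O F m n) :
    dOdd k (mulO f g) = mulO (dOdd k f) g + mulO (par f) (dOdd k g) := by
  induction f using mono_induction with
  | h0 => simp
  | hadd f f' h1 h2 => simp only [map_add, LinearMap.add_apply, h1, h2]; abel
  | hsmul c a =>
  induction g using mono_induction with
  | h0 => simp
  | hadd f f' h1 h2 => simp only [map_add, h1, h2]; abel
  | hsmul c' b =>
  obtain ⟨α, u⟩ := a
  obtain ⟨β, v⟩ := b
  simp only [map_smul, LinearMap.smul_apply, ← smul_add]
  congr 2
  rw [par_mono, mulO_mono, map_smul, map_smul, LinearMap.smul_apply]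
  by_cases hu : k ∈ u
  · obtain ⟨u, hu', rfl⟩ : ∃ w, k ∉ w ∧ u = insert k w :=
      ⟨u.erase k, notMem_erase _ _, (insert_erase hu).symm⟩
    by_cases hv : k ∈ v
    · obtain ⟨v, hv', rfl⟩ : ∃ w, k ∉ w ∧ v = insert k w :=
        ⟨v.erase k, notMem_erase _ _, (insert_erase hv).symm⟩
      rw [dOdd_mono_insert hu', dOdd_mono_insert hv', map_smul, map_smul, LinearMap.smul_apply,
        mulO_mono, mulO_mono]
      simp only [sgn_insert_left hu', sgn_insert_right hv', hu', hv', mem_insert_self, if_true,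
        if_false, smul_smul, insert_union, union_insert, card_insert_of_notMem hu']
      rw [← add_smul, ← card_lt_add_card_gt hu', pow_add, pow_add]
      push_cast
      have h := neg_one_sq_pow (F := F) #{l ∈ v | l < k}
      simp only [mul_zero, zero_smul]
      symm
      convert zero_smul F _ using 2
      linear_combination (-(-1 : F) ^ #{l ∈ u | l < k} * (-1) ^ #{l ∈ u | k < l}
        * binom α β * (sgn u v : ℤ)) * h
    · rw [dOdd_mono_insert hu', dOdd_mono_of_notMem hv, map_smul, LinearMap.smul_apply,
        mulO_mono, insert_union, dOdd_mono_insert (by simp [hu', hv])]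
      simp only [sgn_insert_left hu', hv, if_false, map_zero, smul_zero, add_zero, smul_smul]
      by_cases hd : Disjoint u v
      · rw [card_filter_union_of_sgn_ne hd]
        congr 1
        have h := neg_one_sq_pow (F := F) #{l ∈ v | l < k}
        rw [pow_add]
        push_cast
        linear_combination ((-1 : F) ^ #{l ∈ u | l < k} * binom α β * (sgn u v : ℤ)) * h
      · simp [sgn, hd]
  · by_cases hv : k ∈ v
    · obtain ⟨v, hv', rfl⟩ : ∃ w, k ∉ w ∧ v = insert k w :=
        ⟨v.erase k, notMem_erase _ _, (insert_erase hv).symm⟩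
      rw [dOdd_mono_insert hv', dOdd_mono_of_notMem hu, map_smul,
        mulO_mono, union_insert, dOdd_mono_insert (by simp [hu, hv'])]
      simp only [sgn_insert_right hv', hu, if_false, map_zero, LinearMap.zero_apply, zero_add,
        smul_smul]
      by_cases hd : Disjoint u v
      · rw [card_filter_union_of_sgn_ne hd, ← card_lt_add_card_gt hu]
        congr 1
        rw [pow_add, pow_add]
        push_cast
        ring
      · simp [sgn, hd]
    · rw [dOdd_mono_of_notMem hv, dOdd_mono_of_notMem hu, dOdd_mono_of_notMem (by simp [hu, hv])]
      simp

lemma dOdd_dOdd (k l : Fin n) (f : O F m n) : dOdd k (dOdd l f) = - dOdd l (dOdd k f) := by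
  induction f using mono_induction with
  | h0 => simp
  | hadd f f' h1 h2 => simp only [map_add, h1, h2]; abel
  | hsmul c a =>
  obtain ⟨α, u⟩ := a
  simp only [map_smul, ← smul_neg]
  congr 1
  by_cases hkl : k = l
  · subst hkl
    have : dOdd k (dOdd k (mono (α, u) : O F m n)) = 0 := by
      rw [dOdd_mono]
      split_ifs
      · rw [map_smul, dOdd_mono_of_notMem (notMem_erase _ _), smul_zero]
      · simp
    simp [this]
  by_cases hk : k ∈ u
  · by_cases hl : l ∈ u
    · obtain ⟨u, hku, hlu, rfl⟩ : ∃ w, k ∉ w ∧ l ∉ w ∧ u = insert k (insert l w) := by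
        refine ⟨(u.erase k).erase l, by simp, by simp, ?_⟩
        rw [insert_erase, insert_erase hk]
        exact mem_erase.2 ⟨Ne.symm hkl, hl⟩
      rw [dOdd_mono_insert (by simp [hkl, hku]), insert_comm,
        dOdd_mono_insert (by simp [Ne.symm hkl, hlu]), map_smul, map_smul, dOdd_mono_insert hku,
        dOdd_mono_insert hlu, smul_smul, smul_smul, ← neg_smul]
      congr 1
      simp only [filter_insert]
      rcases lt_or_gt_of_ne hkl with h | h
      · rw [if_pos h, if_neg (not_lt.2 h.le), card_insert_of_notMem (by simp [hku]), pow_succ]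
        ring
      · rw [if_neg (not_lt.2 h.le), if_pos h, card_insert_of_notMem (by simp [hlu]), pow_succ]
        ring
    · have h2 : l ∉ u.erase k := fun h => hl (mem_of_mem_erase h)
      rw [dOdd_mono_of_notMem hl, dOdd_mono, if_pos hk, map_smul, dOdd_mono_of_notMem h2]
      simp
  · have h2 : k ∉ u.erase l := fun h => hk (mem_of_mem_erase h)
    rw [dOdd_mono_of_notMem hk, dOdd_mono]
    split_ifs
    · rw [map_smul, dOdd_mono_of_notMem h2]; simp
    · simp

lemma dEven_dEven (i j : Y0 m) (f : O F m n) : dEven i (dEven j f) = dEven j (dEven i f) := by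
  induction f using mono_induction with
  | h0 => simp
  | hadd f f' h1 h2 => simp only [map_add, h1, h2]
  | hsmul c a =>
  obtain ⟨α, u⟩ := a
  simp only [map_smul]
  congr 1
  by_cases hij : i = j
  · subst hij; rfl
  rw [dEven_mono, dEven_mono]
  by_cases hi : α i = 0 <;> by_cases hj : α j = 0
  · simp [hi, hj]
  · simp [hi, hj, dEven_mono, hij]
  · simp [hi, hj, dEven_mono, Ne.symm hij]
  · simp only [hi, hj, if_false, dEven_mono, Function.update_of_ne hij,
      Function.update_of_ne (Ne.symm hij)]
    rw [Function.update_comm hij]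

lemma dEven_dOdd (i : Y0 m) (k : Fin n) (f : O F m n) :
    dEven i (dOdd k f) = dOdd k (dEven i f) := by
  induction f using mono_induction with
  | h0 => simp
  | hadd f f' h1 h2 => simp only [map_add, h1, h2]
  | hsmul c a =>
  obtain ⟨α, u⟩ := a
  simp only [map_smul]
  congr 1
  rw [dEven_mono, dOdd_mono]
  by_cases hi : α i = 0 <;> by_cases hk : k ∈ u
  all_goals simp [hi, hk, dEven_mono, dOdd_mono]

lemma par_dEven (i : Y0 m) (f : O F m n) : par (dEven i f) = dEven i (par f) := by
  induction f using mono_induction with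
  | h0 => simp
  | hadd f f' h1 h2 => simp only [map_add, h1, h2]
  | hsmul c a =>
  simp only [map_smul]
  congr 1
  rw [dEven_mono, par_mono, map_smul, dEven_mono]
  split_ifs
  · simp
  · rw [par_mono]

lemma mulO_pd (i : Y m n) (f g : O F m n) :
    pd i (mulO f g) = mulO (pd i f) g + mulO (sg i f) (pd i g) := by
  rcases i with i | k
  · exact dEven_mul i f g
  · exact dOdd_mul k f g

/-- The sign `-1` for two odd indices, and `1` otherwise. -/
def eps (i j : Y m n) : ℤ := Sum.elim (fun _ => 1) (fun _ => Sum.elim (fun _ => 1) (fun _ => -1) j) i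

lemma eps_comm (i j : Y m n) : eps i j = eps j i := by
  rcases i with i | k <;> rcases j with j | l <;> rfl

lemma pd_pd (i j : Y m n) (f : O F m n) : pd i (pd j f) = eps i j • pd j (pd i f) := by
  rcases i with i | k <;> rcases j with j | l
  · simpa [pd, eps] using dEven_dEven i j f
  · simpa [pd, eps] using dEven_dOdd i l f
  · simpa [pd, eps] using (dEven_dOdd j k f).symm
  · simpa [pd, eps] using dOdd_dOdd k l f

lemma vf_apply (f : Y m n → O F m n) (g : O F m n) :
    vf f g = ∑ i, mulO (f i) (pd i g) := by
  simp [vf, LinearMap.sum_apply]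

lemma DH_apply (f g : O F m n) :
    DH f g = ∑ i, tau i • mulO (pd i (sg i f)) (pd (prm i) g) := by
  simp [DH, LinearMap.sum_apply]

/-- The span of the basis elements `x^(α) x^u` with `(α, u) ∈ S`. -/
noncomputable def mspan (F : Type*) [Field F] {m n : ℕ} (S : Set (Idx m n)) :
    Submodule F (O F m n) := Submodule.span F (mono '' S)

lemma mspan_eq (S : Set (Idx m n)) : mspan F S = Finsupp.supported F F S :=
  (Finsupp.supported_eq_span_single F S).symm

lemma mono_mem {S : Set (Idx m n)} {a : Idx m n} (h : a ∈ S) : (mono a : O F m n) ∈ mspan F S :=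
  Submodule.subset_span ⟨a, h, rfl⟩

lemma mspan_mono {S T : Set (Idx m n)} (h : S ⊆ T) : mspan F S ≤ mspan F T :=
  Submodule.span_mono (Set.image_mono h)

lemma mspan_map {S T : Set (Idx m n)} (L : Module.End F (O F m n))
    (h : ∀ a ∈ S, L (mono a) ∈ mspan F T) {f : O F m n} (hf : f ∈ mspan F S) :
    L f ∈ mspan F T := by
  have : mspan F S ≤ (mspan F T).comap L := by
    refine Submodule.span_le.2 ?_
    rintro _ ⟨a, ha, rfl⟩
    exact h a ha
  exact this hf

lemma mspan_mul {S T R : Set (Idx m n)}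
    (h : ∀ a ∈ S, ∀ b ∈ T, (binom a.1 b.1 : F) ≠ 0 → Disjoint a.2 b.2 →
      (a.1 + b.1, a.2 ∪ b.2) ∈ R)
    {f g : O F m n} (hf : f ∈ mspan F S) (hg : g ∈ mspan F T) : mulO f g ∈ mspan F R := by
  refine mspan_map (S := T) (T := R) (mulO f) (fun b hb => ?_) hg
  refine mspan_map (S := S) (T := R) (mulO.flip (mono b)) (fun a ha => ?_) hf
  rw [LinearMap.flip_apply, mulO_mono]
  by_cases h1 : (binom a.1 b.1 : F) = 0
  · simp [h1]
  by_cases h2 : Disjoint a.2 b.2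
  · exact Submodule.smul_mem _ _ (mono_mem (h a ha b hb h1 h2))
  · simp [sgn, h2]

lemma mspan_dEven {S R : Set (Idx m n)} (i : Y0 m)
    (h : ∀ a ∈ S, a.1 i ≠ 0 → (Function.update a.1 i (a.1 i - 1), a.2) ∈ R)
    {f : O F m n} (hf : f ∈ mspan F S) : dEven i f ∈ mspan F R := by
  refine mspan_map _ (fun a ha => ?_) hf
  rw [dEven_mono]
  split_ifs with h0
  · exact zero_mem _
  · exact mono_mem (h a ha h0)

lemma mspan_dOdd {S R : Set (Idx m n)} (k : Fin n)
    (h : ∀ a ∈ S, k ∈ a.2 → (a.1, a.2.erase k) ∈ R)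
    {f : O F m n} (hf : f ∈ mspan F S) : dOdd k f ∈ mspan F R := by
  refine mspan_map _ (fun a ha => ?_) hf
  rw [dOdd_mono]
  split_ifs with h0
  · exact Submodule.smul_mem _ _ (mono_mem (h a ha h0))
  · exact zero_mem _

/-- The pairs `(α, u)` for which `x^u` has parity `θ`. -/
def parSet (m n : ℕ) (θ : ZMod 2) : Set (Idx m n) := {a | (#a.2 : ZMod 2) = θ}

/-- The pairs `(α, u)` with `α ∈ 𝔸`, that is, `α i ≤ π i = p^(t i) - 1` for all `i`. -/
def truncSet (p : ℕ) {m : ℕ} (t : Y0 m → ℕ+) (n : ℕ) : Set (Idx m n) :=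
  {a | ∀ i, a.1 i ≤ p ^ (t i : ℕ) - 1}

/-- The pairs `(α, u)` for which `x^(α) x^u` has degree `|α| + |u| = d`. -/
def degSet (m n : ℕ) (d : ℤ) : Set (Idx m n) := {a | ((∑ i, a.1 i + #a.2 : ℕ) : ℤ) = d}

lemma par_of_mem {θ : ZMod 2} {f : O F m n} (hf : f ∈ mspan F (parSet m n θ)) :
    par f = ((-1 : F) ^ θ.val) • f := by
  have : mspan F (parSet m n θ) ≤ LinearMap.ker (par - ((-1 : F) ^ θ.val) • LinearMap.id) := by
    refine Submodule.span_le.2 ?_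
    rintro _ ⟨a, ha, rfl⟩
    have ha' : (#a.2 : ZMod 2) = θ := ha
    simp only [SetLike.mem_coe, LinearMap.mem_ker, LinearMap.sub_apply, par_mono,
      LinearMap.smul_apply, LinearMap.id_apply]
    rw [← ha', ZMod.val_natCast, ← neg_one_pow_eq_pow_mod_two, sub_self]
  have h := this hf
  simpa [sub_eq_zero] using h

lemma par_even {f : O F m n} (hf : f ∈ mspan F (parSet m n 0)) : par f = f := by
  simpa using par_of_mem hf

lemma par_odd {f : O F m n} (hf : f ∈ mspan F (parSet m n 1)) : par f = -f := by
  simpa [ZMod.val_one] using par_of_mem hf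

lemma sg_even {f : O F m n} (hf : f ∈ mspan F (parSet m n 0)) (i : Y m n) : sg i f = f := by
  rcases i with i | k
  · rfl
  · exact par_even hf

lemma mulO_even_comm {f : O F m n} (hf : f ∈ mspan F (parSet m n 0)) (g : O F m n) :
    mulO f g = mulO g f := by
  have : mspan F (parSet m n 0) ≤ LinearMap.ker ((mulO : O F m n →ₗ[F] _).flip g - mulO g) := by
    refine Submodule.span_le.2 ?_
    rintro _ ⟨a, ha, rfl⟩
    have ha' : (#a.2 : ZMod 2) = 0 := ha
    rw [ZMod.natCast_eq_zero_iff_even] at ha'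
    simp only [SetLike.mem_coe, LinearMap.mem_ker, LinearMap.sub_apply, LinearMap.flip_apply]
    induction g using mono_induction with
    | h0 => simp
    | hadd f f' h1 h2 =>
      simp only [map_add, LinearMap.add_apply]
      rw [add_sub_add_comm, h1, h2, add_zero]
    | hsmul c b =>
      simp only [map_smul, LinearMap.smul_apply]
      rw [mulO_mono_comm a b, (ha'.mul_right _).neg_one_pow, one_smul, sub_self]
  have h := this hf
  simpa [sub_eq_zero] using h

lemma mulO_odd_comm {f : O F m n} (hf : f ∈ mspan F (parSet m n 1)) (g : O F m n) :
    mulO f g = mulO (par g) f := by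
  have : mspan F (parSet m n 1) ≤
      LinearMap.ker ((mulO : O F m n →ₗ[F] _).flip g - mulO (par g)) := by
    refine Submodule.span_le.2 ?_
    rintro _ ⟨a, ha, rfl⟩
    have ha' : (#a.2 : ZMod 2) = 1 := ha
    rw [ZMod.natCast_eq_one_iff_odd] at ha'
    simp only [SetLike.mem_coe, LinearMap.mem_ker, LinearMap.sub_apply, LinearMap.flip_apply]
    induction g using mono_induction with
    | h0 => simp
    | hadd f f' h1 h2 =>
      simp only [map_add, LinearMap.add_apply]
      rw [add_sub_add_comm, h1, h2, add_zero]
    | hsmul c b =>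
      simp only [map_smul, LinearMap.smul_apply, par_mono]
      rw [mulO_mono_comm a b, pow_mul, ha'.neg_one_pow, sub_self]
  have h := this hf
  simpa [sub_eq_zero] using h

lemma mulO_sg {i : Y m n} {f : O F m n} (hf : f ∈ mspan F (parSet m n (mu i))) (g : O F m n) :
    mulO f (sg i g) = mulO g f := by
  rcases i with i | k
  · exact mulO_even_comm hf g
  · have := mulO_odd_comm hf (par g)
    rwa [par_par] at this

lemma mulO_eps {i j : Y m n} {f g : O F m n} (hf : f ∈ mspan F (parSet m n (mu i)))
    (hg : g ∈ mspan F (parSet m n (mu j))) : mulO f g = eps i j • mulO g f := by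
  rcases i with i | k
  · simpa [eps] using mulO_even_comm hf g
  · rcases j with j | l
    · simpa [eps] using (mulO_even_comm hg f).symm
    · have := mulO_odd_comm hf g
      rw [par_odd hg] at this
      simpa [eps] using this

/-- Coefficients `f` for which `∑ i, f i ∂_i` is even. -/
def EvenCoef (f : Y m n → O F m n) : Prop := ∀ i, f i ∈ mspan F (parSet m n (mu i))

lemma vf_mul {f : Y m n → O F m n} (hf : EvenCoef f) (a b : O F m n) :
    vf f (mulO a b) = mulO (vf f a) b + mulO a (vf f b) := by
  simp only [vf_apply, mulO_pd, map_add, map_sum, LinearMap.sum_apply]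
  rw [← sum_add_distrib]
  refine sum_congr rfl fun i _ => ?_
  rw [mulO_assoc (f i) (pd i a) b, ← mulO_assoc (f i) (sg i a), mulO_sg (hf i) a, mulO_assoc a]

lemma lie_vf {f g : Y m n → O F m n} (hf : EvenCoef f) (hg : EvenCoef g) :
    ⁅vf f, vf g⁆ = vf fun j => vf f (g j) - vf g (f j) := by
  refine LinearMap.ext fun h => ?_
  rw [Ring.lie_def, LinearMap.sub_apply, Module.End.mul_apply, Module.End.mul_apply,
    vf_apply g h, vf_apply f h, vf_apply _ h]
  simp only [map_sum, vf_mul hf, vf_mul hg, sum_add_distrib, map_sub, LinearMap.sub_apply,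
    sum_sub_distrib]
  have key : ∑ i, mulO (g i) (vf f (pd i h)) = ∑ i, mulO (f i) (vf g (pd i h)) := by
    simp only [vf_apply, map_sum]
    rw [sum_comm]
    refine sum_congr rfl fun i _ => sum_congr rfl fun j _ => ?_
    rw [← mulO_assoc, ← mulO_assoc, mulO_eps (hg j) (hf i), pd_pd i j, eps_comm j i]
    have : eps i j * eps i j = 1 := by
      rcases i with i | k <;> rcases j with j | l <;> rfl
    simp only [map_zsmul, LinearMap.smul_apply, smul_smul, this, one_smul]
  rw [key]; abel

lemma mulO_vf (a : O F m n) (f : Y m n → O F m n) : mulO a * vf f = vf fun i => mulO a (f i) := by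
  refine LinearMap.ext fun h => ?_
  simp [vf_apply, Module.End.mul_apply, mulO_assoc]

end

attribute [local instance] LieRing.ofAssociativeRing

lemma dOdd_sq {F : Type*} [Field F] {m n : ℕ} (k : Fin n) (f : O F m n) :
    dOdd k (dOdd k f) = 0 := by
  induction f using mono_induction with
  | h0 => simp
  | hadd f f' h1 h2 => simp only [map_add, h1, h2, add_zero]
  | hsmul c a =>
  rw [map_smul, map_smul, dOdd_mono]
  split_ifs
  · rw [map_smul, dOdd_mono_of_notMem (notMem_erase _ _), smul_zero, smul_zero]
  · simp

/-! ### The even part of the generalized Witt superalgebra -/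

section
variable (F : Type*) [Field F] (p : ℕ) {m : ℕ} (n : ℕ) (t : Y0 m → ℕ+)

/-- Coefficients in `𝒪(2m,n;t)` of even vector fields: the parity of `f ∂_i` is `p(f) + μ(i)`. -/
noncomputable def WCoef : Submodule F (Y m n → O F m n) :=
  Submodule.pi Set.univ fun i => mspan F (truncSet p t n ∩ parSet m n (mu i))

/-- The subspace of `WCoef` where all coefficients are homogeneous of degree `d + 1`. -/
noncomputable def WCoefDeg (d : ℤ) : Submodule F (Y m n → O F m n) :=
  Submodule.pi Set.univ fun i =>
    mspan F (truncSet p t n ∩ parSet m n (mu i) ∩ degSet m n (d + 1))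

/-- The tuple `π`, `π i = p^(t i) - 1`. -/
def piTop : Y0 m → ℕ := fun i => p ^ (t i : ℕ) - 1

/-- The pairs `(α, u)` with `α ∈ 𝔸` and `|u|` even. -/
def evenSet : Set (Idx m n) := truncSet p t n ∩ parSet m n 0

/-- The pairs `(α, u)` with `α ∈ 𝔸` and `|u|` even, except `(π, ω)` and `(π, ∅)`. -/
def NSet : Set (Idx m n) :=
  {a | a ∈ evenSet p n t ∧ a ≠ (piTop p t, Finset.univ) ∧ a ≠ (piTop p t, ∅)}

variable {F p n t}

lemma mspan_coeff {S : Set (Idx m n)} {f : O F m n} (hf : f ∈ mspan F S) {a : Idx m n}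
    (ha : a ∉ S) : f a = 0 := by
  rw [mspan_eq, Finsupp.mem_supported'] at hf
  exact hf a ha

lemma parSet_mul {a b : Idx m n} {θ η : ZMod 2} (ha : a ∈ parSet m n θ) (hb : b ∈ parSet m n η)
    (h : Disjoint a.2 b.2) : (a.1 + b.1, a.2 ∪ b.2) ∈ parSet m n (θ + η) := by
  simp only [parSet, Set.mem_ofPred_eq] at *
  rw [card_union_of_disjoint h, Nat.cast_add, ha, hb]

lemma truncSet_mul [Fact p.Prime] [CharP F p] {a b : Idx m n} (ha : a ∈ truncSet p t n)
    (hb : b ∈ truncSet p t n) (h : (binom a.1 b.1 : F) ≠ 0) :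
    (a.1 + b.1, a.2 ∪ b.2) ∈ truncSet p t n := by
  intro i
  by_contra hlt
  apply h
  have hp : p.Prime := Fact.out
  have hpos : 0 < p ^ (t i : ℕ) := pow_pos hp.pos _
  have hai : a.1 i < p ^ (t i : ℕ) := by have := ha i; omega
  have hbi : b.1 i < p ^ (t i : ℕ) := by have := hb i; omega
  have hs : p ^ (t i : ℕ) ≤ a.1 i + b.1 i := by
    simp only [Pi.add_apply, not_le] at hlt; omega
  rw [CharP.cast_eq_zero_iff F p]
  refine dvd_trans ?_ (dvd_prod_of_mem _ (mem_univ i))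
  apply dvd_of_one_le_padicValNat
  rw [add_comm, padicValNat_choose' (Nat.lt_succ_self _), Nat.one_le_iff_ne_zero, card_ne_zero]
  refine ⟨t i, ?_⟩
  simp only [mem_filter, mem_Ico]
  refine ⟨⟨(t i).pos, ?_⟩, ?_⟩
  · refine Nat.lt_succ_of_le (Nat.le_log_of_pow_le hp.one_lt ?_)
    omega
  · rw [Nat.mod_eq_of_lt hai, Nat.mod_eq_of_lt hbi]; exact hs

lemma mulO_mem [Fact p.Prime] [CharP F p] {θ η : ZMod 2} {f g : O F m n}
    (hf : f ∈ mspan F (truncSet p t n ∩ parSet m n θ))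
    (hg : g ∈ mspan F (truncSet p t n ∩ parSet m n η)) :
    mulO f g ∈ mspan F (truncSet p t n ∩ parSet m n (θ + η)) :=
  mspan_mul (R := truncSet p t n ∩ parSet m n (θ + η)) (fun _ ha _ hb h1 h2 => ⟨truncSet_mul (F := F) ha.1 hb.1 h1, parSet_mul ha.2 hb.2 h2⟩) hf hg

lemma pd_mem {θ : ZMod 2} {f : O F m n} (i : Y m n)
    (hf : f ∈ mspan F (truncSet p t n ∩ parSet m n θ)) :
    pd i f ∈ mspan F (truncSet p t n ∩ parSet m n (mu i + θ)) := by
  rcases i with i | k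
  · refine mspan_dEven (R := truncSet p t n ∩ parSet m n _) i (fun a ha h0 => ⟨fun j => ?_, ?_⟩) hf
    · have := ha.1 j
      by_cases hj : j = i
      · subst hj; simp only [Function.update_self]; omega
      · simpa [hj] using this
    · simpa [mu, parSet] using ha.2
  · refine mspan_dOdd (R := truncSet p t n ∩ parSet m n _) k (fun a ha h0 => ⟨fun j => ha.1 j, ?_⟩) hf
    have h2 : (#a.2 : ZMod 2) = θ := ha.2
    have h3 : ((#(a.2.erase k) + 1 : ℕ) : ZMod 2) = θ := by rw [card_erase_add_one h0, h2]
    simp only [parSet, Set.mem_ofPred_eq, mu, Sum.elim_inr]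
    rw [← h3, Nat.cast_add, Nat.cast_one, ← add_assoc, add_comm (1 : ZMod 2), add_assoc,
      show (1 : ZMod 2) + 1 = 0 from rfl, add_zero]

lemma WCoef_even {f : Y m n → O F m n} (hf : f ∈ WCoef F p n t) : EvenCoef f := fun i =>
  mspan_mono Set.inter_subset_right (hf i (Set.mem_univ i))

lemma zmod2_add_self (θ η : ZMod 2) : θ + (θ + η) = η := by
  rw [← add_assoc, CharTwo.add_self_eq_zero, zero_add]

lemma vf_mem [Fact p.Prime] [CharP F p] {f : Y m n → O F m n} (hf : f ∈ WCoef F p n t)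
    {θ : ZMod 2} {g : O F m n} (hg : g ∈ mspan F (truncSet p t n ∩ parSet m n θ)) :
    vf f g ∈ mspan F (truncSet p t n ∩ parSet m n θ) := by
  rw [vf_apply]
  refine sum_mem fun i _ => ?_
  have := mulO_mem (hf i (Set.mem_univ i)) (pd_mem i hg)
  rwa [zmod2_add_self] at this

lemma lie_coef_mem [Fact p.Prime] [CharP F p] {f g : Y m n → O F m n}
    (hf : f ∈ WCoef F p n t) (hg : g ∈ WCoef F p n t) :
    (fun j => vf f (g j) - vf g (f j)) ∈ WCoef F p n t := fun j _ =>
  sub_mem (vf_mem hf (hg j (Set.mem_univ j))) (vf_mem hg (hf j (Set.mem_univ j)))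

variable (F p n t)

/-- The even part `𝒲` of the generalized Witt superalgebra `W(2m,n;t)`: the even vector fields
`∑ i, f i ∂_i` with `f i ∈ 𝒪(2m,n;t)`. The bracket of two even elements is the commutator of
endomorphisms of `𝒪(2m,n)`. -/
noncomputable def W [Fact p.Prime] [CharP F p] :
    LieSubalgebra F (Module.End F (O F m n)) where
  toSubmodule := (WCoef F p n t).map vf
  lie_mem' := by
    rintro _ _ ⟨f, hf, rfl⟩ ⟨g, hg, rfl⟩
    rw [lie_vf (WCoef_even hf) (WCoef_even hg)]
    exact Submodule.mem_map_of_mem (lie_coef_mem hf hg)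

variable {F p n t}

/-- The coefficients of `D_H(f)`. -/
noncomputable def DHCoef (f : O F m n) : Y m n → O F m n :=
  fun j => tau (prm j) • pd (prm j) (sg (prm j) f)

lemma prm_prm (i : Y m n) : prm (prm i) = i := by
  rcases i with (i | i) | k <;> rfl

lemma DH_eq_vf (f : O F m n) : DH f = vf (DHCoef f) := by
  refine LinearMap.ext fun g => ?_
  rw [DH_apply, vf_apply]
  refine Fintype.sum_bijective prm (Function.Involutive.bijective prm_prm) _ _ fun i => ?_
  simp only [DHCoef, prm_prm, map_zsmul, LinearMap.smul_apply]

lemma mu_prm (i : Y m n) : mu (prm i) = mu i := by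
  rcases i with (i | i) | k <;> rfl

lemma evenSet_par {f : O F m n} (hf : f ∈ mspan F (evenSet p n t)) :
    f ∈ mspan F (parSet m n 0) := mspan_mono Set.inter_subset_right hf

lemma DHCoef_mem {f : O F m n} (hf : f ∈ mspan F (evenSet p n t)) :
    DHCoef f ∈ WCoef F p n t := by
  intro j _
  have h := pd_mem (prm j) (θ := 0) hf
  rw [add_zero, mu_prm] at h
  simp only [DHCoef]
  rw [sg_even (evenSet_par hf)]
  exact zsmul_mem h _

lemma DH_mem_W [Fact p.Prime] [CharP F p] {f : O F m n} (hf : f ∈ mspan F (evenSet p n t)) :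
    DH f ∈ W F p n t := by
  rw [DH_eq_vf]
  exact Submodule.mem_map_of_mem (DHCoef_mem hf)

lemma NSet_subset : NSet p n t ⊆ evenSet p n t := fun _ h => h.1

lemma pd_par_even {f : O F m n} (hf : f ∈ mspan F (parSet m n 0)) (i : Y m n) :
    pd i f ∈ mspan F (parSet m n (mu i)) := by
  rcases i with i | k
  · exact mspan_dEven i (fun a ha _ => ha) hf
  · refine mspan_dOdd k (fun a ha h0 => ?_) hf
    have h2 : (#a.2 : ZMod 2) = 0 := ha
    have h3 : ((#(a.2.erase k) + 1 : ℕ) : ZMod 2) = 0 := by rw [card_erase_add_one h0, h2]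
    rw [Nat.cast_add, Nat.cast_one, CharTwo.add_eq_zero] at h3
    exact h3

/-- Antisymmetry of the Poisson bracket, differentiated form. -/
lemma DH_pd_antisymm {f g : O F m n} (hf : f ∈ mspan F (parSet m n 0))
    (hg : g ∈ mspan F (parSet m n 0)) (j : Y m n) :
    pd j (DH f g) = DH f (pd j g) - DH g (pd j f) := by
  rw [DH_apply, DH_apply, DH_apply, map_sum]
  simp only [sg_even hf, sg_even hg, map_zsmul, mulO_pd, smul_add, sum_add_distrib]
  rw [sub_eq_add_neg, add_comm]
  congr 1
  · refine sum_congr rfl fun i _ => ?_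
    congr 1
    rcases j with j | l
    · rw [pd_pd]
      simp [sg, eps]
    · rcases i with i | k
      · have h : sg (Sum.inr l) (pd (Sum.inl i) f) = pd (Sum.inl i) f :=
          par_even (pd_par_even hf (Sum.inl i))
        rw [h, pd_pd]
        simp [eps, prm]
      · have h : sg (Sum.inr l) (pd (Sum.inr k) f) = - pd (Sum.inr k) f :=
          par_odd (pd_par_even hf (Sum.inr k))
        rw [h, pd_pd]
        simp [eps, prm]
  · rw [← sum_neg_distrib]
    refine Fintype.sum_bijective prm (Function.Involutive.bijective prm_prm) _ _ fun i => ?_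
    rw [prm_prm]
    rcases i with i | k
    · have h := pd_par_even hg (prm (Sum.inl i))
      rw [mu_prm] at h
      rw [mulO_even_comm (f := pd (prm (Sum.inl i)) g) h, pd_pd]
      rcases i with i | i <;> simp [tau, prm, eps]
    · have h := pd_par_even hg (prm (Sum.inr k))
      have h2 := mulO_sg (i := Sum.inr k) (f := pd (Sum.inr k) g) h (pd j (pd (Sum.inr k) f))
      rw [← prm_prm (Sum.inr k)] at h2
      change _ = -(tau (Sum.inr k) • mulO (pd (Sum.inr k) g) (pd (Sum.inr k) (pd j f)))
      change tau (Sum.inr k) • mulO (pd j (pd (Sum.inr k) f)) (pd (Sum.inr k) g) = _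
      have h3 := mulO_odd_comm (f := pd (Sum.inr k) g) h (pd (Sum.inr k) (pd j f))
      rw [h3, pd_pd j]
      rcases j with j | l
      · have : par (pd (Sum.inr k) (pd (Sum.inl j) f)) = -pd (Sum.inr k) (pd (Sum.inl j) f) :=
          par_odd (pd_par_even (pd_par_even hf (Sum.inl j)) (Sum.inr k))
        rw [this]
        simp [eps]
      · have : par (pd (Sum.inr k) (pd (Sum.inr l) f)) = pd (Sum.inr k) (pd (Sum.inr l) f) := by
          refine par_even ?_
          have h1 := pd_par_even hf (Sum.inr l : Y m n)
          refine mspan_dOdd k (fun a ha h0 => ?_) h1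
          have h2 : (#a.2 : ZMod 2) = 1 := ha
          have h3 : ((#(a.2.erase k) + 1 : ℕ) : ZMod 2) = 1 := by
            rw [card_erase_add_one h0, h2]
          simpa [parSet] using h3
        rw [this]
        simp [eps]

lemma lie_DH {f g : O F m n} (hf : f ∈ mspan F (parSet m n 0))
    (hg : g ∈ mspan F (parSet m n 0)) (hfg : DH f g ∈ mspan F (parSet m n 0)) :
    ⁅DH f, DH g⁆ = DH (DH f g) := by
  have hc : ∀ {f : O F m n}, f ∈ mspan F (parSet m n 0) → EvenCoef (DHCoef f) := by
    intro f hf j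
    simp only [DHCoef]
    rw [sg_even hf, ← mu_prm j]
    exact zsmul_mem (pd_par_even hf (prm j)) _
  rw [DH_eq_vf f, DH_eq_vf g, lie_vf (hc hf) (hc hg), ← DH_eq_vf, ← DH_eq_vf, DH_eq_vf (DH f g)]
  congr 1
  funext j
  simp only [DHCoef]
  rw [sg_even hf, sg_even hg, sg_even hfg, DH_pd_antisymm hf hg, map_zsmul, map_zsmul,
    smul_sub]

lemma DH_mem_evenSet [Fact p.Prime] [CharP F p] {f g : O F m n}
    (hf : f ∈ mspan F (evenSet p n t)) (hg : g ∈ mspan F (evenSet p n t)) :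
    DH f g ∈ mspan F (evenSet p n t) := by
  rw [DH_eq_vf]
  exact vf_mem (DHCoef_mem hf) hg

lemma DH_apply_even {f : O F m n} (hf : f ∈ mspan F (parSet m n 0)) (g : O F m n) :
    DH f g = ∑ i : Y0 m, tau (Sum.inl i : Y m n) • dEven i (mulO f (dEven i.swap g))
      + ∑ k, dOdd k (mulO f (dOdd k g)) := by
  rw [DH_apply, Fintype.sum_sum_type]
  congr 1
  · simp only [sg_even hf, dEven_mul, smul_add, sum_add_distrib]
    rw [eq_comm]
    refine (add_eq_left.2 ?_)
    rw [Fintype.sum_sum_type, ← sum_add_distrib]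
    refine sum_eq_zero fun i _ => ?_
    simp [tau, dEven_dEven (Sum.inl i) (Sum.inr i)]
  · refine sum_congr rfl fun k _ => ?_
    have : dOdd k (dOdd k g) = 0 := by
      rw [dOdd_sq]
    simp [sg_even hf, dOdd_mul, this, tau, pd, prm]

lemma DH_mem_NSet [Fact p.Prime] [CharP F p] {f g : O F m n}
    (hf : f ∈ mspan F (evenSet p n t)) (hg : g ∈ mspan F (evenSet p n t)) :
    DH f g ∈ mspan F (NSet p n t) := by
  have hE := DH_mem_evenSet hf hg
  have hf0 := evenSet_par hf
  have hg0 := evenSet_par hg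
  -- the contribution of the even variables has no terms with exponent `π`
  have h1 : ∀ (i : Y0 m) (u : Finset (Fin n)),
      (dEven i (mulO f (dEven i.swap g))) (piTop p t, u) = 0 := by
    intro i u
    have h := mulO_mem (p := p) (t := t) hf (pd_mem (Sum.inl i.swap) hg)
    have h2 : dEven i (mulO f (dEven i.swap g)) ∈
        mspan F {a : Idx m n | a.1 i < piTop p t i} := by
      refine mspan_dEven i (fun a ha h0 => ?_) h
      have := ha.1 i
      simp only [Set.mem_ofPred_eq, Function.update_self, piTop]
      omega
    exact mspan_coeff h2 (by simp)
  have h2 : ∀ (k : Fin n), (dOdd k (mulO f (dOdd k g))) (piTop p t, Finset.univ) = 0 := by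
    intro k
    have h : mulO f (dOdd k g) ∈ mspan F (Set.univ : Set (Idx m n)) := by
      rw [mspan_eq, Finsupp.supported_univ]; trivial
    have h2 : dOdd k (mulO f (dOdd k g)) ∈ mspan F {a : Idx m n | k ∉ a.2} :=
      mspan_dOdd k (fun a ha h0 => by simp) h
    exact mspan_coeff h2 (by simp)
  have h3 : ∀ (k : Fin n), (dOdd k (mulO f (dOdd k g))) (piTop p t, ∅) = 0 := by
    intro k
    have e : dOdd k (mulO f (dOdd k g)) = mulO (dOdd k f) (dOdd k g) := by
      rw [dOdd_mul, dOdd_sq]; simp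
    have hk : dOdd k f ∈ mspan F {a : Idx m n | a.2 ≠ ∅} := by
      refine mspan_mono (fun a ha h0 => ?_) (pd_par_even hf0 (Sum.inr k))
      have ha' : (#a.2 : ZMod 2) = 1 := ha
      rw [h0] at ha'
      simp at ha'
    have hkg : dOdd k g ∈ mspan F {a : Idx m n | a.2 ≠ ∅} := by
      refine mspan_mono (fun a ha h0 => ?_) (pd_par_even hg0 (Sum.inr k))
      have ha' : (#a.2 : ZMod 2) = 1 := ha
      rw [h0] at ha'
      simp at ha'
    rw [e]
    refine mspan_coeff (mspan_mul (R := {a : Idx m n | a.2 ≠ ∅}) ?_ hk hkg) (by simp)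
    intro a ha b hb _ _
    simp only [Set.mem_ofPred_eq, ne_eq, union_eq_empty, not_and] at ha hb ⊢
    exact fun h => absurd h ha
  have hz : ∀ u, (∀ k, (dOdd k (mulO f (dOdd k g))) (piTop p t, u) = 0) →
      (DH f g) (piTop p t, u) = 0 := by
    intro u hu
    rw [DH_apply_even hf0, Finsupp.add_apply, Finsupp.finsetSum_apply, Finsupp.finsetSum_apply,
      sum_eq_zero (fun k _ => hu k), add_zero]
    refine sum_eq_zero fun i _ => ?_
    rw [Finsupp.smul_apply, h1, smul_zero]
  rw [mspan_eq, Finsupp.mem_supported']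
  intro a ha
  by_cases hae : a ∈ evenSet p n t
  · by_cases ha1 : a = (piTop p t, Finset.univ)
    · rw [ha1]; exact hz _ h2
    · by_cases ha2 : a = (piTop p t, ∅)
      · rw [ha2]; exact hz _ h3
      · exact absurd ⟨hae, ha1, ha2⟩ ha
  · exact mspan_coeff hE hae

variable (F p n t)

/-- `D_H` as a map from the even elements of `𝒪(2m,n;t)` to `𝒲`. -/
noncomputable def DHW [Fact p.Prime] [CharP F p] :
    mspan F (evenSet p n t) →ₗ[F] W F p n t :=
  (DH.domRestrict (mspan F (evenSet p n t))).codRestrict (W F p n t).toSubmodule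
    fun f => DH_mem_W f.2

/-- The Lie algebra `𝔑`, spanned by the `D_H(x^(α) x^u)` with `α ∈ 𝔸`, `|u|` even and `(α, u)`
different from `(π, ω)` and `(π, ∅)`. -/
noncomputable def N [Fact p.Prime] [CharP F p] : LieSubalgebra F (W F p n t) where
  toSubmodule := ((mspan F (NSet p n t)).map DH).comap (W F p n t).toSubmodule.subtype
  lie_mem' := by
    rintro x y ⟨f, hf, hx⟩ ⟨g, hg, hy⟩
    have hf' := mspan_mono NSet_subset hf
    have hg' := mspan_mono NSet_subset hg
    refine ⟨DH f g, DH_mem_NSet hf' hg', ?_⟩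
    rw [← lie_DH (evenSet_par hf') (evenSet_par hg') (evenSet_par (DH_mem_evenSet hf' hg')), hx, hy]
    rfl

/-- `D_H` as a map onto `𝔑`, from the span of the `x^(α) x^u` that occur in its definition. -/
noncomputable def DHN [Fact p.Prime] [CharP F p] :
    mspan F (NSet p n t) →ₗ[F] N F p n t :=
  ((DHW F p n t).comp (Submodule.inclusion (mspan_mono NSet_subset))).codRestrict
    (N F p n t).toSubmodule fun f => ⟨f, f.2, rfl⟩

variable {F p n t}

lemma DHN_surjective [Fact p.Prime] [CharP F p] : Function.Surjective (DHN F p n t) := by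
  rintro ⟨x, f, hf, hx⟩
  exact ⟨⟨f, hf⟩, Subtype.ext (Subtype.ext hx)⟩

lemma pd_mono_single (i : Y m n) (j : Y0 m) :
    pd i (mono (Pi.single j 1, ∅) : O F m n) = if i = Sum.inl j then mono (0, ∅) else 0 := by
  rcases i with i | k
  · by_cases h : i = j
    · subst h
      simp only [pd, Sum.elim_inl, dEven_mono, Pi.single_eq_same, if_true]
      rw [if_neg one_ne_zero]
      congr 2
      ext l
      by_cases hl : l = i
      · subst hl; simp
      · simp [hl]
    · simp [pd, dEven_mono, h]
  · simp [pd, dOdd_mono]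

lemma mulO_one (f : O F m n) : mulO f (mono (0, ∅)) = f := by
  induction f using mono_induction with
  | h0 => simp
  | hadd f f' h1 h2 => simp only [map_add, LinearMap.add_apply, h1, h2]
  | hsmul c a =>
  simp [mulO_mono, binom, sgn]

lemma dEven_eq_zero_of_DH {f : O F m n} (h : DH f = 0) (i : Y0 m) : dEven i f = 0 := by
  have h1 : DH f (mono (Pi.single i.swap 1, ∅)) = 0 := by rw [h]; rfl
  rw [DH_eq_vf, vf_apply] at h1
  simp only [pd_mono_single] at h1
  rw [sum_eq_single (Sum.inl i.swap)] at h1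
  · rw [if_pos rfl, mulO_one] at h1
    rcases i with i | i
    · simpa [DHCoef, prm, tau, sg, pd] using h1
    · simpa [DHCoef, prm, tau, sg, pd] using h1
  · intro b _ hb
    simp [hb]
  · simp

lemma dEven_pow_mem {θ : ZMod 2} {f : O F m n} (i : Y0 m) (q : ℕ)
    (hf : f ∈ mspan F (truncSet p t n ∩ parSet m n θ)) :
    (dEven i ^ q) f ∈ mspan F (truncSet p t n ∩ parSet m n θ) := by
  induction q with
  | zero => simpa using hf
  | succ q ih =>
    rw [pow_succ', Module.End.mul_apply]
    simpa [mu, pd] using pd_mem (Sum.inl i) ih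

lemma mulO_mul_mem_W [Fact p.Prime] [CharP F p] {f : O F m n}
    (hf : f ∈ mspan F (evenSet p n t)) {w : Module.End F (O F m n)} (hw : w ∈ W F p n t) :
    mulO f * w ∈ W F p n t := by
  obtain ⟨g, hg, rfl⟩ := hw
  rw [mulO_vf]
  refine Submodule.mem_map_of_mem fun i _ => ?_
  simpa using mulO_mem hf (hg i (Set.mem_univ i))

lemma omega_mem (hn : Even n) : ((0, Finset.univ) : Idx m n) ∈ evenSet p n t := by
  refine ⟨fun i => Nat.zero_le _, ?_⟩
  simp [parSet, ZMod.natCast_eq_zero_iff_even, hn]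

/-- The linear map `f a ↦ g a`, for a surjective linear map `f` such that `f a` determines
`g a`. -/
noncomputable def liftSurj {K A B C : Type*} [Field K] [AddCommMonoid A] [AddCommMonoid B]
    [AddCommMonoid C] [Module K A] [Module K B] [Module K C] (f : A →ₗ[K] B)
    (hf : Function.Surjective f) (g : A →ₗ[K] C) (h : ∀ a a', f a = f a' → g a = g a') :
    B →ₗ[K] C where
  toFun b := g (Function.surjInv hf b)
  map_add' x y := by
    rw [← map_add]
    refine h _ _ ?_
    rw [map_add, Function.surjInv_eq hf, Function.surjInv_eq hf, Function.surjInv_eq hf]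
  map_smul' c x := by
    rw [RingHom.id_apply, ← map_smul]
    refine h _ _ ?_
    rw [map_smul, Function.surjInv_eq hf, Function.surjInv_eq hf]

lemma liftSurj_apply {K A B C : Type*} [Field K] [AddCommMonoid A] [AddCommMonoid B]
    [AddCommMonoid C] [Module K A] [Module K B] [Module K C] (f : A →ₗ[K] B)
    (hf : Function.Surjective f) (g : A →ₗ[K] C) (h : ∀ a a', f a = f a' → g a = g a') (a : A) :
    liftSurj f hf g h (f a) = g a :=
  h _ _ (Function.surjInv_eq hf (f a))

variable (F p n t)

/-! ### The exceptional derivations -/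

/-- The map `f ↦ ∂_i^(p^q)(f) D_H(x^ω)`. -/
noncomputable def preΦ [Fact p.Prime] [CharP F p] (hn : Even n) (i : Y0 m) (q : ℕ) :
    mspan F (NSet p n t) →ₗ[F] W F p n t :=
  ((LinearMap.mulRight F (DH (mono (0, Finset.univ) : O F m n)) ∘ₗ mulO ∘ₗ
    (dEven i ^ p ^ q)).domRestrict (mspan F (NSet p n t))).codRestrict (W F p n t).toSubmodule
    fun f => mulO_mul_mem_W (dEven_pow_mem i _ (mspan_mono NSet_subset f.2))
      (DH_mem_W (mono_mem (omega_mem hn)))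

variable {F p n t}

lemma preΦ_congr [Fact p.Prime] [CharP F p] (hn : Even n) (i : Y0 m) (q : ℕ)
    (f g : mspan F (NSet p n t)) (h : DHN F p n t f = DHN F p n t g) :
    preΦ F p n t hn i q f = preΦ F p n t hn i q g := by
  have h' : DH (f : O F m n) = DH (g : O F m n) :=
    congrArg (fun x : N F p n t => ((x : W F p n t) : Module.End F (O F m n))) h
  have h0 : DH ((f : O F m n) - (g : O F m n)) = 0 := by rw [map_sub, h', sub_self]
  have h1 : (dEven i ^ p ^ q) ((f : O F m n) - (g : O F m n)) = 0 := by
    have hp : p ^ q ≠ 0 := pow_ne_zero _ (Fact.out : p.Prime).ne_zero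
    obtain ⟨k, hk⟩ := Nat.exists_eq_succ_of_ne_zero hp
    rw [hk, pow_succ, Module.End.mul_apply, dEven_eq_zero_of_DH h0, map_zero]
  rw [map_sub, sub_eq_zero] at h1
  refine Subtype.ext ?_
  change mulO ((dEven i ^ p ^ q) (f : O F m n)) * _ = mulO ((dEven i ^ p ^ q) (g : O F m n)) * _
  rw [h1]

variable (F p n t)

/-- The map `Φ_i^(q) : 𝔑 → 𝒲`, `D_H(f) ↦ ∂_i^(p^q)(f) D_H(x^ω)`, for even `n`;
it is characterized by `Φ_DHN`. -/
noncomputable def Φ [Fact p.Prime] [CharP F p] (hn : Even n) (i : Y0 m) (q : ℕ) :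
    N F p n t →ₗ[F] W F p n t :=
  liftSurj (DHN F p n t) DHN_surjective (preΦ F p n t hn i q) (preΦ_congr hn i q)

lemma Φ_DHN [Fact p.Prime] [CharP F p] (hn : Even n) (i : Y0 m) (q : ℕ)
    (f : mspan F (NSet p n t)) :
    ((Φ F p n t hn i q (DHN F p n t f) : W F p n t) : Module.End F (O F m n))
      = mulO ((dEven i ^ p ^ q) (f : O F m n)) * DH (mono (0, Finset.univ)) := by
  have : Φ F p n t hn i q (DHN F p n t f) = preΦ F p n t hn i q f :=
    liftSurj_apply (DHN F p n t) DHN_surjective (preΦ F p n t hn i q) (preΦ_congr hn i q) f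
  rw [this]
  rfl

lemma partial_mem_W [Fact p.Prime] [CharP F p] (i : Y0 m) :
    (dEven i : Module.End F (O F m n)) ∈ W F p n t := by
  refine ⟨Pi.single (Sum.inl i) (mono (0, ∅)), fun j _ => ?_, ?_⟩
  · by_cases hj : j = Sum.inl i
    · subst hj
      rw [Pi.single_eq_same]
      exact mono_mem ⟨fun _ => Nat.zero_le _, by simp [parSet, mu]⟩
    · rw [Pi.single_eq_of_ne hj]
      exact zero_mem _
  · refine LinearMap.ext fun f => ?_
    rw [vf_apply, sum_eq_single (Sum.inl i)]
    · rw [Pi.single_eq_same, mulO_even_comm (mono_mem (by simp [parSet])), mulO_one]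
      rfl
    · intro j _ hj
      simp [Pi.single_eq_of_ne hj]
    · simp

/-- `∂_i`, `i ∈ Y₀`, as an element of `𝒲`. -/
noncomputable def dW [Fact p.Prime] [CharP F p] (i : Y0 m) : W F p n t :=
  ⟨dEven i, partial_mem_W F p n t i⟩

/-- The map `(ad ∂_i)^(p^q) : 𝔑 → 𝒲`. -/
noncomputable def adPow [Fact p.Prime] [CharP F p] (i : Y0 m) (q : ℕ) :
    N F p n t →ₗ[F] W F p n t :=
  (LieAlgebra.ad F (W F p n t) (dW F p n t i) ^ p ^ q) ∘ₗ (N F p n t).toSubmodule.subtype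

/-- For even `n`, the map `𝒲 → 𝒲`, `D ↦ x^ω D`. -/
noncomputable def omegaMul [Fact p.Prime] [CharP F p] (hn : Even n) :
    W F p n t →ₗ[F] W F p n t :=
  (LinearMap.mulLeft F (mulO (mono (0, Finset.univ) : O F m n)) ∘ₗ
    (W F p n t).toSubmodule.subtype).codRestrict (W F p n t).toSubmodule
    fun w => mulO_mul_mem_W (mono_mem (omega_mem hn)) w.2

/-- The map `Θ_i^(q) : 𝔑 → 𝒲`, `D ↦ x^ω (ad ∂_i)^(p^q)(D)`, for even `n`. -/
noncomputable def Θ [Fact p.Prime] [CharP F p] (hn : Even n) (i : Y0 m) (q : ℕ) :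
    N F p n t →ₗ[F] W F p n t :=
  omegaMul F p n t hn ∘ₗ adPow F p n t i q

/-! ### Derivations and gradings -/

/-- The space `Der(𝔤, V)` of derivations from a Lie algebra `𝔤` into a `𝔤`-module `V`. -/
def Der (K g V : Type*) [Field K] [LieRing g] [LieAlgebra K g] [AddCommGroup V] [Module K V]
    [LieRingModule g V] [LieModule K g V] : Submodule K (g →ₗ[K] V) where
  carrier := {D | ∀ x y : g, D ⁅x, y⁆ = ⁅x, D y⁆ - ⁅y, D x⁆}
  add_mem' := by
    intro D E hD hE x y
    simp only [LinearMap.add_apply, hD x y, hE x y, lie_add]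
    abel
  zero_mem' := by
    intro x y
    simp
  smul_mem' := by
    intro c D hD x y
    simp only [LinearMap.smul_apply, hD x y, lie_smul, smul_sub]

/-- The homogeneous component `𝒲_[d]`. -/
noncomputable def WDeg [Fact p.Prime] [CharP F p] (d : ℤ) : Submodule F (W F p n t) :=
  ((WCoefDeg F p n t d).map vf).comap (W F p n t).toSubmodule.subtype

/-- The space `Der_[r](𝔑, 𝒲)` of derivations that map `𝔑_[i] = 𝔑 ∩ 𝒲_[i]` into `𝒲_[r+i]` for
every `i`. -/
noncomputable def DerDeg [Fact p.Prime] [CharP F p] (r : ℤ) :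
    Submodule F (N F p n t →ₗ[F] W F p n t) where
  carrier := {D | D ∈ Der F (N F p n t) (W F p n t) ∧
    ∀ (i : ℤ) (x : N F p n t), (x : W F p n t) ∈ WDeg F p n t i → D x ∈ WDeg F p n t (r + i)}
  add_mem' := fun hD hE =>
    ⟨add_mem hD.1 hE.1, fun i x hx => add_mem (hD.2 i x hx) (hE.2 i x hx)⟩
  zero_mem' := ⟨zero_mem _, fun _ _ _ => zero_mem _⟩
  smul_mem' := fun c _ hD =>
    ⟨Submodule.smul_mem _ c hD.1, fun i x hx => Submodule.smul_mem _ c (hD.2 i x hx)⟩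

/-- `Der⁻(𝔑, 𝒲)`, the sum of the `Der_[r](𝔑, 𝒲)` with `r ≤ -1`. -/
noncomputable def DerNeg [Fact p.Prime] [CharP F p] :
    Submodule F (N F p n t →ₗ[F] W F p n t) :=
  ⨆ r : {r : ℤ // r ≤ -1}, DerDeg F p n t r

/-- The linear map `𝒲 → Hom(𝔑, 𝒲)`, `w ↦ (ad w)|_𝔑`. -/
noncomputable def adN [Fact p.Prime] [CharP F p] :
    W F p n t →ₗ[F] N F p n t →ₗ[F] W F p n t :=
  LinearMap.lcomp F (W F p n t) (N F p n t).toSubmodule.subtype ∘ₗ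
    (LieAlgebra.ad F (W F p n t)).toLinearMap

end

end HamSuper

/-! A derivation D of degree r ≤ -1 is studied through L(f) = D(D_H(f)). By induction on d,
multiples of the listed derivations are subtracted until L vanishes on all monomials of degree less
than d; as degrees in 𝔑 are bounded, D is then exhausted. Write i' for `i.swap`, and call i, i' a
pair.

Suppose that L vanishes below degree d. Three tools govern degree d. (1) If a monomial is a nonzero
multiple of a Poisson bracket of two monomials killed by L, it is killed (`NegDer.bracket_zero`).
(2) Since D_H(x_{i'}) = ±∂_i, the value at a monomial of degree d commutes with all ∂_i, i ∈ Y₀, so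
its coefficients lie in the exterior algebra (`NegDer.dEven_comm`). (3) For d ≥ 3 the elements x_i
x_{i'} act diagonally, and a nonzero component c_j ∂_j of the value at x^(α) x^u forces α_i - α_{i'}
to equal the weight of ∂_j modulo p (`NegDer.weight`). As ∂_j has nonzero weight on at most one
pair, two pairs of nonzero weight make the value vanish.

With these, L kills every monomial of degree d ≥ 3 except possibly x_j^(q) and x_i x_j^(q), where q
= p^s, s ≥ 1 and j is not i or i' (`NegDer.killsBelow_succ`). The prime powers survive because the
binomial coefficients that would arise in writing x_j^(q) as a bracket are divisible by p.

The exceptional values are pinned down by invariance under the rotations D_H(x_k x_l). The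
invariants of the exterior algebra are spanned by 1 and x^ω, and the relevant invariant odd fields
are multiples of D_H(x^ω), which exist in the even part only for even n. Hence L(x_j^(q)) is a
multiple of D_H(x^ω), the value of Φ (`NegDer.power_value`), and L(x_i x_j^(q)) is a combination of
D_H(x_i) and x^ω D_H(x_i), the values of (ad ∂_j)^q and Θ (`NegDer.mul_power_value`). Comparing
degrees gives r = n - q for Φ and Θ, whence the condition n - q < 0, and r = -q for (ad ∂_j)^q.

In degree at most two only r = -1 leaves anything. There the element ∑ x_i x_{i'} separates the
weights of quadratic monomials from those of the ∂_j, and an inner derivation by an element of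
𝒲_[-1] removes everything (`exists_adN_killsBelow_three`).

Conversely, Φ and Θ are derivations because x^ω Poisson commutes with all even elements
(`DH_omega`), and (ad ∂_j)^q is one because it is the bracket with the operator ∂_j^q. -/

namespace HamSuper

open Finset

attribute [local instance] LieRing.ofAssociativeRing

/-! ### Monomials, their brackets, and vector fields by coefficients -/

section Monomials
variable {F : Type*} [Field F] {m n : ℕ}

/-- The degree `|α| + |u|` of the basis element `x^(α) x^u`. -/
def deg (a : Idx m n) : ℕ := ∑ i, a.1 i + #a.2

lemma mono_apply (a b : Idx m n) : (mono a : O F m n) b = if a = b then 1 else 0 := by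
  classical
  rw [mono, Finsupp.single_apply]

lemma dEven_mono_of_eq_zero {i : Y0 m} {α : Y0 m → ℕ} (u : Finset (Fin n)) (h : α i = 0) :
    dEven i (mono (α, u) : O F m n) = 0 := by
  rw [dEven_mono, if_pos h]

lemma dEven_mono_add (i : Y0 m) (α : Y0 m → ℕ) (u : Finset (Fin n)) :
    dEven i (mono (α + Pi.single i 1, u) : O F m n) = mono (α, u) := by
  rw [dEven_mono, if_neg (by simp)]
  congr 2
  funext j
  by_cases hj : j = i
  · subst hj; simp
  · simp [hj]

lemma exists_add_single {i : Y0 m} {α : Y0 m → ℕ} (h : α i ≠ 0) :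
    ∃ γ : Y0 m → ℕ, α = γ + Pi.single i 1 := by
  refine ⟨Function.update α i (α i - 1), ?_⟩
  funext j
  by_cases hj : j = i
  · subst hj; simp; omega
  · simp [hj]

lemma dEven_apply (i : Y0 m) (f : O F m n) (α : Y0 m → ℕ) (u : Finset (Fin n)) :
    (dEven i f) (α, u) = f (α + Pi.single i 1, u) := by
  induction f using mono_induction with
  | h0 => simp
  | hadd f g h1 h2 => simp [h1, h2]
  | hsmul c a =>
  obtain ⟨β, v⟩ := a
  rw [map_smul, Finsupp.smul_apply, Finsupp.smul_apply]
  congr 1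
  by_cases hb : β i = 0
  · rw [dEven_mono_of_eq_zero _ hb, mono_apply, if_neg, Finsupp.zero_apply]
    intro h
    have := congrFun (congrArg Prod.fst h) i
    simp [hb] at this
  · obtain ⟨γ, rfl⟩ := exists_add_single hb
    rw [dEven_mono_add, mono_apply, mono_apply]
    simp only [Prod.mk.injEq, add_left_inj]

lemma apply_eq_zero_of_dEven {f : O F m n} (h : ∀ i, dEven i f = 0) {a : Idx m n}
    (ha : a.1 ≠ 0) : f a = 0 := by
  obtain ⟨α, u⟩ := a
  obtain ⟨i, hi⟩ := Function.ne_iff.1 ha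
  obtain ⟨γ, rfl⟩ := exists_add_single hi
  rw [← dEven_apply, h, Finsupp.zero_apply]

lemma binom_eq_one {α β : Y0 m → ℕ} (h : ∀ i, α i = 0 ∨ β i = 0) : binom α β = 1 := by
  unfold binom
  refine prod_eq_one fun i _ => ?_
  rcases h i with h | h <;> simp [h]

lemma binom_single (i : Y0 m) (a : ℕ) (β : Y0 m → ℕ) :
    binom (Pi.single i a) β = (a + β i).choose a := by
  unfold binom
  rw [prod_eq_single i]
  · simp
  · intro j _ hj; simp [hj]
  · simp

lemma sgn_empty_left (u : Finset (Fin n)) : sgn ∅ u = 1 := by simp [sgn]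

lemma sgn_of_not_disjoint {u v : Finset (Fin n)} (h : ¬ Disjoint u v) : sgn u v = 0 := by
  simp [sgn, h]

lemma sgn_cast_ne_zero {u v : Finset (Fin n)} (h : Disjoint u v) : ((sgn u v : ℤ) : F) ≠ 0 := by
  simp [sgn, h]

lemma mulO_even_mono (α β : Y0 m → ℕ) (v : Finset (Fin n)) (h : ∀ i, α i = 0 ∨ β i = 0) :
    mulO (mono (α, ∅)) (mono (β, v) : O F m n) = mono (α + β, v) := by
  rw [mulO_mono, binom_eq_one h, sgn_empty_left]
  simp

lemma tau_mul_self (i : Y m n) : tau i * tau i = 1 := by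
  rcases i with (i | i) | k <;> rfl

lemma tau_swap (i : Y0 m) : tau (Sum.inl i.swap : Y m n) = -tau (Sum.inl i : Y m n) := by
  rcases i with i | i <;> rfl

lemma swap_ne (i : Y0 m) : i.swap ≠ i := by
  rcases i with i | i <;> simp

lemma even_parSet {α : Y0 m → ℕ} {u : Finset (Fin n)} (h : Even #u) :
    (α, u) ∈ parSet m n 0 := by
  simpa [parSet, ZMod.natCast_eq_zero_iff_even] using h

lemma even_of_parSet {a : Idx m n} (h : a ∈ parSet m n 0) : Even #a.2 := by
  simpa [parSet, ZMod.natCast_eq_zero_iff_even] using h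

/-- The Poisson bracket of an even element, with even and odd variables separated. -/
lemma DH_even_apply {f : O F m n} (hf : f ∈ mspan F (parSet m n 0)) (g : O F m n) :
    DH f g = ∑ i : Y0 m, tau (Sum.inl i : Y m n) • mulO (dEven i f) (dEven i.swap g)
      + ∑ k, mulO (dOdd k f) (dOdd k g) := by
  rw [DH_apply, Fintype.sum_sum_type]
  simp only [sg_even hf]
  congr 1
  exact sum_congr rfl fun k _ => by simp [tau, pd, prm]

lemma dOdd_mono_empty (k : Fin n) (α : Y0 m → ℕ) : dOdd k (mono (α, ∅) : O F m n) = 0 :=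
  dOdd_mono_of_notMem (by simp)

lemma DH_pure_apply (α : Y0 m → ℕ) (g : O F m n) :
    DH (mono (α, ∅)) g = ∑ i : Y0 m, tau (Sum.inl i : Y m n) •
      mulO (dEven i (mono (α, ∅))) (dEven i.swap g) := by
  rw [DH_even_apply (mono_mem (even_parSet (by simp)))]
  simp [dOdd_mono_empty]

lemma DHCoef_inl {f : O F m n} (i : Y0 m) :
    DHCoef f (Sum.inl i) = -tau (Sum.inl i : Y m n) • dEven i.swap f := by
  rcases i with i | i <;> simp [DHCoef, prm, tau, sg, pd]

lemma DHCoef_inr {f : O F m n} (hf : f ∈ mspan F (parSet m n 0)) (k : Fin n) :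
    DHCoef f (Sum.inr k) = dOdd k f := by
  simp [DHCoef, prm, tau, pd, sg_even hf]

lemma evenCoef_DHCoef {f : O F m n} (hf : f ∈ mspan F (parSet m n 0)) :
    EvenCoef (DHCoef f) := by
  intro j
  simp only [DHCoef]
  rw [sg_even hf, ← mu_prm j]
  exact zsmul_mem (pd_par_even hf (prm j)) _

/-- The variable `x_j`. -/
noncomputable def var : Y m n → O F m n :=
  Sum.elim (fun i => mono (Pi.single i 1, ∅)) (fun k => mono (0, {k}))

lemma pd_var (i j : Y m n) : pd i (var j : O F m n) = if i = j then mono (0, ∅) else 0 := by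
  rcases j with j | l
  · exact pd_mono_single i j
  · rcases i with i | k
    · simp [var, pd, dEven_mono]
    · by_cases h : k = l
      · subst h; simp [var, pd, dOdd_mono]
        rw [filter_singleton, if_neg (lt_irrefl k)]; simp
      · simp [var, pd, dOdd_mono, h]

lemma vf_var (c : Y m n → O F m n) (j : Y m n) : vf c (var j) = c j := by
  rw [vf_apply, sum_eq_single j]
  · rw [pd_var, if_pos rfl, mulO_one]
  · intro i _ hi; rw [pd_var, if_neg hi, map_zero]
  · simp

/-- The j-th coefficient is the value of the field at the variable x_j. Identities between fields
may therefore be compared coefficient by coefficient. -/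
lemma vf_injective : Function.Injective (vf : (Y m n → O F m n) →ₗ[F] _) := by
  intro c d h
  funext j
  rw [← vf_var c, h, vf_var]

lemma lie_eq (A B : Module.End F (O F m n)) : ⁅A, B⁆ = A * B - B * A := rfl

lemma end_lie_zero (A : Module.End F (O F m n)) : ⁅A, (0 : Module.End F (O F m n))⁆ = 0 := by
  refine LinearMap.ext fun f => ?_
  rw [lie_eq, LinearMap.sub_apply]
  simp

lemma end_sub_zero (A : Module.End F (O F m n)) : A - 0 = A :=
  LinearMap.ext fun f => by rw [LinearMap.sub_apply]; simp

lemma tau_cast_ne_zero (i : Y m n) : ((tau i : ℤ) : F) ≠ 0 := by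
  rcases i with (i | i) | k <;> simp [tau]

lemma end_smul_lie (z : F) (A B : Module.End F (O F m n)) : ⁅z • A, B⁆ = z • ⁅A, B⁆ := by
  refine LinearMap.ext fun f => ?_
  rw [lie_eq, lie_eq, LinearMap.sub_apply, LinearMap.smul_apply, LinearMap.sub_apply, smul_sub]
  simp

lemma lie_DH_vf {f : O F m n} (hf : f ∈ mspan F (parSet m n 0)) {c : Y m n → O F m n}
    (hc : EvenCoef c) :
    ⁅DH f, vf c⁆ = vf fun j => DH f (c j) - vf c (DHCoef f j) := by
  rw [DH_eq_vf, lie_vf (evenCoef_DHCoef hf) hc]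

lemma dEven_eq_vf (i : Y0 m) : (dEven i : Module.End F (O F m n))
    = vf (Pi.single (Sum.inl i) (mono (0, ∅))) := by
  refine LinearMap.ext fun f => ?_
  rw [vf_apply, sum_eq_single (Sum.inl i)]
  · rw [Pi.single_eq_same, mulO_even_comm (mono_mem (by simp [parSet])), mulO_one]
    rfl
  · intro j _ hj
    simp [Pi.single_eq_of_ne hj]
  · simp

lemma dEven_pd (i : Y0 m) (j : Y m n) (f : O F m n) : dEven i (pd j f) = pd j (dEven i f) := by
  rcases j with j | k
  · exact dEven_dEven i j f
  · exact dEven_dOdd i k f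

lemma lie_dEven_vf (i : Y0 m) (c : Y m n → O F m n) :
    ⁅(dEven i : Module.End F (O F m n)), vf c⁆ = vf fun j => dEven i (c j) := by
  refine LinearMap.ext fun f => ?_
  rw [lie_eq, LinearMap.sub_apply, Module.End.mul_apply, Module.End.mul_apply,
    vf_apply, vf_apply, vf_apply, map_sum, ← sum_sub_distrib]
  refine sum_congr rfl fun j _ => ?_
  rw [dEven_mul, ← dEven_pd, add_sub_cancel_right]

/-- This places the constant fields ∂_i, i ∈ Y₀, among the Hamiltonian fields, so that a derivation
can be tested against them. -/
lemma DH_mono_single (i : Y0 m) : DH (mono (Pi.single i 1, ∅) : O F m n)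
    = ((tau (Sum.inl i : Y m n) : ℤ) : F) • dEven i.swap := by
  refine LinearMap.ext fun g => ?_
  rw [DH_pure_apply, sum_eq_single i, LinearMap.smul_apply,
    Int.cast_smul_eq_zsmul]
  · congr 1
    have := dEven_mono_add (F := F) i 0 (∅ : Finset (Fin n))
    rw [zero_add] at this
    rw [this, mulO_even_comm (mono_mem (even_parSet (by simp))), mulO_one]
  · intro j _ hj
    rw [dEven_mono_of_eq_zero _ (by simp [hj])]; simp
  · simp

lemma DH_one : DH (mono (0, ∅) : O F m n) = 0 := by
  refine LinearMap.ext fun g => ?_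
  rw [DH_pure_apply]
  exact sum_eq_zero fun i _ => by rw [dEven_mono_of_eq_zero _ (by simp)]; simp

end Monomials

/-! ### Degrees, and membership of auxiliary monomials in the index set of 𝔑 -/

section Degrees
variable {F : Type*} [Field F] {p m n : ℕ} {t : Y0 m → ℕ+}

/-- The total degree `|α|` of an exponent. -/
def tot (α : Y0 m → ℕ) : ℕ := ∑ i, α i

lemma tot_add (α β : Y0 m → ℕ) : tot (α + β) = tot α + tot β := by
  simp only [tot, Pi.add_apply, sum_add_distrib]

lemma tot_single (i : Y0 m) (a : ℕ) : tot (Pi.single i a) = a := by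
  unfold tot
  rw [sum_eq_single i]
  · simp
  · intro j _ hj; simp [hj]
  · simp

lemma tot_zero : tot (0 : Y0 m → ℕ) = 0 := by simp [tot]

lemma deg_mk (α : Y0 m → ℕ) (u : Finset (Fin n)) : deg (α, u) = tot α + #u := rfl

lemma le_tot (α : Y0 m → ℕ) (i : Y0 m) : α i ≤ tot α :=
  single_le_sum (f := α) (fun _ _ => Nat.zero_le _) (mem_univ i)

lemma add_swap_le_tot (α : Y0 m → ℕ) (i : Y0 m) : α i + α i.swap ≤ tot α := by
  rw [← sum_pair (swap_ne i).symm]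
  exact sum_le_sum_of_subset (subset_univ _)

/-- Lower bounds for the number of variables and for the characteristic. -/
class LargeParams (p m n : ℕ) : Prop where
  three_lt_p : 3 < p
  one_lt_m : 1 < m
  three_lt_n : 3 < n

/-- Here m > 1 enters: an auxiliary pair of variables is always at hand, both for brackets and for
keeping an exponent below its bound. -/
lemma exists_not_mem_pair [h : LargeParams p m n] (i : Y0 m) :
    ∃ j : Y0 m, j ≠ i ∧ j ≠ i.swap := by
  have hm := h.one_lt_m
  obtain ⟨k, hk⟩ : ∃ k : Fin m, k ≠ Sum.elim id id i := by
    have : Nontrivial (Fin m) := Fin.nontrivial_iff_two_le.2 hm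
    exact exists_ne _
  refine ⟨Sum.inl k, ?_, ?_⟩ <;> rcases i with i | i <;> simp_all

lemma three_le_piTop [h : LargeParams p m n] (i : Y0 m) : 3 ≤ piTop p t i := by
  have h1 := h.three_lt_p
  have : p ^ 1 ≤ p ^ (t i : ℕ) := Nat.pow_le_pow_right (by omega) (t i).pos
  rw [pow_one] at this
  unfold piTop
  omega

/-- Both excluded monomials have exponent π, so a single exponent strictly below its bound avoids
them. -/
lemma mem_NSet {α : Y0 m → ℕ} {u : Finset (Fin n)} (h : ∀ i, α i ≤ piTop p t i) (hu : Even #u)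
    {i : Y0 m} (hi : α i < piTop p t i) : (α, u) ∈ NSet p n t := by
  refine ⟨⟨h, even_parSet hu⟩, ?_, ?_⟩ <;>
  · intro h'
    rw [Prod.mk.injEq] at h'
    rw [h'.1] at hi
    exact lt_irrefl _ hi

lemma le_piTop_of_mem {a : Idx m n} (h : a ∈ NSet p n t) (i : Y0 m) : a.1 i ≤ piTop p t i :=
  h.1.1 i

lemma even_of_mem {a : Idx m n} (h : a ∈ NSet p n t) : Even #a.2 := even_of_parSet h.1.2

lemma single_mem_NSet [LargeParams p m n] (i : Y0 m) :
    ((Pi.single i 1, ∅) : Idx m n) ∈ NSet p n t := by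
  obtain ⟨j, hj, -⟩ := exists_not_mem_pair (p := p) (n := n) i
  refine mem_NSet (fun k => ?_) (by simp) (i := j) ?_
  · have := three_le_piTop (p := p) (n := n) (t := t) k
    by_cases hk : k = i
    · subst hk; simp; omega
    · simp [hk]
  · have := three_le_piTop (p := p) (n := n) (t := t) j
    rw [Pi.single_eq_of_ne hj]; omega

lemma dEven_mem_NSet {α : Y0 m → ℕ} {u : Finset (Fin n)} {i : Y0 m}
    (h : (α + Pi.single i 1, u) ∈ NSet p n t) : (α, u) ∈ NSet p n t := by
  have h1 := fun j => le_piTop_of_mem h j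
  refine mem_NSet (fun j => le_trans (by simp) (h1 j)) (even_of_mem h) (i := i) ?_
  have := h1 i
  simp at this
  omega

end Degrees

/-! ### Constraints on a value from ∂_i and from x_i x_{i'} -/

section NegativeDerivations
variable {F : Type*} [Field F] {p m n : ℕ} {t : Y0 m → ℕ+}

/-- The maps `f ↦ D(D_H(f))` for the derivations `D` of degree `r`. -/
structure NegDer (F : Type*) [Field F] (p : ℕ) {m : ℕ} (n : ℕ) (t : Y0 m → ℕ+) (r : ℤ)
    (L : O F m n →ₗ[F] Module.End F (O F m n)) : Prop where
  coef : ∀ a ∈ NSet p n t, ∃ c ∈ WCoefDeg F p n t ((deg a : ℤ) - 2 + r), L (mono a) = vf c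
  lie : ∀ a ∈ NSet p n t, ∀ b ∈ NSet p n t, L (DH (mono a) (mono b)) =
    ⁅(DH (mono a) : Module.End F (O F m n)), L (mono b)⁆
      - ⁅(DH (mono b) : Module.End F (O F m n)), L (mono a)⁆

/-- `L` vanishes on all basis elements of degree less than `d`. -/
def KillsBelow (p : ℕ) (t : Y0 m → ℕ+) (d : ℕ)
    (L : O F m n →ₗ[F] Module.End F (O F m n)) : Prop :=
  ∀ a ∈ NSet p n t, deg a < d → L (mono a) = 0

lemma WCoefDeg_evenCoef {d : ℤ} {c : Y m n → O F m n} (hc : c ∈ WCoefDeg F p n t d) :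
    EvenCoef c :=
  fun i => mspan_mono (fun _ h => h.1.2) (hc i (Set.mem_univ i))

lemma WCoefDeg_apply {d : ℤ} {c : Y m n → O F m n} (hc : c ∈ WCoefDeg F p n t d) {j : Y m n}
    {a : Idx m n} (h : c j a ≠ 0) : (#a.2 : ZMod 2) = mu j ∧ (deg a : ℤ) = d + 1 := by
  by_contra hh
  exact h (mspan_coeff (hc j (Set.mem_univ j)) fun h' => hh ⟨h'.1.2, h'.2⟩)

lemma WCoefDeg_eq_zero {d : ℤ} (hd : d ≤ -2) {c : Y m n → O F m n}
    (hc : c ∈ WCoefDeg F p n t d) : c = 0 := by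
  funext j
  ext a
  by_contra h
  have := (WCoefDeg_apply hc h).2
  omega

lemma lie_pure_vf (β : Y0 m → ℕ) {c : Y m n → O F m n} (hc : EvenCoef c)
    (h : ∀ i j, dEven i (c j) = 0) :
    ⁅DH (mono (β, ∅) : O F m n), vf c⁆ =
      vf fun j => - vf c (DHCoef (mono (β, ∅)) j) := by
  rw [lie_DH_vf (mono_mem (even_parSet (by simp))) hc]
  congr 1
  funext j
  rw [DH_pure_apply, sum_eq_zero, zero_sub]
  intro i _
  rw [h]; simp

lemma DHCoef_pure_inr (β : Y0 m → ℕ) (k : Fin n) :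
    DHCoef (mono (β, ∅) : O F m n) (Sum.inr k) = 0 := by
  rw [DHCoef_inr (mono_mem (even_parSet (by simp))), dOdd_mono_empty]

/-- L kills x_{i'}, whose field is ±∂_i. The derivation rule thus reads [∂_i, L(f)] = L(∂_i f), and
∂_i f is zero or a monomial of smaller degree. -/
lemma NegDer.dEven_comm [LargeParams p m n] {r : ℤ}
    {L : O F m n →ₗ[F] Module.End F (O F m n)} (hL : NegDer F p n t r L) {d : ℕ} (hd : 2 ≤ d) (hk : KillsBelow p t d L) {a : Idx m n}
    (ha : a ∈ NSet p n t) (hda : deg a = d) : ∃ c ∈ WCoefDeg F p n t ((d : ℤ) - 2 + r),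
      L (mono a) = vf c ∧ ∀ i j, dEven i (c j) = 0 := by
  obtain ⟨c, hc, h⟩ := hL.coef a ha
  rw [hda] at hc
  refine ⟨c, hc, h, fun i j => ?_⟩
  have h1 := hL.lie _ (single_mem_NSet i.swap) a ha
  rw [hk _ (single_mem_NSet i.swap) (by rw [deg_mk, tot_single]; simp; omega), end_lie_zero, end_sub_zero,
    DH_mono_single, LinearMap.smul_apply, map_smul, end_smul_lie, Sum.swap_swap] at h1
  have h2 : L (dEven i (mono a)) = 0 := by
    obtain ⟨α, u⟩ := a
    by_cases h0 : α i = 0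
    · rw [dEven_mono_of_eq_zero _ h0, map_zero]
    · obtain ⟨γ, rfl⟩ := exists_add_single h0
      rw [dEven_mono_add]
      refine hk _ (dEven_mem_NSet ha) ?_
      rw [← hda, deg_mk, deg_mk, tot_add, tot_single]; omega
  rw [h2, smul_zero, h, lie_dEven_vf, eq_comm] at h1
  exact congrFun (vf_injective (((smul_eq_zero.1 h1).resolve_left (tau_cast_ne_zero _)).trans (map_zero vf).symm)) j

/-- The weight of `∂_j` with respect to `x_i x_{i'}`. -/
def wt (i : Y0 m) : Y m n → ℤ :=
  Sum.elim (fun l => if l = i.swap then 1 else if l = i then -1 else 0) (fun _ => 0)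

lemma mulO_var_dEven (i : Y0 m) (a : Idx m n) :
    mulO (mono (Pi.single i 1, ∅)) (dEven i (mono a) : O F m n) = (a.1 i : F) • mono a := by
  obtain ⟨α, u⟩ := a
  by_cases h0 : α i = 0
  · rw [dEven_mono_of_eq_zero _ h0, map_zero]; simp [h0]
  · obtain ⟨γ, rfl⟩ := exists_add_single h0
    rw [dEven_mono_add, mulO_mono, sgn_empty_left, binom_single]
    simp [add_comm]

lemma dEven_pair_left (i : Y0 m) (u : Finset (Fin n)) :
    dEven i (mono (Pi.single i 1 + Pi.single i.swap 1, u) : O F m n)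
      = mono (Pi.single i.swap 1, u) := by
  rw [add_comm, dEven_mono_add]

lemma DH_pair (i : Y0 m) (a : Idx m n) :
    DH (mono (Pi.single i 1 + Pi.single i.swap 1, ∅)) (mono a : O F m n)
      = (tau (Sum.inl i : Y m n) : F) • ((a.1 i.swap : F) - a.1 i) • mono a := by
  rw [DH_pure_apply, ← sum_subset (subset_univ {i, i.swap}), sum_pair (swap_ne i).symm]
  · rw [dEven_pair_left, dEven_mono_add, Sum.swap_swap, mulO_var_dEven, mulO_var_dEven, tau_swap,
      ← Int.cast_smul_eq_zsmul F, ← Int.cast_smul_eq_zsmul F]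
    module
  · intro l _ hl
    simp only [mem_insert, mem_singleton, not_or] at hl
    rw [dEven_mono_of_eq_zero _ (by simp [hl.1, hl.2])]; simp

lemma vf_DHCoef_pair (i : Y0 m) (c : Y m n → O F m n) (j : Y m n) :
    vf c (DHCoef (mono (Pi.single i 1 + Pi.single i.swap 1, ∅)) j)
      = (tau (Sum.inl i : Y m n) : F) • (wt i j : F) • c j := by
  rcases j with l | k
  · rw [DHCoef_inl, map_zsmul]
    by_cases h1 : l = i.swap
    · subst h1
      rw [Sum.swap_swap, dEven_pair_left, tau_swap, neg_neg]
      have := vf_var c (Sum.inl i.swap)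
      simp only [var, Sum.elim_inl] at this
      rw [this, ← Int.cast_smul_eq_zsmul F]
      simp [wt]
    · by_cases h2 : l = i
      · subst h2
        rw [dEven_mono_add]
        have := vf_var c (Sum.inl l)
        simp only [var, Sum.elim_inl] at this
        rw [this, ← Int.cast_smul_eq_zsmul F]
        simp [wt, (swap_ne l).symm]
      · have h3 : l.swap ≠ i := fun h => h1 (by rw [← h, Sum.swap_swap])
        have h4 : l.swap ≠ i.swap := fun h => h2 (by rw [← Sum.swap_swap l, h, Sum.swap_swap])
        rw [dEven_mono_of_eq_zero _ (by simp [h3, h4])]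
        simp [wt, h1, h2]
  · rw [DHCoef_pure_inr]
    simp [wt]

lemma pair_mem_NSet [LargeParams p m n] (i : Y0 m) :
    ((Pi.single i 1 + Pi.single i.swap 1, ∅) : Idx m n) ∈ NSet p n t := by
  obtain ⟨j, hj, hj'⟩ := exists_not_mem_pair (p := p) (n := n) i
  refine mem_NSet (fun k => ?_) (by simp) (i := j) ?_
  · have := three_le_piTop (p := p) (n := n) (t := t) k
    simp only [Pi.add_apply, Pi.single_apply]
    split_ifs <;> omega
  · have := three_le_piTop (p := p) (n := n) (t := t) j
    simp [hj, hj']; omega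

/-- The element x_i x_{i'} is killed because its degree is two. Up to the common sign τ(i), it
multiplies a monomial by α_{i'} - α_i and a component c_j ∂_j with exterior coefficient by minus the
weight; the derivation rule equates the two scalars in F. -/
lemma NegDer.weight [LargeParams p m n] {r : ℤ}
    {L : O F m n →ₗ[F] Module.End F (O F m n)} (hL : NegDer F p n t r L) {d : ℕ} (hd : 3 ≤ d) (hk : KillsBelow p t d L) {a : Idx m n}
    (ha : a ∈ NSet p n t) {c : Y m n → O F m n} (hc : EvenCoef c) (h : L (mono a) = vf c)
    (hc0 : ∀ i j, dEven i (c j) = 0) {j : Y m n} (hj : c j ≠ 0) (i : Y0 m) :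
    ((a.1 i : F) - a.1 i.swap) = wt i j := by
  have h1 := hL.lie _ (pair_mem_NSet i) a ha
  rw [hk _ (pair_mem_NSet i) (by rw [deg_mk, tot_add, tot_single, tot_single]; simp; omega),
    end_lie_zero, end_sub_zero, DH_pair, h, lie_pure_vf _ hc hc0, map_smul, map_smul, h, ← map_smul,
    ← map_smul] at h1
  have h2 := congrFun (vf_injective h1) j
  simp only [Pi.smul_apply] at h2
  rw [vf_DHCoef_pair, ← smul_neg] at h2
  have h3 := tau_cast_ne_zero (F := F) (Sum.inl i : Y m n)
  have h4 := smul_right_injective _ h3 h2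
  rw [← neg_smul, ← sub_eq_zero, ← sub_smul, smul_eq_zero] at h4
  have h5 := h4.resolve_right hj
  linear_combination -h5

lemma NegDer.exists_weight [LargeParams p m n] {r : ℤ}
    {L : O F m n →ₗ[F] Module.End F (O F m n)} (hL : NegDer F p n t r L) {d : ℕ} (hd : 3 ≤ d) (hk : KillsBelow p t d L) {a : Idx m n}
    (ha : a ∈ NSet p n t) (hda : deg a = d) (h : L (mono a) ≠ 0) :
    ∃ j : Y m n, ∀ i, ((a.1 i : F) - a.1 i.swap) = wt i j := by
  obtain ⟨c, hc, hLc, hc0⟩ := hL.dEven_comm (by omega) hk ha hda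
  obtain ⟨j, hj⟩ : ∃ j, c j ≠ 0 := by
    by_contra! hh
    exact h (by rw [hLc, show c = 0 from funext hh, map_zero])
  exact ⟨j, hL.weight hd hk ha (WCoefDeg_evenCoef hc) hLc hc0 hj⟩

end NegativeDerivations

/-! ### Brackets of monomials in the even variables -/

section PureBrackets
variable {F : Type*} [Field F] {p m n : ℕ} {t : Y0 m → ℕ+}

lemma DH_pure_one_term (i : Y0 m) (α β : Y0 m → ℕ) (v : Finset (Fin n))
    (h : ∀ l, l ≠ i → α l = 0 ∨ β l.swap = 0) :
    DH (mono (α + Pi.single i 1, ∅)) (mono (β + Pi.single i.swap 1, v) : O F m n)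
      = ((tau (Sum.inl i : Y m n) : ℤ) : F) • mulO (mono (α, ∅)) (mono (β, v)) := by
  rw [DH_pure_apply, sum_eq_single i, Int.cast_smul_eq_zsmul, dEven_mono_add, dEven_mono_add]
  · intro l _ hl
    have hl' : l.swap ≠ i.swap := fun h => hl (by rw [← Sum.swap_swap l, h, Sum.swap_swap])
    rcases h l hl with h | h
    · rw [dEven_mono_of_eq_zero _ (by simp [hl, h])]; simp
    · rw [dEven_mono_of_eq_zero (i := l.swap) _ (by simp [hl', h])]; simp
  · simp

lemma DH_pure_two_terms {i k : Y0 m} (hik : i ≠ k) (α β : Y0 m → ℕ)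
    (h : ∀ l, l ≠ i → l ≠ k → α l = 0 ∨ β l.swap = 0) :
    DH (mono (α + Pi.single i 1 + Pi.single k 1, ∅))
        (mono (β + Pi.single i.swap 1 + Pi.single k.swap 1, ∅) : O F m n)
      = ((tau (Sum.inl i : Y m n) : ℤ) : F) •
          mulO (mono (α + Pi.single k 1, ∅)) (mono (β + Pi.single k.swap 1, ∅))
        + ((tau (Sum.inl k : Y m n) : ℤ) : F) •
          mulO (mono (α + Pi.single i 1, ∅)) (mono (β + Pi.single i.swap 1, ∅)) := by
  rw [DH_pure_apply, ← sum_subset (subset_univ {i, k}), sum_pair hik, Int.cast_smul_eq_zsmul,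
    Int.cast_smul_eq_zsmul, dEven_mono_add, dEven_mono_add, add_right_comm, dEven_mono_add,
    add_right_comm β, dEven_mono_add]
  intro l _ hl
  simp only [mem_insert, mem_singleton, not_or] at hl
  have hl' : ∀ i, l ≠ i → l.swap ≠ i.swap := fun i hl h =>
    hl (by rw [← Sum.swap_swap l, h, Sum.swap_swap])
  rcases h l hl.1 hl.2 with h | h
  · rw [dEven_mono_of_eq_zero _ (by simp [hl, h])]; simp
  · rw [dEven_mono_of_eq_zero (i := l.swap) _ (by simp [hl' _ hl.1, hl' _ hl.2, h])]; simp

lemma DH_single_odd (j : Y0 m) (β : Y0 m → ℕ) {u v : Finset (Fin n)} (hu : Even #u)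
    (h : Disjoint u v) :
    DH (mono (Pi.single j 1, u)) (mono (β + Pi.single j.swap 1, v) : O F m n)
      = (((tau (Sum.inl j : Y m n) : ℤ) : F) * ((sgn u v : ℤ) : F)) • mono (β, u ∪ v) := by
  rw [DH_even_apply (mono_mem (even_parSet hu)), sum_eq_single j]
  · have h1 := dEven_mono_add (F := F) j 0 u
    rw [zero_add] at h1
    rw [h1, dEven_mono_add, mulO_mono, binom_eq_one (by simp), ← Int.cast_smul_eq_zsmul F,
      smul_smul, sum_eq_zero]
    · simp
    · intro k _
      by_cases hk : k ∈ u
      · rw [dOdd_mono_of_notMem (u := v) (disjoint_left.1 h hk), map_zero]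
      · rw [dOdd_mono_of_notMem hk]; simp
  · intro l _ hl
    rw [dEven_mono_of_eq_zero _ (by simp [hl])]; simp
  · simp

/-- The kernel of a derivation is closed under brackets. This is the engine of the induction: to
kill a monomial it is enough to produce it, with nonzero coefficient, as a bracket. -/
lemma NegDer.bracket_zero {r : ℤ} {L : O F m n →ₗ[F] Module.End F (O F m n)}
    (hL : NegDer F p n t r L) {a b : Idx m n} (ha : a ∈ NSet p n t) (hb : b ∈ NSet p n t)
    (hLa : L (mono a) = 0) (hLb : L (mono b) = 0) : L (DH (mono a) (mono b)) = 0 := by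
  rw [hL.lie a ha b hb, hLa, hLb, end_lie_zero, end_lie_zero, end_sub_zero]

lemma NegDer.bracket_left {r : ℤ} {L : O F m n →ₗ[F] Module.End F (O F m n)}
    (hL : NegDer F p n t r L) {a b : Idx m n} (ha : a ∈ NSet p n t) (hb : b ∈ NSet p n t)
    (hLa : L (mono a) = 0) :
    L (DH (mono a) (mono b)) = ⁅(DH (mono a) : Module.End F (O F m n)), L (mono b)⁆ := by
  rw [hL.lie a ha b hb, hLa, end_lie_zero, end_sub_zero]

lemma eq_zero_of_map_smul {L : O F m n →ₗ[F] Module.End F (O F m n)} {c : F} {f : O F m n}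
    (h : L (c • f) = 0) (hc : c ≠ 0) : L f = 0 := by
  rw [map_smul] at h
  exact (smul_eq_zero.1 h).resolve_left hc

lemma exists_lt_piTop {α : Y0 m → ℕ} (h : ((α, ∅) : Idx m n) ∈ NSet p n t) :
    ∃ i, α i < piTop p t i := by
  by_contra! hh
  refine h.2.2 ?_
  rw [Prod.mk.injEq]
  exact ⟨funext fun i => le_antisymm (le_piTop_of_mem h i) (hh i), rfl⟩

lemma swap_ne_of {i j : Y0 m} (h : j ≠ i.swap) : j.swap ≠ i := fun h' =>
  h (by rw [← h', Sum.swap_swap])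

lemma swap_ne_swap {i j : Y0 m} (h : j ≠ i) : j.swap ≠ i.swap := fun h' =>
  h (by rw [← Sum.swap_swap j, h', Sum.swap_swap])

/-- The exponent of `x^(α)` in the variables `x_k` and `x_{k'}`. -/
lemma pair_le (α : Y0 m → ℕ) (k : Y0 m) :
    Pi.single k (α k) + Pi.single k.swap (α k.swap) ≤ α := by
  intro l
  have := swap_ne k
  simp only [Pi.add_apply, Pi.single_apply]
  grind

/-- Let γ be the part of α on the pair of k and β the rest. Then {x^(β) x_i, x^(γ) x_{i'}} = ± x^(α)
up to divided power factors equal to one, since β and γ have disjoint supports. Both arguments have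
smaller degree because β and γ have degree at least two; room for x_i in the first requires α_i <
π_i. -/
lemma NegDer.split_pair [LargeParams p m n] {r : ℤ}
    {L : O F m n →ₗ[F] Module.End F (O F m n)} (hL : NegDer F p n t r L) {d : ℕ}
    (hk : KillsBelow p t d L) {α : Y0 m → ℕ} (ha : ((α, ∅) : Idx m n) ∈ NSet p n t)
    (hda : tot α = d) {i k : Y0 m} (hi : α i < piTop p t i) (hik : k ≠ i) (hik' : k ≠ i.swap)
    (h1 : 2 ≤ α k + α k.swap) (h2 : α k + α k.swap + 2 ≤ tot α) : L (mono (α, ∅)) = 0 := by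
  obtain ⟨γ, hγ⟩ : ∃ γ : Y0 m → ℕ, γ = Pi.single k (α k) + Pi.single k.swap (α k.swap) := ⟨_, rfl⟩
  obtain ⟨β, hβ⟩ : ∃ β : Y0 m → ℕ, α = β + γ := ⟨α - γ, by rw [hγ, tsub_add_cancel_of_le (pair_le α k)]⟩
  have hki : k.swap ≠ i := swap_ne_of hik'
  have hki' : k.swap ≠ i.swap := swap_ne_swap hik
  have hkk := swap_ne k
  have hii := swap_ne i
  have htγ : tot γ = α k + α k.swap := by rw [hγ, tot_add, tot_single, tot_single]
  have htα : tot α = tot β + tot γ := by rw [hβ, tot_add]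
  have hγl : ∀ l, l ≠ k → l ≠ k.swap → γ l = 0 := fun l h h' => by simp [hγ, h, h']
  have hγk : γ k = α k := by simp [hγ, hkk.symm]
  have hγk' : γ k.swap = α k.swap := by simp [hγ, hkk]
  have hsum : ∀ l, α l = β l + γ l := fun l => by rw [hβ]; rfl
  have hβk : β k = 0 := by have := hsum k; omega
  have hβk' : β k.swap = 0 := by have := hsum k.swap; omega
  have hle := fun l => le_piTop_of_mem ha l
  simp only at hle
  have h3 := fun l => three_le_piTop (p := p) (n := n) (t := t) l
  have hf : ((β + Pi.single i 1, ∅) : Idx m n) ∈ NSet p n t := by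
    refine mem_NSet (fun l => ?_) (by simp) (i := k) ?_
    · simp only [Pi.add_apply, Pi.single_apply]
      have := hsum l; have := hle l
      split_ifs with h
      · subst h; omega
      · omega
    · simp [hik, hβk]; have := h3 k; omega
  have hg : ((γ + Pi.single i.swap 1, ∅) : Idx m n) ∈ NSet p n t := by
    refine mem_NSet (fun l => ?_) (by simp) (i := i) ?_
    · simp only [Pi.add_apply, Pi.single_apply]
      have := hsum l; have := hle l; have := h3 l
      split_ifs with h
      · subst h
        have := hγl _ hik'.symm hki'.symm
        omega
      · omega
    · simp [hii.symm, hγl i hik.symm hki.symm]; have := h3 i; omega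
  have key := hL.bracket_zero hf hg
    (hk _ hf (by rw [deg_mk, tot_add, tot_single]; simp; omega))
    (hk _ hg (by rw [deg_mk, tot_add, tot_single]; simp; omega))
  have hor : ∀ l, β l = 0 ∨ γ l = 0 := by
    intro l
    by_cases h : l = k
    · subst h; exact Or.inl hβk
    · by_cases h' : l = k.swap
      · subst h'; exact Or.inl hβk'
      · exact Or.inr (hγl l h h')
  rw [DH_pure_one_term, mulO_even_mono _ _ _ hor, ← hβ] at key
  · exact eq_zero_of_map_smul key (tau_cast_ne_zero _)
  · intro l _
    by_cases h : l = k
    · subst h; exact Or.inl hβk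
    · by_cases h' : l = k.swap
      · subst h'; exact Or.inl hβk'
      · exact Or.inr (hγl _ (swap_ne_of h') (swap_ne_swap h))

lemma pairs_le_tot (α : Y0 m → ℕ) {i k : Y0 m} (hik : k ≠ i) (hik' : k ≠ i.swap) :
    α i + α i.swap + (α k + α k.swap) ≤ tot α := by
  obtain ⟨β, hβ⟩ : ∃ β : Y0 m → ℕ, α = β + (Pi.single k (α k) + Pi.single k.swap (α k.swap)) :=
    ⟨α - _, by rw [tsub_add_cancel_of_le (pair_le α k)]⟩
  have h1 : tot α = tot β + (α k + α k.swap) := by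
    conv_lhs => rw [hβ, tot_add, tot_add, tot_single, tot_single]
  have h2 := add_swap_le_tot β i
  have h3 : α i = β i := by
    rw [hβ]; simp [hik.symm, (swap_ne_of hik').symm]
  have h4 : α i.swap = β i.swap := by
    rw [hβ]; simp [hik'.symm, (swap_ne_swap hik).symm]
  omega

/-- Since x^(π) is excluded, some exponent α_l is below its bound. At least one of the two given
pairs does not contain l, and that one can be split off by `NegDer.split_pair`. -/
lemma NegDer.two_large_pairs [LargeParams p m n] {r : ℤ}
    {L : O F m n →ₗ[F] Module.End F (O F m n)} (hL : NegDer F p n t r L) {d : ℕ}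
    (hk : KillsBelow p t d L) {α : Y0 m → ℕ} (ha : ((α, ∅) : Idx m n) ∈ NSet p n t)
    (hda : tot α = d) {i k : Y0 m} (hik : k ≠ i) (hik' : k ≠ i.swap)
    (h1 : 2 ≤ α i + α i.swap) (h2 : 2 ≤ α k + α k.swap) : L (mono (α, ∅)) = 0 := by
  obtain ⟨l, hl⟩ := exists_lt_piTop ha
  have h3 := pairs_le_tot α hik hik'
  by_cases hli : l = i ∨ l = i.swap
  · refine hL.split_pair hk ha hda hl (k := k) ?_ ?_ h2 (by omega) <;>
    rcases hli with rfl | rfl <;> simpa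
  · push Not at hli
    refine hL.split_pair hk ha hda hl (k := i) hli.1.symm ?_ h1 (by omega)
    exact fun h => hli.2 (by rw [h, Sum.swap_swap])

/-- Two distinct pairs of variables cannot both have a nonzero weight. -/
lemma NegDer.weight_pair [LargeParams p m n] {r : ℤ}
    {L : O F m n →ₗ[F] Module.End F (O F m n)} (hL : NegDer F p n t r L) {d : ℕ} (hd : 3 ≤ d)
    (hk : KillsBelow p t d L) {a : Idx m n} (ha : a ∈ NSet p n t) (hda : deg a = d)
    {i k : Y0 m} (hik : k ≠ i) (hik' : k ≠ i.swap) (h1 : (a.1 i : F) ≠ a.1 i.swap)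
    (h2 : (a.1 k : F) ≠ a.1 k.swap) : L (mono a) = 0 := by
  by_contra hne
  obtain ⟨j, hj⟩ := hL.exists_weight hd hk ha hda hne
  have hi := hj i
  have hk := hj k
  -- If ∂_j belongs to the pair of i, its weight on the pair of k is zero; otherwise its weight on
  -- the pair of i is zero.
  rcases j with l | l
  · simp only [wt, Sum.elim_inl] at hi hk
    by_cases hl : l = i.swap ∨ l = i
    · rw [if_neg, if_neg, Int.cast_zero, sub_eq_zero] at hk
      · exact h2 hk
      · rintro rfl; tauto
      · rintro rfl
        rcases hl with hl | hl
        · exact swap_ne_swap hik hl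
        · exact swap_ne_of hik' hl
    · push Not at hl
      rw [if_neg hl.1, if_neg hl.2, Int.cast_zero, sub_eq_zero] at hi
      exact h1 hi
  · simp only [wt, Sum.elim_inr, Int.cast_zero, sub_eq_zero] at hi
    exact h1 hi

end PureBrackets

/-! ### Vanishing on monomials in the even variables -/

section PureUniqueness
variable {F : Type*} [Field F] {p m n : ℕ} {t : Y0 m → ℕ+}

/-- Take for k the largest power of p not exceeding a. Adding k and a - k in base p produces no
carry, so by Kummer's theorem p does not divide the binomial coefficient; k < a exactly because a is
not a power of p. -/
lemma exists_choose_ne_zero [Fact p.Prime] [CharP F p] {a : ℕ} (ha : a ≠ 0)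
    (h : ∀ s, a ≠ p ^ s) : ∃ k, 0 < k ∧ k < a ∧ (a.choose k : F) ≠ 0 := by
  have hp : p.Prime := Fact.out
  refine ⟨p ^ Nat.log p a, pow_pos hp.pos _,
    lt_of_le_of_ne (Nat.pow_log_le_self p ha) (h _).symm, ?_⟩
  rw [Ne, CharP.cast_eq_zero_iff F p]
  have hle := Nat.pow_log_le_self p ha
  intro hdvd
  have h1 := one_le_padicValNat_of_dvd (Nat.choose_pos hle).ne' hdvd
  rw [padicValNat_choose hle (Nat.lt_succ_self _), Nat.one_le_iff_ne_zero, card_ne_zero] at h1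
  obtain ⟨i, hi⟩ := h1
  simp only [mem_filter, mem_Ico] at hi
  obtain ⟨⟨-, hi1⟩, hi2⟩ := hi
  have h3 : p ^ i ∣ p ^ Nat.log p a := Nat.pow_dvd_pow p (by omega)
  rw [Nat.mod_eq_zero_of_dvd h3, zero_add] at hi2
  exact absurd (Nat.mod_lt (a - p ^ Nat.log p a) (pow_pos hp.pos i)) (not_lt.2 hi2)

/-- Monomials `x_i x_j^(c+1) x_{j'}^(d+1)`. -/
lemma NegDer.single_mul_pair [LargeParams p m n] {r : ℤ}
    {L : O F m n →ₗ[F] Module.End F (O F m n)} (hL : NegDer F p n t r L) {e : ℕ}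
    (hk : KillsBelow p t e L) {i j : Y0 m} (hij : j ≠ i) (hij' : j ≠ i.swap) {c d : ℕ}
    (ha : ((Pi.single i 1 + Pi.single j (c + 1) + Pi.single j.swap (d + 1), ∅) : Idx m n)
      ∈ NSet p n t) (hd : 1 ≤ d) (hcd : 2 ≤ c + d) (he : c + d + 3 = e) :
    L (mono (Pi.single i 1 + Pi.single j (c + 1) + Pi.single j.swap (d + 1), ∅)) = 0 := by
  have hii := swap_ne i
  have hjj := swap_ne j
  have h1 : j.swap ≠ i := swap_ne_of hij'
  have h2 : j.swap ≠ i.swap := swap_ne_swap hij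
  have h3 := fun l => three_le_piTop (p := p) (n := n) (t := t) l
  have hle := fun l => le_piTop_of_mem ha l
  have hj := hle j
  have hj' := hle j.swap
  simp only [Pi.add_apply, Pi.single_apply, hij, h1, hjj, hjj.symm, if_true,
    if_false, zero_add, add_zero] at hj hj'
  -- The bracket of x_i^(2) x_j^(c+1) and x_{i'} x_{j'}^(d+1) is ± the given monomial plus ± x_i^(2)
  -- x_{i'} x_j^(c) x_{j'}^(d). The second term has degree at least two in each of the two pairs and
  -- is already killed.
  have hf : ((Pi.single i 1 + Pi.single j c + Pi.single i 1 + Pi.single j 1, ∅) : Idx m n)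
      ∈ NSet p n t := by
    refine mem_NSet (fun l => ?_) (by simp) (i := i.swap) ?_
    · have := h3 l
      simp only [Pi.add_apply, Pi.single_apply]
      grind
    · have := h3 i.swap
      simp only [Pi.add_apply, Pi.single_apply]
      grind
  have hg : ((Pi.single j.swap d + Pi.single i.swap 1 + Pi.single j.swap 1, ∅) : Idx m n)
      ∈ NSet p n t := by
    refine mem_NSet (fun l => ?_) (by simp) (i := i) ?_
    · have := h3 l
      simp only [Pi.add_apply, Pi.single_apply]
      grind
    · have := h3 i
      simp only [Pi.add_apply, Pi.single_apply]
      grind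
  have key := hL.bracket_zero hf hg
    (hk _ hf (by simp only [deg_mk, tot_add, tot_single, card_empty]; omega))
    (hk _ hg (by simp only [deg_mk, tot_add, tot_single, card_empty]; omega))
  rw [DH_pure_two_terms hij.symm, mulO_even_mono, mulO_even_mono, map_add, map_smul, map_smul] at key
  · have h4 : L (mono (Pi.single i 1 + Pi.single j c + Pi.single i 1
        + (Pi.single j.swap d + Pi.single i.swap 1), ∅)) = 0 := by
      refine hL.two_large_pairs hk ?_ ?_ hij hij' ?_ ?_
      · refine mem_NSet (fun l => ?_) (by simp) (i := j) ?_
        · have := h3 l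
          simp only [Pi.add_apply, Pi.single_apply]
          grind
        · simp only [Pi.add_apply, Pi.single_apply]
          grind
      · simp only [tot_add, tot_single]; omega
      · simp only [Pi.add_apply, Pi.single_apply]; grind
      · simp only [Pi.add_apply, Pi.single_apply]; grind
    rw [h4, smul_zero, add_zero] at key
    have h5 := (smul_eq_zero.1 key).resolve_left (tau_cast_ne_zero _)
    rw [← h5]
    congr 3
    funext l
    simp only [Pi.add_apply, Pi.single_apply]
    split_ifs <;> omega
  · intro l
    simp only [Pi.add_apply, Pi.single_apply]; grind
  · intro l
    simp only [Pi.add_apply, Pi.single_apply]; grind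
  · intro l hl hl'
    simp only [Pi.add_apply, Pi.single_apply]; grind

lemma two_ne_zero_of_large [Fact p.Prime] [CharP F p] [h : LargeParams p m n] :
    (2 : F) ≠ 0 := by
  have h1 := h.three_lt_p
  have : ((2 : ℕ) : F) ≠ 0 := by
    rw [Ne, CharP.cast_eq_zero_iff F p]
    exact fun h => absurd (Nat.le_of_dvd (by norm_num) h) (by omega)
  exact_mod_cast this

/-- Monomials `x_i x_j x_{j'}`. -/
lemma NegDer.single_mul_single_pair [Fact p.Prime] [CharP F p] [LargeParams p m n] {r : ℤ}
    {L : O F m n →ₗ[F] Module.End F (O F m n)} (hL : NegDer F p n t r L)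
    (hk : KillsBelow p t 3 L) {i j : Y0 m} (hij : j ≠ i) (hij' : j ≠ i.swap) :
    L (mono (Pi.single i 1 + Pi.single j 1 + Pi.single j.swap 1, ∅)) = 0 := by
  have hii := swap_ne i
  have hjj := swap_ne j
  have h1 : j.swap ≠ i := swap_ne_of hij'
  have h2 : j.swap ≠ i.swap := swap_ne_swap hij
  have h3 := fun l => three_le_piTop (p := p) (n := n) (t := t) l
  -- The monomial is ± the bracket of x_i x_j^(2) and x_{j'}^(2). The first argument also has degree
  -- three, but it is killed by its weights 1 and 2 on two different pairs; here 2 ≠ 0 in F is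
  -- needed.
  have hf : ((Pi.single i 1 + Pi.single j 1 + Pi.single j 1, ∅) : Idx m n)
      ∈ NSet p n t := by
    refine mem_NSet (fun l => ?_) (by simp) (i := i.swap) ?_
    · have := h3 l
      simp only [Pi.add_apply, Pi.single_apply]
      grind
    · have := h3 i.swap
      simp only [Pi.add_apply, Pi.single_apply]
      grind
  have hg : ((Pi.single j.swap 1 + Pi.single j.swap 1, ∅) : Idx m n)
      ∈ NSet p n t := by
    refine mem_NSet (fun l => ?_) (by simp) (i := i) ?_
    · have := h3 l
      simp only [Pi.add_apply, Pi.single_apply]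
      grind
    · have := h3 i
      simp only [Pi.add_apply, Pi.single_apply]
      grind
  have hLf : L (mono (Pi.single i 1 + Pi.single j 1 + Pi.single j 1, ∅)) = 0 := by
    refine hL.weight_pair le_rfl hk hf ?_ hij hij' ?_ ?_
    · simp only [deg_mk, tot_add, tot_single, card_empty]
    · simp [hij.symm, hij'.symm, hii]
    · simp [hij, hjj, h1, one_add_one_eq_two]
      exact two_ne_zero_of_large (p := p) (m := m) (n := n)
  have key := hL.bracket_zero hf hg hLf
    (hk _ hg (by simp only [deg_mk, tot_add, tot_single, card_empty]; omega))
  rw [DH_pure_one_term, mulO_even_mono] at key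
  · exact eq_zero_of_map_smul key (tau_cast_ne_zero _)
  · intro l
    simp only [Pi.add_apply, Pi.single_apply]; grind
  · intro l hl
    simp only [Pi.add_apply, Pi.single_apply]; grind

/-- `L` vanishes on the `x_j^(q)` and on the `x_i x_j^(q)` of degree `d`, where `q > 1` is a power
of `p` and `i` is outside the pair of `j`. -/
structure KillsSpecial (p : ℕ) (n : ℕ) (t : Y0 m → ℕ+) (d : ℕ)
    (L : O F m n →ₗ[F] Module.End F (O F m n)) : Prop where
  pow : ∀ j s, 1 ≤ s → p ^ s ≤ piTop p t j → p ^ s = d → L (mono (Pi.single j (p ^ s), ∅)) = 0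
  mul_pow : ∀ j s, 1 ≤ s → p ^ s ≤ piTop p t j → p ^ s + 1 = d → ∀ i, j ≠ i → j ≠ i.swap →
    L (mono (Pi.single i 1 + Pi.single j (p ^ s), ∅)) = 0

/-- Monomials `x_i x_j^(c)` with `p ∣ c`. -/
lemma NegDer.single_mul_power [Fact p.Prime] [CharP F p] [LargeParams p m n] {r : ℤ}
    {L : O F m n →ₗ[F] Module.End F (O F m n)} (hL : NegDer F p n t r L) {e : ℕ}
    (hk : KillsBelow p t e L) (hs : KillsSpecial p n t e L) {i j : Y0 m} (hij : j ≠ i)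
    (hij' : j ≠ i.swap) {c : ℕ}
    (ha : ((Pi.single i 1 + Pi.single j c, ∅) : Idx m n) ∈ NSet p n t) (hc : 2 ≤ c)
    (hc0 : (c : F) = 0) (he : c + 1 = e) :
    L (mono (Pi.single i 1 + Pi.single j c, ∅)) = 0 := by
  have hii := swap_ne i
  have hjj := swap_ne j
  have h1 : j.swap ≠ i := swap_ne_of hij'
  have h2 : j.swap ≠ i.swap := swap_ne_swap hij
  have h3 := fun l => three_le_piTop (p := p) (n := n) (t := t) l
  have hj := le_piTop_of_mem ha j
  simp only [Pi.add_apply, Pi.single_apply, hij, if_true, if_false, zero_add] at hj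
  by_cases hpow : ∃ s, c = p ^ s
  · obtain ⟨s, rfl⟩ := hpow
    refine hs.mul_pow j s ?_ hj he i hij hij'
    rw [Nat.one_le_iff_ne_zero]
    rintro rfl
    simp at hc
  push Not at hpow
  obtain ⟨k, hk0, hkc, hch⟩ := exists_choose_ne_zero (F := F) (p := p) (by omega) hpow
  obtain ⟨l, rfl⟩ : ∃ l, c = k + l := ⟨c - k, by omega⟩
  -- The case l = 1 would make the binomial coefficient equal to c, which is zero in F. The bound
  -- lets x_i^(2) x_j^(k) have smaller degree; its bracket with x_j^(l) x_{i'} is ± (k+l choose k)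
  -- times the given monomial.
  have hl : 2 ≤ l := by
    by_contra hl
    obtain rfl : l = 1 := by omega
    rw [Nat.choose_succ_self_right] at hch
    exact hch hc0
  have hf : ((Pi.single i 1 + Pi.single j k + Pi.single i 1, ∅) : Idx m n) ∈ NSet p n t := by
    refine mem_NSet (fun l => ?_) (by simp) (i := i.swap) ?_
    · have := h3 l
      simp only [Pi.add_apply, Pi.single_apply]
      grind
    · have := h3 i.swap
      simp only [Pi.add_apply, Pi.single_apply]
      grind
  have hg : ((Pi.single j l + Pi.single i.swap 1, ∅) : Idx m n) ∈ NSet p n t := by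
    refine mem_NSet (fun l => ?_) (by simp) (i := i) ?_
    · have := h3 l
      simp only [Pi.add_apply, Pi.single_apply]
      grind
    · have := h3 i
      simp only [Pi.add_apply, Pi.single_apply]
      grind
  have key := hL.bracket_zero hf hg
    (hk _ hf (by simp only [deg_mk, tot_add, tot_single, card_empty]; omega))
    (hk _ hg (by simp only [deg_mk, tot_add, tot_single, card_empty]; omega))
  rw [DH_pure_one_term, mulO_mono, sgn_empty_left, binom_comm, binom_single, map_smul,
    empty_union] at key
  · have h5 := (smul_eq_zero.1 key).resolve_left (tau_cast_ne_zero _)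
    rw [add_assoc, ← Pi.single_add] at h5
    refine eq_zero_of_map_smul h5 ?_
    rw [Nat.choose_symm_add] at hch
    simpa [hij, add_comm l k] using hch
  · intro l hl
    simp only [Pi.add_apply, Pi.single_apply]; grind

/-- Monomials in which one pair of variables has degree one, and another one occurs. -/
lemma NegDer.small_pair [Fact p.Prime] [CharP F p] [LargeParams p m n] {r : ℤ}
    {L : O F m n →ₗ[F] Module.End F (O F m n)} (hL : NegDer F p n t r L) {d : ℕ} (hd : 3 ≤ d)
    (hk : KillsBelow p t d L) (hs : KillsSpecial p n t d L) {α : Y0 m → ℕ}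
    (ha : ((α, ∅) : Idx m n) ∈ NSet p n t) (hda : tot α = d) {i j : Y0 m} (hij : j ≠ i)
    (hij' : j ≠ i.swap) (h1 : α i = 1) (h1' : α i.swap = 0) (h2 : α j ≠ 0) :
    L (mono (α, ∅)) = 0 := by
  have hii := swap_ne i
  have hjj := swap_ne j
  have g1 : j.swap ≠ i := swap_ne_of hij'
  have g2 : j.swap ≠ i.swap := swap_ne_swap hij
  -- The pair of i has weight one. Hence every other pair may be assumed to have weight zero modulo
  -- p, which in particular rules out pairs of degree one.
  have hw : ∀ k, k ≠ i → k ≠ i.swap → (α k : F) ≠ α k.swap → L (mono (α, ∅)) = 0 :=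
    fun k hki hki' hne => hL.weight_pair hd hk ha (by rw [deg_mk, hda]; simp) hki hki'
      (by simp [h1, h1']) hne
  have hdeg : ∀ k, k ≠ i → k ≠ i.swap → α k + α k.swap = 1 → L (mono (α, ∅)) = 0 := by
    intro k hki hki' hk1
    refine hw k hki hki' ?_
    have : α k = 0 ∧ α k.swap = 1 ∨ α k = 1 ∧ α k.swap = 0 := by omega
    rcases this with h | h <;> simp [h]
  by_cases hj1 : α j + α j.swap = 1
  · exact hdeg j hij hij' hj1
  by_cases hwj : (α j : F) ≠ α j.swap
  · exact hw j hij hij' hwj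
  rw [not_not] at hwj
  by_cases hother : ∃ k, k ≠ i ∧ k ≠ i.swap ∧ k ≠ j ∧ k ≠ j.swap ∧ α k ≠ 0
  · obtain ⟨k, hki, hki', hkj, hkj', hk0⟩ := hother
    by_cases hk1 : α k + α k.swap = 1
    · exact hdeg k hki hki' hk1
    · exact hL.two_large_pairs hk ha hda hkj hkj' (by omega) (by omega)
  push Not at hother
  have hα : α = Pi.single i 1 + Pi.single j (α j) + Pi.single j.swap (α j.swap) := by
    funext l
    have := hother l
    simp only [Pi.add_apply, Pi.single_apply]
    by_cases hl : l = i.swap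
    · subst hl
      simp [h1', hii, hij'.symm, g2.symm]
    · clear hw hdeg hother
      grind
  have htot : 1 + α j + α j.swap = d := by
    rw [← hda]
    conv_rhs => rw [hα]
    simp only [tot_add, tot_single]
  by_cases hj' : α j.swap = 0
  · rw [hj', Pi.single_zero, add_zero] at hα
    rw [hj', Nat.cast_zero] at hwj
    rw [hα]
    exact hL.single_mul_power hk hs hij hij' (hα ▸ ha) (by omega) hwj (by omega)
  by_cases h11 : α j = 1 ∧ α j.swap = 1
  · rw [h11.1, h11.2] at hα
    rw [hα]
    obtain rfl : d = 3 := by omega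
    exact hL.single_mul_single_pair hk hij hij'
  -- Exponents 1 and 2 differ by ±1 in F, against weight zero. So the pair of j has degree at least
  -- four, and x_j or x_{j'} has exponent at least two, as `NegDer.single_mul_pair` requires after a
  -- possible exchange of j and j'.
  have h3 : ¬ (α j + α j.swap = 3) := by
    intro h3
    have : α j = 1 ∧ α j.swap = 2 ∨ α j = 2 ∧ α j.swap = 1 := by omega
    rcases this with h | h <;> rw [h.1, h.2] at hwj <;> norm_num at hwj
    · exact one_ne_zero (by linear_combination -hwj : (1 : F) = 0)
    · exact one_ne_zero (by linear_combination hwj : (1 : F) = 0)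
  obtain ⟨c, hc⟩ := Nat.exists_eq_add_one_of_ne_zero h2
  obtain ⟨e, he⟩ := Nat.exists_eq_add_one_of_ne_zero hj'
  rw [hc, he] at hα
  rw [hα]
  by_cases he0 : e = 0
  · rw [add_right_comm]
    have h4 := hL.single_mul_pair (d := c) (c := e) hk (i := i) (j := j.swap) g1 g2
    rw [Sum.swap_swap] at h4
    exact h4 (by rw [add_right_comm]; exact hα ▸ ha) (by omega) (by omega) (by omega)
  · exact hL.single_mul_pair hk hij hij' (hα ▸ ha) (by omega) (by omega) (by omega)

lemma NegDer.two_pairs [Fact p.Prime] [CharP F p] [LargeParams p m n] {r : ℤ}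
    {L : O F m n →ₗ[F] Module.End F (O F m n)} (hL : NegDer F p n t r L) {d : ℕ} (hd : 3 ≤ d)
    (hk : KillsBelow p t d L) (hs : KillsSpecial p n t d L) {α : Y0 m → ℕ}
    (ha : ((α, ∅) : Idx m n) ∈ NSet p n t) (hda : tot α = d) {i j : Y0 m} (hij : j ≠ i)
    (hij' : j ≠ i.swap) (h1 : α i ≠ 0) (h2 : α j ≠ 0) :
    L (mono (α, ∅)) = 0 := by
  have hji : i ≠ j.swap := fun h => hij' (by rw [h, Sum.swap_swap])
  by_cases hi : α i + α i.swap = 1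
  · exact hL.small_pair hd hk hs ha hda hij hij' (by omega) (by omega) h2
  by_cases hj : α j + α j.swap = 1
  · exact hL.small_pair hd hk hs ha hda hij.symm hji (by omega) (by omega) h1
  exact hL.two_large_pairs hk ha hda hij hij' (by omega) (by omega)

/-- Monomials `x_i^(a+1) x_{i'}^(b+1)`. -/
lemma NegDer.one_pair [Fact p.Prime] [CharP F p] [LargeParams p m n] {r : ℤ}
    {L : O F m n →ₗ[F] Module.End F (O F m n)} (hL : NegDer F p n t r L) {d : ℕ} (hd : 3 ≤ d)
    (hk : KillsBelow p t d L) (hs : KillsSpecial p n t d L) {i : Y0 m} {a b : ℕ}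
    (ha : ((Pi.single i (a + 1) + Pi.single i.swap (b + 1), ∅) : Idx m n) ∈ NSet p n t)
    (hda : a + b + 2 = d) :
    L (mono (Pi.single i (a + 1) + Pi.single i.swap (b + 1), ∅)) = 0 := by
  obtain ⟨j, hij, hij'⟩ := exists_not_mem_pair (p := p) (n := n) i
  have hii := swap_ne i
  have hjj := swap_ne j
  have g1 : j.swap ≠ i := swap_ne_of hij'
  have g2 : j.swap ≠ i.swap := swap_ne_swap hij
  have h3 := fun l => three_le_piTop (p := p) (n := n) (t := t) l
  have hle := fun l => le_piTop_of_mem ha l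
  have hi := hle i
  have hi' := hle i.swap
  simp only [Pi.add_apply, Pi.single_apply, hii, hii.symm, if_true,
    if_false, zero_add, add_zero] at hi hi'
  -- The auxiliary monomials may have degree d itself, for instance if a or b is zero; as they
  -- involve two pairs, `NegDer.two_pairs` handles that case.
  have hkill : ∀ α : Y0 m → ℕ, ((α, ∅) : Idx m n) ∈ NSet p n t → tot α ≤ d →
      ∀ i j, j ≠ i → j ≠ i.swap → α i ≠ 0 → α j ≠ 0 → L (mono (α, ∅)) = 0 := by
    intro α hα hle i j h1 h2 h4 h5
    rcases hle.lt_or_eq with h | h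
    · exact hk _ hα (by simpa [deg_mk] using h)
    · exact hL.two_pairs hd hk hs hα h h1 h2 h4 h5
  -- The bracket of x_i^(a+1) x_j and x_{i'}^(b+1) x_{j'} is ± the given monomial plus ± x_i^(a)
  -- x_{i'}^(b) x_j x_{j'}. Since a + b > 0, the latter involves two pairs.
  have hf : ((Pi.single i a + Pi.single j 1 + Pi.single i 1, ∅) : Idx m n) ∈ NSet p n t := by
    refine mem_NSet (fun l => ?_) (by simp) (i := j.swap) ?_
    · have := h3 l
      simp only [Pi.add_apply, Pi.single_apply]
      grind
    · have := h3 j.swap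
      simp only [Pi.add_apply, Pi.single_apply]
      grind
  have hg : ((Pi.single i.swap b + Pi.single j.swap 1 + Pi.single i.swap 1, ∅) : Idx m n)
      ∈ NSet p n t := by
    refine mem_NSet (fun l => ?_) (by simp) (i := j) ?_
    · have := h3 l
      simp only [Pi.add_apply, Pi.single_apply]
      grind
    · have := h3 j
      simp only [Pi.add_apply, Pi.single_apply]
      grind
  have key := hL.bracket_zero hf hg
    (hkill _ hf (by simp only [tot_add, tot_single]; omega) i j hij hij'
      (by simp) (by simp))
    (hkill _ hg (by simp only [tot_add, tot_single]; omega) i.swap j.swap g2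
      (by rwa [Sum.swap_swap]) (by simp) (by simp))
  rw [DH_pure_two_terms hij, mulO_even_mono, mulO_even_mono, map_add, map_smul, map_smul] at key
  · have h4 : L (mono (Pi.single i a + Pi.single j 1
        + (Pi.single i.swap b + Pi.single j.swap 1), ∅)) = 0 := by
      have hN : ((Pi.single i a + Pi.single j 1
        + (Pi.single i.swap b + Pi.single j.swap 1), ∅) : Idx m n) ∈ NSet p n t := by
        refine mem_NSet (fun l => ?_) (by simp) (i := j) ?_
        · have := h3 l
          simp only [Pi.add_apply, Pi.single_apply]
          grind
        · have := h3 j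
          simp only [Pi.add_apply, Pi.single_apply]
          grind
      by_cases ha0 : a = 0
      · refine hkill _ hN ?_ i.swap j (by simpa using hij') (by simpa using hij) ?_ (by simp)
        · simp only [tot_add, tot_single]; omega
        · simp; omega
      · refine hkill _ hN ?_ i j hij hij' ?_ (by simp)
        · simp only [tot_add, tot_single]; omega
        · simp; omega
    rw [h4, smul_zero, add_zero] at key
    have h5 := (smul_eq_zero.1 key).resolve_left (tau_cast_ne_zero _)
    rw [← h5]
    congr 3
    funext l
    simp only [Pi.add_apply, Pi.single_apply]
    split_ifs <;> omega
  · intro l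
    simp only [Pi.add_apply, Pi.single_apply]; grind
  · intro l
    simp only [Pi.add_apply, Pi.single_apply]; grind
  · intro l hl hl'
    simp only [Pi.single_apply]; grind

/-- Monomials `x_i^(a)`. -/
lemma NegDer.one_variable [Fact p.Prime] [CharP F p] [LargeParams p m n] {r : ℤ}
    {L : O F m n →ₗ[F] Module.End F (O F m n)} (hL : NegDer F p n t r L) {d : ℕ} (hd : 3 ≤ d)
    (hk : KillsBelow p t d L) (hs : KillsSpecial p n t d L) {i : Y0 m}
    (ha : ((Pi.single i d, ∅) : Idx m n) ∈ NSet p n t) :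
    L (mono (Pi.single i d, ∅)) = 0 := by
  obtain ⟨j, hij, hij'⟩ := exists_not_mem_pair (p := p) (n := n) i
  have hii := swap_ne i
  have hjj := swap_ne j
  have g1 : j.swap ≠ i := swap_ne_of hij'
  have g2 : j.swap ≠ i.swap := swap_ne_swap hij
  have h3 := fun l => three_le_piTop (p := p) (n := n) (t := t) l
  have hi := le_piTop_of_mem ha i
  simp only [Pi.single_apply, if_true] at hi
  by_cases hpow : ∃ s, d = p ^ s
  · obtain ⟨s, rfl⟩ := hpow
    refine hs.pow i s ?_ hi rfl
    rw [Nat.one_le_iff_ne_zero]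
    rintro rfl
    simp at hd
  push Not at hpow
  -- With d = k + l, the bracket of x_i^(k) x_j and x_i^(l) x_{j'} is ± (d choose k) x_i^(d).
  obtain ⟨k, hk0, hkc, hch⟩ := exists_choose_ne_zero (F := F) (p := p) (by omega) hpow
  obtain ⟨l, rfl⟩ : ∃ l, d = k + l := ⟨d - k, by omega⟩
  have hmem : ∀ j c, j ≠ i → j ≠ i.swap → c ≤ k + l →
      ((Pi.single i c + Pi.single j 1, ∅) : Idx m n) ∈ NSet p n t := by
    intro j c h1 h2 h4
    refine mem_NSet (fun l => ?_) (by simp) (i := i.swap) ?_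
    · have := h3 l
      simp only [Pi.add_apply, Pi.single_apply]
      grind
    · have := h3 i.swap
      simp only [Pi.add_apply, Pi.single_apply]
      grind
  have hkill : ∀ j c, j ≠ i → j ≠ i.swap → 0 < c → c < k + l →
      L (mono (Pi.single i c + Pi.single j 1, ∅)) = 0 := by
    intro j c h1 h2 h4 h5
    rcases (Nat.succ_le_of_lt h5).lt_or_eq with h | h
    · exact hk _ (hmem j c h1 h2 h5.le) (by simpa [deg_mk, tot_add, tot_single] using h)
    · exact hL.two_pairs hd hk hs (hmem j c h1 h2 h5.le)
        (by simpa [tot_add, tot_single] using h) h1 h2 (by simp; omega) (by simp)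
  have key := hL.bracket_zero (hmem j k hij hij' (by omega)) (hmem j.swap l g1 g2 (by omega))
    (hkill j k hij hij' (by omega) (by omega)) (hkill j.swap l g1 g2 (by omega) (by omega))
  rw [DH_pure_one_term, mulO_mono, sgn_empty_left, binom_single, map_smul,
    empty_union] at key
  · have h5 := (smul_eq_zero.1 key).resolve_left (tau_cast_ne_zero _)
    rw [← Pi.single_add] at h5
    exact eq_zero_of_map_smul h5 (by simpa using hch)
  · intro l hl
    simp only [Pi.single_apply]; grind

/-- Monomials in the even variables. -/
lemma NegDer.pure [Fact p.Prime] [CharP F p] [LargeParams p m n] {r : ℤ}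
    {L : O F m n →ₗ[F] Module.End F (O F m n)} (hL : NegDer F p n t r L) {d : ℕ} (hd : 3 ≤ d)
    (hk : KillsBelow p t d L) (hs : KillsSpecial p n t d L) {α : Y0 m → ℕ}
    (ha : ((α, ∅) : Idx m n) ∈ NSet p n t) (hda : tot α = d) : L (mono (α, ∅)) = 0 := by
  obtain ⟨i, hi⟩ : ∃ i, α i ≠ 0 := by
    by_contra! h
    rw [show α = 0 from funext h, tot_zero] at hda
    omega
  by_cases hother : ∃ j, j ≠ i ∧ j ≠ i.swap ∧ α j ≠ 0
  · obtain ⟨j, h1, h2, h3⟩ := hother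
    exact hL.two_pairs hd hk hs ha hda h1 h2 hi h3
  push Not at hother
  have hα : α = Pi.single i (α i) + Pi.single i.swap (α i.swap) := by
    funext l
    have := hother l
    have := swap_ne i
    simp only [Pi.add_apply, Pi.single_apply]
    grind
  have htot : α i + α i.swap = d := by
    rw [← hda]
    conv_rhs => rw [hα]
    simp only [tot_add, tot_single]
  by_cases hi' : α i.swap = 0
  · rw [hi', Pi.single_zero, add_zero, show α i = d by omega] at hα
    rw [hα]
    exact hL.one_variable hd hk hs (hα ▸ ha)
  obtain ⟨a, hc⟩ := Nat.exists_eq_add_one_of_ne_zero hi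
  obtain ⟨b, he⟩ := Nat.exists_eq_add_one_of_ne_zero hi'
  rw [hc, he] at hα
  rw [hα]
  exact hL.one_pair hd hk hs (hα ▸ ha) (by omega)

end PureUniqueness

/-! ### Vanishing on monomials with odd variables -/

section OddUniqueness
variable {F : Type*} [Field F] {p m n : ℕ} {t : Y0 m → ℕ+}

lemma mulO_eq_zero_of_mem {s : Fin n} {f g : O F m n} (hf : f ∈ mspan F {a : Idx m n | s ∈ a.2})
    (hg : g ∈ mspan F {a : Idx m n | s ∈ a.2}) : mulO f g = 0 := by
  have h := mspan_mul (R := (∅ : Set (Idx m n))) (fun a ha b hb _ hd =>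
    (disjoint_left.1 hd ha hb).elim) hf hg
  simpa [mspan] using h

/-- The bracket of two monomials with a common odd variable contracts this variable. -/
lemma DH_contract (α β : Y0 m → ℕ) {s : Fin n} {u v : Finset (Fin n)} (hu : s ∉ u) (hv : s ∉ v)
    (he : Even #(insert s u)) (hd : Disjoint u v) : ∃ ε : F, ε ≠ 0 ∧
      DH (mono (α, insert s u)) (mono (β, insert s v)) =
        (ε * binom α β) • (mono (α + β, u ∪ v) : O F m n) := by
  have hmem : ∀ γ w, (mono (γ, insert s w) : O F m n) ∈ mspan F {a : Idx m n | s ∈ a.2} :=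
    fun γ w => mono_mem (by simp)
  refine ⟨(-1) ^ #{l ∈ u | l < s} * (-1) ^ #{l ∈ v | l < s} * ((sgn u v : ℤ) : F), ?_, ?_⟩
  · exact mul_ne_zero (mul_ne_zero (by simp) (by simp)) (sgn_cast_ne_zero hd)
  -- Every derivative other than ∂_s leaves x_s in both factors, and x_s² = 0.
  rw [DH_even_apply (mono_mem (even_parSet he)), sum_eq_zero, zero_add, sum_eq_single s]
  · rw [dOdd_mono_insert hu, dOdd_mono_insert hv, map_smul, map_smul, LinearMap.smul_apply,
      mulO_mono, smul_smul, smul_smul]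
    congr 1
    ring
  · intro k _ hk
    refine mulO_eq_zero_of_mem (s := s) ?_ ?_ <;>
    · refine mspan_dOdd k (fun a ha _ => ?_) (hmem _ _)
      exact mem_erase.2 ⟨hk.symm, ha⟩
  · simp
  · intro i _
    rw [mulO_eq_zero_of_mem (s := s) (mspan_dEven i (fun a ha _ => ha) (hmem _ _))
      (mspan_dEven i.swap (fun a ha _ => ha) (hmem _ _)), smul_zero]

/-- In F one has π_i = -1. Consequently an exponent divisible by p is strictly below its bound and
can be raised. -/
lemma piTop_cast_ne_zero [Fact p.Prime] [CharP F p] (i : Y0 m) : (piTop p t i : F) ≠ 0 := by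
  have hp : p.Prime := Fact.out
  have h1 : 1 ≤ p ^ (t i : ℕ) := Nat.one_le_pow _ _ hp.pos
  rw [piTop, Nat.cast_sub h1, Nat.cast_pow, CharP.cast_eq_zero, zero_pow (t i).pos.ne']
  simp

/-- Monomials `x^(α) x^u` with `u ≠ ω` in which `x^(α)` has an exponent prime to `p`. -/
lemma NegDer.odd_contract [LargeParams p m n] {r : ℤ}
    {L : O F m n →ₗ[F] Module.End F (O F m n)} (hL : NegDer F p n t r L) {d : ℕ} (hd : 4 ≤ d)
    (hk : KillsBelow p t d L) {α : Y0 m → ℕ} {u : Finset (Fin n)}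
    (ha : (α, u) ∈ NSet p n t) (hda : deg (α, u) = d) {k l : Fin n} (hl : l ∈ u) (hku : k ∉ u)
    {j : Y0 m} (hj : (α j : F) ≠ 0) : L (mono (α, u)) = 0 := by
  obtain ⟨γ, rfl⟩ := exists_add_single (α := α) (i := j) (by rintro h; simp [h] at hj)
  obtain ⟨w, hw, rfl⟩ : ∃ w, l ∉ w ∧ u = insert l w :=
    ⟨u.erase l, notMem_erase _ _, (insert_erase hl).symm⟩
  rw [mem_insert, not_or] at hku
  have heven := even_of_mem ha
  have hle := fun i => le_piTop_of_mem ha i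
  simp only at heven hle
  have h3 := fun l => three_le_piTop (p := p) (n := n) (t := t) l
  rw [card_insert_of_notMem hw] at heven
  -- With x_l x^w the odd part, the bracket of x_j x_k x_l and x^(γ) x_k x^w contracts x_k. Its
  -- coefficient is ± (γ_j + 1), which is the exponent of x_j in the given monomial.
  have hf : ((Pi.single j 1, insert k {l}) : Idx m n) ∈ NSet p n t := by
    refine mem_NSet (fun l => ?_) ?_ (i := j) ?_
    · have := h3 l
      simp only [Pi.single_apply]
      grind
    · rw [card_insert_of_notMem (by simpa using hku.1)]
      simp
    · have := h3 j
      simp; omega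
  have hg : ((γ, insert k w) : Idx m n) ∈ NSet p n t := by
    refine mem_NSet (fun l => le_trans (by simp) (hle l)) ?_ (i := j) ?_
    · rwa [card_insert_of_notMem hku.2]
    · have := hle j
      simp at this; omega
  rw [deg_mk, tot_add, tot_single, card_insert_of_notMem hw] at hda
  have key := hL.bracket_zero hf hg
    (hk _ hf (by rw [deg_mk, tot_single, card_insert_of_notMem (by simpa using hku.1)]; simp; omega))
    (hk _ hg (by rw [deg_mk, card_insert_of_notMem hku.2]; omega))
  obtain ⟨ε, hε, h⟩ := DH_contract (F := F) (Pi.single j 1) γ (s := k) (u := {l}) (v := w)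
    (by simpa using hku.1) hku.2 (even_of_mem hf) (by simpa using hw)
  rw [h, binom_single, Nat.choose_one_right, add_comm (Pi.single j 1), ← insert_eq] at key
  refine eq_zero_of_map_smul key (mul_ne_zero hε ?_)
  simpa [add_comm] using hj

/-- Monomials `x^(α) x^u x^w` with `|u| = 2`. -/
lemma NegDer.odd_split [LargeParams p m n] {r : ℤ}
    {L : O F m n →ₗ[F] Module.End F (O F m n)} (hL : NegDer F p n t r L) {d : ℕ} (hd : 4 ≤ d)
    (hk : KillsBelow p t d L) {α : Y0 m → ℕ} {u w : Finset (Fin n)} (hu : #u = 2)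
    (huw : Disjoint u w) {i : Y0 m} (ha : (α + Pi.single i 1, w) ∈ NSet p n t)
    (hda : tot α + #w + 2 = d) : L (mono (α, u ∪ w)) = 0 := by
  have h3 := fun l => three_le_piTop (p := p) (n := n) (t := t) l
  -- The bracket of x_{i'} x^u with x^(α+ε_i) x^w is ± x^(α) x^u x^w: only the derivatives in x_{i'}
  -- and x_i contribute, as u and w are disjoint.
  have hf : ((Pi.single i.swap 1, u) : Idx m n) ∈ NSet p n t := by
    refine mem_NSet (fun l => ?_) (by rw [hu]; exact even_two) (i := i) ?_
    · have := h3 l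
      simp only [Pi.single_apply]
      grind
    · have := h3 i
      simp [(swap_ne i).symm]; omega
  have key := hL.bracket_zero hf ha
    (hk _ hf (by rw [deg_mk, tot_single, hu]; omega))
    (hk _ ha (by rw [deg_mk, tot_add, tot_single]; omega))
  have h := DH_single_odd (F := F) i.swap α (u := u) (v := w) (by rw [hu]; exact even_two) huw
  rw [Sum.swap_swap] at h
  rw [h] at key
  exact eq_zero_of_map_smul key (mul_ne_zero (tau_cast_ne_zero _) (sgn_cast_ne_zero huw))

/-- If u ≠ ω and some exponent is prime to p, an odd variable outside u can be contracted
(`NegDer.odd_contract`). Otherwise two odd variables are split off at the cost of raising one α_i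
(`NegDer.odd_split`). There is room for this: for u = ω because (π, ω) is excluded, for u ≠ ω
because all exponents are divisible by p. -/
lemma NegDer.odd_large [Fact p.Prime] [CharP F p] [LargeParams p m n] {r : ℤ}
    {L : O F m n →ₗ[F] Module.End F (O F m n)} (hL : NegDer F p n t r L) {d : ℕ} (hd : 4 ≤ d)
    (hk : KillsBelow p t d L) {α : Y0 m → ℕ} {u : Finset (Fin n)}
    (ha : (α, u) ∈ NSet p n t) (hda : deg (α, u) = d) (hu : u.Nonempty) :
    L (mono (α, u)) = 0 := by
  have heven := even_of_mem ha
  have hle := fun i => le_piTop_of_mem ha i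
  have h3 := fun l => three_le_piTop (p := p) (n := n) (t := t) l
  simp only at heven hle
  have hu2 : 2 ≤ #u := by
    have := hu.card_pos
    obtain ⟨k, hk⟩ := heven
    omega
  obtain ⟨v, hvu, hv⟩ := exists_subset_card_eq hu2
  have hsplit : ∀ i, (α + Pi.single i 1, u \ v) ∈ NSet p n t → L (mono (α, u)) = 0 := by
    intro i hi
    have := hL.odd_split hd hk hv disjoint_sdiff hi (by
      rw [← hda, deg_mk, card_sdiff_of_subset hvu]; omega)
    rwa [union_sdiff_of_subset hvu] at this
  have heven' : Even #(u \ v) := by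
    rw [card_sdiff_of_subset hvu, hv, Nat.even_sub hu2]
    simp [heven]
  have hadd : ∀ i, α i < piTop p t i → ∀ l, (α + Pi.single i 1 : Y0 m → ℕ) l ≤ piTop p t l := by
    intro i hi l
    have := hle l
    simp only [Pi.add_apply, Pi.single_apply]
    grind
  by_cases hω : u = univ
  · subst hω
    obtain ⟨i, hi⟩ : ∃ i, α i < piTop p t i := by
      by_contra! hh
      refine ha.2.1 ?_
      rw [Prod.mk.injEq]
      exact ⟨funext fun i => le_antisymm (hle i) (hh i), rfl⟩
    -- The raised exponent may equal π. The new monomial is still admissible, since removing two of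
    -- n > 3 odd variables leaves a set that is neither full nor empty.
    refine hsplit i ⟨⟨hadd i hi, even_parSet heven'⟩, ?_, ?_⟩
    · intro h
      have h1 := congrArg card (congrArg Prod.snd h)
      have hn : 3 < n := LargeParams.three_lt_n p m
      rw [card_sdiff_of_subset hvu, hv, card_univ, Fintype.card_fin] at h1
      omega
    · intro h
      have h1 := congrArg card (congrArg Prod.snd h)
      have hn : 3 < n := LargeParams.three_lt_n p m
      rw [card_sdiff_of_subset hvu, hv, card_univ, Fintype.card_fin, card_empty] at h1
      omega
  obtain ⟨k, hku⟩ : ∃ k, k ∉ u := by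
    by_contra! h
    exact hω (eq_univ_iff_forall.2 h)
  obtain ⟨l, hl⟩ := hu
  by_cases hα : ∃ j, (α j : F) ≠ 0
  · obtain ⟨j, hj⟩ := hα
    exact hL.odd_contract hd hk ha hda hl hku hj
  push Not at hα
  have hlt : ∀ i, α i < piTop p t i := fun i => lt_of_le_of_ne (hle i) fun h =>
    piTop_cast_ne_zero (F := F) (p := p) (t := t) i (by rw [← h, hα])
  have hm : 1 < m := LargeParams.one_lt_m p n
  let i : Y0 m := Sum.inl ⟨0, by omega⟩
  refine hsplit i (mem_NSet (hadd i (hlt i)) heven' (i := i.swap) ?_)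
  simpa [swap_ne] using hlt i.swap

/-- The weight on the pair of i is one, while odd ∂_k have weight zero, so no odd components occur.
A coefficient of an even ∂_j has degree 2 + r ≤ 1, lies in the exterior algebra and is even, hence
is constant. -/
lemma NegDer.cubic_coef [LargeParams p m n] {r : ℤ} (hr : r ≤ -1)
    {L : O F m n →ₗ[F] Module.End F (O F m n)} (hL : NegDer F p n t r L)
    (hk : KillsBelow p t 3 L) {i : Y0 m} {u : Finset (Fin n)} (hu : #u = 2)
    (ha : (Pi.single i 1, u) ∈ NSet p n t) : ∃ c : Y m n → O F m n, EvenCoef c ∧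
      L (mono (Pi.single i 1, u)) = vf c ∧ (∀ k, c (Sum.inr k) = 0) ∧
      ∀ j, ∃ x : F, c j = x • mono (0, ∅) := by
  obtain ⟨c, hc, hLc, hc0⟩ := hL.dEven_comm (by omega) hk ha (by rw [deg_mk, tot_single, hu])
  have hinr : ∀ k, c (Sum.inr k) = 0 := by
    intro k
    by_contra h
    have := hL.weight le_rfl hk ha (WCoefDeg_evenCoef hc) hLc hc0 h i
    simp [wt, swap_ne] at this
  refine ⟨c, WCoefDeg_evenCoef hc, hLc, hinr, fun j => ⟨c j (0, ∅), ?_⟩⟩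
  rcases j with j | k
  · ext a
    rw [Finsupp.smul_apply, mono_apply]
    by_cases h0 : a = (0, ∅)
    · subst h0; simp
    · rw [if_neg (Ne.symm h0), smul_zero]
      by_contra h
      have h1 := WCoefDeg_apply hc h
      have h2 : a.1 = 0 := by
        by_contra h2
        exact h (apply_eq_zero_of_dEven (fun i => hc0 i _) h2)
      have h3 : deg a = #a.2 := by
        rw [show deg a = tot a.1 + #a.2 from rfl, h2, tot_zero, zero_add]
      obtain ⟨k, hk⟩ : Even #a.2 := by
        simpa [mu, ZMod.natCast_eq_zero_iff_even] using h1.1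
      refine h0 (Prod.ext h2 (card_eq_zero.1 ?_))
      have := h1.2
      push_cast at this
      omega
  · simp [hinr k]

/-- With u = {k, l} and s outside u, the bracket of x_s x_k and x_i x_s x_l is ± x_i x_k x_l. The
value at x_i x_s x_l is a combination of the ∂_j, j ∈ Y₀, with constant coefficients and so commutes
with the rotation D_H(x_s x_k); thus no prior knowledge of degree three is needed. -/
lemma NegDer.cubic [LargeParams p m n] {r : ℤ} (hr : r ≤ -1)
    {L : O F m n →ₗ[F] Module.End F (O F m n)} (hL : NegDer F p n t r L)
    (hk : KillsBelow p t 3 L) {i : Y0 m} {u : Finset (Fin n)} (hu : #u = 2) :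
    L (mono (Pi.single i 1, u)) = 0 := by
  have hn : 3 < n := LargeParams.three_lt_n p m
  have h3 := fun l => three_le_piTop (p := p) (n := n) (t := t) l
  have hmem : ∀ {α : Y0 m → ℕ} {u : Finset (Fin n)}, (∀ l, α l ≤ 1) → #u = 2 →
      (α, u) ∈ NSet p n t := by
    intro α u hα hu
    refine mem_NSet (fun l => ?_) (by rw [hu]; exact even_two) (i := i) ?_
    · have := h3 l; have := hα l; omega
    · have := h3 i; have := hα i; omega
  have hα1 : ∀ l, (Pi.single i 1 : Y0 m → ℕ) l ≤ 1 := by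
    intro l
    simp only [Pi.single_apply]
    split_ifs <;> omega
  obtain ⟨s, hs⟩ : ∃ s, s ∉ u := by
    by_contra! h
    rw [eq_univ_iff_forall.2 h, card_univ, Fintype.card_fin] at hu
    omega
  obtain ⟨k, l, hkl, rfl⟩ := card_eq_two.1 hu
  simp only [mem_insert, mem_singleton, not_or] at hs
  have hf2 : #({s, k} : Finset (Fin n)) = 2 := card_pair hs.1
  have hg2 : #({s, l} : Finset (Fin n)) = 2 := card_pair hs.2
  have hf : ((0, {s, k}) : Idx m n) ∈ NSet p n t := hmem (by simp) hf2
  have hg : ((Pi.single i 1, {s, l}) : Idx m n) ∈ NSet p n t := hmem hα1 hg2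
  obtain ⟨c, hc, hLc, hinr, hc0⟩ := hL.cubic_coef hr hk hg2 hg
  have key := hL.bracket_left hf hg (hk _ hf (by rw [deg_mk, tot_zero, hf2]; omega))
  have hz : (mono (0, {s, k}) : O F m n) ∈ mspan F (parSet m n 0) :=
    mono_mem (even_parSet (by rw [hf2]; exact even_two))
  have hEz : ∀ i, dEven i (mono (0, {s, k}) : O F m n) = 0 :=
    fun i => dEven_mono_of_eq_zero _ rfl
  rw [hLc, lie_DH_vf hz hc] at key
  have hzero : (fun j => DH (mono (0, {s, k})) (c j) - vf c (DHCoef (mono (0, {s, k})) j))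
      = (0 : Y m n → O F m n) := by
    funext j
    obtain ⟨x, hx⟩ := hc0 j
    have h1 : DH (mono (0, {s, k}) : O F m n) (c j) = 0 := by
      rw [hx, map_smul, DH_even_apply hz]
      simp [hEz, dOdd_mono_empty]
    have h2 : ∀ f : O F m n, (∀ i, dEven i f = 0) → vf c f = 0 := by
      intro f hf
      rw [vf_apply]
      refine sum_eq_zero fun i _ => ?_
      rcases i with i | i
      · rw [show pd (Sum.inl i) f = 0 from hf i, map_zero]
      · rw [hinr i]; simp
    rw [h1, h2, sub_zero, Pi.zero_apply]
    intro i
    rcases j with j | j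
    · rw [DHCoef_inl, hEz]; simp
    · rw [DHCoef_inr hz, dEven_dOdd, hEz, map_zero]
  rw [hzero, map_zero] at key
  obtain ⟨ε, hε, h⟩ := DH_contract (F := F) 0 (Pi.single i 1) (s := s) (u := {k}) (v := {l})
    (by simpa using hs.1) (by simpa using hs.2) (even_of_mem hf) (by simpa using hkl)
  rw [show ({s, k} : Finset (Fin n)) = insert s {k} from rfl,
    show ({s, l} : Finset (Fin n)) = insert s {l} from rfl, h, binom_eq_one (by simp), zero_add,
    ← insert_eq] at key
  exact eq_zero_of_map_smul key (by simpa using hε)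

/-- `L` vanishes in degree `d` if it vanishes in lower degrees and on the special elements. -/
lemma NegDer.killsBelow_succ [Fact p.Prime] [CharP F p] [LargeParams p m n] {r : ℤ} (hr : r ≤ -1)
    {L : O F m n →ₗ[F] Module.End F (O F m n)} (hL : NegDer F p n t r L) {d : ℕ} (hd : 3 ≤ d)
    (hk : KillsBelow p t d L) (hs : KillsSpecial p n t d L) : KillsBelow p t (d + 1) L := by
  intro a ha hda
  rcases (Nat.lt_succ_iff.1 hda).lt_or_eq with h | h
  · exact hk a ha h
  obtain ⟨α, u⟩ := a
  rcases u.eq_empty_or_nonempty with rfl | hu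
  · exact hL.pure hd hk hs ha (by simpa [deg_mk] using h)
  rcases hd.lt_or_eq with hd | rfl
  · exact hL.odd_large hd hk ha h hu
  obtain ⟨e, he⟩ := even_of_mem ha
  have := hu.card_pos
  rw [deg_mk] at h
  simp only at he
  have hu2 : #u = 2 := by omega
  have hα : tot α = 1 := by omega
  obtain ⟨i, hi⟩ : ∃ i, α i ≠ 0 := by
    by_contra! h
    rw [show α = 0 from funext h, tot_zero] at hα
    omega
  obtain ⟨γ, rfl⟩ := exists_add_single hi
  rw [tot_add, tot_single] at hα
  have hγ : γ = 0 := funext fun l => by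
    have := le_tot γ l
    simp only [Pi.zero_apply]; omega
  rw [hγ, zero_add]
  exact hL.cubic hr hk hu2

end OddUniqueness

/-! ### Invariants of the rotations x_k x_l -/

section Invariants
variable {F : Type*} [Field F] {p m n : ℕ} {t : Y0 m → ℕ+}

/-- The element `x^ω` Poisson commutes with all even elements. -/
lemma DH_omega {f : O F m n} (hf : f ∈ mspan F (parSet m n 0)) :
    DH f (mono (0, univ)) = 0 := by
  have hle : mspan F (parSet m n 0) ≤
      LinearMap.ker ((LinearMap.applyₗ (mono (0, univ) : O F m n)) ∘ₗ DH) := by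
    refine Submodule.span_le.2 ?_
    rintro _ ⟨⟨α, u⟩, ha, rfl⟩
    simp only [SetLike.mem_coe, LinearMap.mem_ker, LinearMap.comp_apply, LinearMap.applyₗ_apply_apply]
    rw [DH_even_apply (mono_mem ha), sum_eq_zero, zero_add, sum_eq_zero]
    · intro k _
      by_cases hk : k ∈ u
      · obtain ⟨e, he⟩ := even_of_parSet ha
        simp only at he
        have h1 := card_erase_add_one hk
        -- As |u| is even, u contains some l ≠ k, and x_l divides both ∂_k(x^u) and ∂_k(x^ω), so
        -- their product is zero.
        obtain ⟨l, hl⟩ : (u.erase k).Nonempty := by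
          rw [← card_pos]; omega
        rw [dOdd_mono, if_pos hk, dOdd_mono, if_pos (mem_univ k), map_smul, map_smul,
          LinearMap.smul_apply, mulO_eq_zero_of_mem (s := l)]
        · simp
        · exact mono_mem hl
        · exact mono_mem (mem_erase.2 ⟨ne_of_mem_erase hl, mem_univ l⟩)
      · rw [dOdd_mono_of_notMem hk]; simp
    · intro i _
      rw [dEven_mono_of_eq_zero (i := i.swap) _ rfl]; simp
  exact hle hf

lemma mulO_mono_apply_insert (f : O F m n) (α : Y0 m → ℕ) {l : Fin n} {v : Finset (Fin n)}
    (hl : l ∉ v) : (mulO f (mono (0, {l}))) (α, insert l v) = f (α, v) * ((sgn v {l} : ℤ) : F) := by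
  induction f using mono_induction with
  | h0 => simp
  | hadd f g h1 h2 => simp [h1, h2, add_mul]
  | hsmul c b =>
  obtain ⟨β, w⟩ := b
  rw [map_smul, LinearMap.smul_apply, Finsupp.smul_apply, Finsupp.smul_apply, smul_mul_assoc]
  congr 1
  rw [mulO_mono, Finsupp.smul_apply, mono_apply, mono_apply, binom_eq_one (by simp)]
  by_cases hlw : l ∈ w
  · rw [sgn_of_not_disjoint (by simpa using hlw), if_neg (c := (β, w) = (α, v))]
    · simp
    · rintro h
      rw [Prod.mk.injEq] at h
      exact hl (h.2 ▸ hlw)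
  · have : ((β + 0, w ∪ {l}) = (α, insert l v)) ↔ (β, w) = (α, v) := by
      rw [Prod.mk.injEq, Prod.mk.injEq, add_zero, union_comm, ← insert_eq]
      refine and_congr_right fun _ => ⟨fun h => ?_, fun h => by rw [h]⟩
      rw [← erase_insert hlw, h, erase_insert hl]
    simp only [this]
    split_ifs with h
    · rw [Prod.mk.injEq] at h
      rw [h.2]; simp
    · simp

lemma dOdd_pair_left {k l : Fin n} (hkl : k ≠ l) :
    ∃ ε : F, ε ≠ 0 ∧ dOdd k (mono (0, {k, l}) : O F m n) = ε • mono (0, {l}) := by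
  refine ⟨(-1) ^ #{x ∈ ({l} : Finset (Fin n)) | x < k}, by simp, ?_⟩
  rw [show ({k, l} : Finset (Fin n)) = insert k {l} from rfl, dOdd_mono_insert (by simpa using hkl)]

lemma even_card_pair {k l : Fin n} (hkl : k ≠ l) : Even #({k, l} : Finset (Fin n)) := by
  rw [card_pair hkl]; exact even_two

lemma DH_rotation_apply {k l : Fin n} (hkl : k ≠ l) (f : O F m n) :
    DH (mono (0, {k, l})) f = mulO (dOdd k (mono (0, {k, l}))) (dOdd k f)
      + mulO (dOdd l (mono (0, {k, l}))) (dOdd l f) := by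
  rw [DH_even_apply (mono_mem (even_parSet (even_card_pair hkl))), sum_eq_zero, zero_add,
    ← sum_subset (subset_univ {k, l}), sum_pair hkl]
  · intro x _ hx
    rw [dOdd_mono_of_notMem hx]; simp
  · intro i _
    rw [dEven_mono_of_eq_zero _ rfl]; simp

/-- The action of the rotation `x_l ∂_k - x_k ∂_l` on coefficients. -/
lemma DH_rotation_coeff (α : Y0 m → ℕ) {k l : Fin n} {w : Finset (Fin n)} (hk : k ∈ w)
    (hl : l ∉ w) : ∃ ε : F, ε ≠ 0 ∧ ∀ f : O F m n,
      (DH (mono (0, {k, l})) f) (α, insert l (w.erase k)) = ε * f (α, w) := by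
  have hkl : k ≠ l := fun h => hl (h ▸ hk)
  obtain ⟨ε, hε, h1⟩ := dOdd_pair_left (F := F) (m := m) hkl
  obtain ⟨δ, hδ, h2⟩ := dOdd_pair_left (F := F) (m := m) hkl.symm
  rw [pair_comm] at h2
  obtain ⟨v, hv, rfl⟩ : ∃ v, k ∉ v ∧ w = insert k v :=
    ⟨w.erase k, notMem_erase _ _, (insert_erase hk).symm⟩
  rw [mem_insert, not_or] at hl
  rw [erase_insert hv]
  refine ⟨ε * (-1) ^ #{x ∈ v | x < k} * ((sgn {l} v : ℤ) : F),
    mul_ne_zero (mul_ne_zero hε (by simp)) (sgn_cast_ne_zero (by simpa using hl.2)), fun f => ?_⟩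
  rw [DH_rotation_apply hkl, h1, h2]
  induction f using mono_induction with
  | h0 => simp
  | hadd f g h3 h4 =>
    simp only [map_add, Finsupp.add_apply] at h3 h4 ⊢
    linear_combination h3 + h4
  | hsmul c b =>
  obtain ⟨β, u⟩ := b
  -- The second summand of the rotation multiplies by x_k, which does not occur in the monomial
  -- whose coefficient is taken.
  have hz : (mulO (δ • mono (0, {k})) (dOdd l (mono (β, u))) : O F m n) (α, insert l v) = 0 := by
    refine mspan_coeff (S := {a : Idx m n | k ∈ a.2}) ?_ (by simp [hkl, hv])
    refine mspan_mul (S := {a : Idx m n | k ∈ a.2}) (T := Set.univ) (fun a ha b _ _ _ => ?_)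
      (Submodule.smul_mem _ _ (mono_mem (by simp))) ?_
    · exact mem_union_left _ ha
    · rw [mspan_eq, Finsupp.supported_univ]; trivial
  simp only [map_smul, Finsupp.add_apply, Finsupp.smul_apply] at hz ⊢
  rw [hz, smul_zero, add_zero, smul_eq_mul, smul_eq_mul, mul_left_comm]
  congr 1
  by_cases hku : k ∈ u
  · obtain ⟨w, hw, rfl⟩ : ∃ w, k ∉ w ∧ u = insert k w :=
      ⟨u.erase k, notMem_erase _ _, (insert_erase hku).symm⟩
    rw [dOdd_mono_insert hw, map_smul, LinearMap.smul_apply, mulO_mono,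
      binom_eq_one (by simp)]
    simp only [Finsupp.smul_apply, mono_apply, smul_eq_mul]
    by_cases hlw : l ∈ w
    · rw [sgn_of_not_disjoint (by simpa using hlw), if_neg (c := (β, insert k w) = (α, insert k v))]
      · simp
      · intro h
        rw [Prod.mk.injEq] at h
        have : l ∈ insert k v := h.2 ▸ mem_insert_of_mem hlw
        exact hl.2 ((mem_insert.1 this).resolve_left hkl.symm)
    · have : ((0 + β, {l} ∪ w) = (α, insert l v)) ↔ (β, insert k w) = (α, insert k v) := by
        rw [Prod.mk.injEq, Prod.mk.injEq, zero_add, ← insert_eq]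
        refine and_congr_right fun _ => ⟨fun h => ?_, fun h => ?_⟩
        · rw [← erase_insert hlw, h, erase_insert hl.2]
        · rw [← erase_insert hw, h, erase_insert hv]
      simp only [this]
      split_ifs with h
      · rw [Prod.mk.injEq] at h
        have hwv : w = v := by rw [← erase_insert hw, h.2, erase_insert hv]
        rw [hwv]; simp; ring
      · simp
  · rw [dOdd_mono_of_notMem hku, mono_apply, if_neg]
    · simp
    · intro h
      rw [Prod.mk.injEq] at h
      exact hku (h.2 ▸ mem_insert_self k v)

/-- The `𝔰𝔬(n)`-invariants of the exterior algebra are spanned by `1` and `x^ω`. -/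
lemma invariant_eq {f : O F m n} (h0 : ∀ i, dEven i f = 0)
    (h : ∀ k l, k ≠ l → DH (mono (0, {k, l})) f = 0) :
    f = f (0, ∅) • mono (0, ∅) + f (0, univ) • mono (0, univ) ∨ n = 0 := by
  -- For n = 0 the monomials 1 and x^ω coincide and the formula would count the constant term twice,
  -- hence the alternative in the statement.
  by_cases hn : n = 0
  · exact Or.inr hn
  left
  have hne : (univ : Finset (Fin n)) ≠ ∅ := by
    rw [← nonempty_iff_ne_empty]
    exact ⟨⟨0, Nat.pos_of_ne_zero hn⟩, mem_univ _⟩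
  ext ⟨α, w⟩
  simp only [Finsupp.add_apply, Finsupp.smul_apply, mono_apply, smul_eq_mul, Prod.mk.injEq]
  by_cases hα : 0 = α
  · subst hα
    by_cases h1 : w = ∅
    · subst h1; simp [hne]
    by_cases h2 : w = univ
    · subst h2; simp [hne.symm]
    -- If w is neither empty nor full, the rotation that replaces some k in w by some l outside w
    -- detects the coefficient at x^w.
    obtain ⟨k, hk⟩ := nonempty_iff_ne_empty.2 h1
    obtain ⟨l, hl⟩ : ∃ l, l ∉ w := by
      by_contra! h
      exact h2 (eq_univ_iff_forall.2 h)
    obtain ⟨ε, hε, hc⟩ := DH_rotation_coeff (F := F) (0 : Y0 m → ℕ) hk hl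
    have h3 := hc f
    rw [h k l fun h => hl (h ▸ hk), Finsupp.zero_apply, eq_comm, mul_eq_zero] at h3
    simp [h3.resolve_left hε, Ne.symm h1, Ne.symm h2]
  · rw [apply_eq_zero_of_dEven h0 (Ne.symm hα)]
    simp [hα]

lemma lie_rotation {c : Y m n → O F m n} (hc : EvenCoef c) {k l : Fin n} (hkl : k ≠ l)
    (h : ⁅(DH (mono (0, {k, l})) : Module.End F (O F m n)), vf c⁆ = 0) (j : Y m n) :
    DH (mono (0, {k, l})) (c j) = vf c (DHCoef (mono (0, {k, l})) j) := by
  rw [lie_DH_vf (mono_mem (even_parSet (even_card_pair hkl)))  hc] at h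
  have := congrFun (vf_injective (h.trans (map_zero vf).symm)) j
  exact sub_eq_zero.1 this

lemma vf_mono_odd (c : Y m n → O F m n) (l : Fin n) : vf c (mono (0, {l})) = c (Sum.inr l) :=
  vf_var c (Sum.inr l)

/-- The rotation moves the field ∂_k to ±∂_l, so invariance ties the odd components together: one of
them determines all others. -/
lemma rotation_coef {c : Y m n → O F m n} (hc : EvenCoef c)
    (h : ∀ k l, k ≠ l → ⁅(DH (mono (0, {k, l})) : Module.End F (O F m n)), vf c⁆ = 0)
    {k l : Fin n} (hkl : k ≠ l) : ∃ ε : F, ε ≠ 0 ∧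
      DH (mono (0, {k, l})) (c (Sum.inr k)) = ε • c (Sum.inr l) := by
  obtain ⟨ε, hε, h1⟩ := dOdd_pair_left (F := F) (m := m) hkl
  refine ⟨ε, hε, ?_⟩
  rw [lie_rotation hc hkl (h k l hkl),
    DHCoef_inr (mono_mem (even_parSet (even_card_pair hkl))), h1, map_smul, vf_mono_odd]

lemma eq_zero_of_invariant {c : Y m n → O F m n} (hc : EvenCoef c)
    (hinl : ∀ i, c (Sum.inl i) = 0)
    (h : ∀ k l, k ≠ l → ⁅(DH (mono (0, {k, l})) : Module.End F (O F m n)), vf c⁆ = 0)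
    {k : Fin n} (hk : c (Sum.inr k) = 0) : c = 0 := by
  funext j
  rcases j with i | l
  · exact hinl i
  · by_cases hkl : k = l
    · rw [← hkl]; exact hk
    obtain ⟨ε, hε, h1⟩ := rotation_coef hc h hkl
    rw [hk, map_zero, eq_comm, smul_eq_zero] at h1
    exact h1.resolve_left hε

lemma evenCoef_apply {c : Y m n → O F m n} (hc : EvenCoef c) {j : Y m n} {a : Idx m n}
    (h : c j a ≠ 0) : (#a.2 : ZMod 2) = mu j := by
  by_contra hh
  exact h (mspan_coeff (hc j) hh)

/-- Let a_k be the coefficient of x_k in c_k. The coefficient of x_k x_l in the image of x_k x_l is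
a_k + a_l, so a_k = -a_l for all k ≠ l; three distinct indices give 2 a_k = 0. This excludes
multiples of the Euler field ∑ x_k ∂_k. -/
lemma invariant_coef_singleton [Fact p.Prime] [CharP F p] [LargeParams p m n]
    {c : Y m n → O F m n} (hc : EvenCoef c)
    (h : ∀ k l : Fin n, k ≠ l → vf c (mono (0, {k, l})) = 0) (k : Fin n) :
    c (Sum.inr k) (0, {k}) = 0 := by
  have hneg : ∀ k l : Fin n, k ≠ l → c (Sum.inr k) (0, {k}) = - c (Sum.inr l) (0, {l}) := by
    intro k l hkl
    have h1 : mono (0, {k, l}) = ((sgn {k} {l} : ℤ) : F)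
        • mulO (mono (0, {k})) (mono (0, {l}) : O F m n) := by
      rw [mulO_mono, binom_eq_one (by simp), smul_smul, add_zero, ← insert_eq]
      have : (((sgn {k} {l} : ℤ) : F) * (((1 : ℕ) : F) * ((sgn {k} {l} : ℤ) : F))) = 1 := by
        have hd : Disjoint ({k} : Finset (Fin n)) {l} := by simpa using hkl
        rw [Nat.cast_one, one_mul]
        simp only [sgn, if_pos hd, Int.cast_pow, Int.cast_neg, Int.cast_one]
        exact neg_one_sq_pow _
      rw [this, one_smul]
    have h2 := h k l hkl
    rw [h1, map_smul, smul_eq_zero] at h2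
    have h3 := h2.resolve_left (sgn_cast_ne_zero (by simpa using hkl))
    rw [vf_mul hc, vf_mono_odd, vf_mono_odd, mulO_odd_comm (mono_mem (by simp [parSet])),
      par_odd (hc (Sum.inr l)), map_neg, LinearMap.neg_apply, ← sub_eq_add_neg, sub_eq_zero] at h3
    have h4 := mulO_mono_apply_insert (c (Sum.inr k)) (0 : Y0 m → ℕ) (l := l) (v := {k})
      (by simpa using hkl.symm)
    have h5 := mulO_mono_apply_insert (c (Sum.inr l)) (0 : Y0 m → ℕ) (l := k) (v := {l})
      (by simpa using hkl)
    rw [← h3, show ({k, l} : Finset (Fin n)) = {l, k} from pair_comm k l, h4, sgn_comm {l} {k}] at h5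
    simp only [card_singleton, mul_one, pow_one, Int.cast_mul, Int.cast_neg, Int.cast_one] at h5
    refine mul_right_cancel₀ (sgn_cast_ne_zero (F := F) (u := {k}) (v := {l})
      (by simpa using hkl)) ?_
    rw [h5]; ring
  have hn : 3 < n := LargeParams.three_lt_n p m
  obtain ⟨l, hl⟩ : ∃ l, l ∉ ({k} : Finset (Fin n)) := by
    by_contra! h
    have := card_univ (α := Fin n)
    rw [← eq_univ_iff_forall.2 h, card_singleton, Fintype.card_fin] at this
    omega
  obtain ⟨s, hs⟩ : ∃ s, s ∉ ({k, l} : Finset (Fin n)) := by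
    by_contra! h
    have := card_univ (α := Fin n)
    have h2 := card_le_two (a := k) (b := l)
    rw [eq_univ_iff_forall.2 h, card_univ, Fintype.card_fin] at h2
    omega
  simp only [mem_singleton, mem_insert, not_or] at hl hs
  have h1 := hneg k l (Ne.symm hl)
  have h2 := hneg l s (Ne.symm hs.2)
  have h3 := hneg s k hs.1
  have h4 : (2 : F) * c (Sum.inr k) (0, {k}) = 0 := by linear_combination h1 - h2 + h3
  exact (mul_eq_zero.1 h4).resolve_left (two_ne_zero_of_large (p := p) (m := m) (n := n))

/-- Even vector fields in the odd variables that are invariant under `𝔰𝔬(n)` and annihilate the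
quadratic elements are multiples of `D_H(x^ω)`. -/
lemma invariant_field [Fact p.Prime] [CharP F p] [LargeParams p m n]
    {c : Y m n → O F m n} (hc : EvenCoef c) (hinl : ∀ i, c (Sum.inl i) = 0)
    (hc0 : ∀ i j, dEven i (c j) = 0)
    (h : ∀ k l, k ≠ l → ⁅(DH (mono (0, {k, l})) : Module.End F (O F m n)), vf c⁆ = 0)
    (h2 : ∀ k l : Fin n, k ≠ l → vf c (mono (0, {k, l})) = 0) :
    c = 0 ∨ Even n ∧ ∃ b : F, c = b • DHCoef (mono (0, univ)) := by
  have hn : 3 < n := LargeParams.three_lt_n p m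
  -- A rotation in two variables x, y different from k does not involve x_k, so it annihilates c_k.
  -- If w contains such an x and misses such a y, the coefficient at x^w vanishes. Of the remaining
  -- sets, the empty one is excluded by parity and {k} by `invariant_coef_singleton`.
  have hsupp : ∀ k w, c (Sum.inr k) (0, w) ≠ 0 → w = univ.erase k ∨ w = univ := by
    intro k w hw
    by_contra! hcon
    have hpar := evenCoef_apply hc hw
    by_cases hw0 : w.erase k = ∅
    · have : w = ∅ ∨ w = {k} := by
        rw [erase_eq_empty_iff] at hw0; exact hw0
      rcases this with rfl | rfl
      · simp [mu] at hpar
      · exact hw (invariant_coef_singleton (p := p) hc h2 k)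
    obtain ⟨x, hx⟩ := nonempty_iff_ne_empty.2 hw0
    obtain ⟨y, hyk, hyw⟩ : ∃ y, y ≠ k ∧ y ∉ w := by
      by_contra! hall
      by_cases hk : k ∈ w
      · exact hcon.2 (eq_univ_iff_forall.2 fun y => by
          by_cases hy : y = k
          · rwa [hy]
          · exact hall y hy)
      · refine hcon.1 ?_
        ext y
        simp only [mem_erase, mem_univ, and_true]
        exact ⟨fun hy => by rintro rfl; exact hk hy, hall y⟩
    have hxw := mem_of_mem_erase hx
    have hxk := ne_of_mem_erase hx
    have hxy : x ≠ y := fun h => hyw (h ▸ hxw)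
    obtain ⟨ε, hε, hcf⟩ := DH_rotation_coeff (F := F) (0 : Y0 m → ℕ) hxw hyw
    have h3 := hcf (c (Sum.inr k))
    rw [lie_rotation hc hxy (h x y hxy),
      DHCoef_inr (mono_mem (even_parSet (even_card_pair hxy))),
      dOdd_mono_of_notMem (by simp [Ne.symm hxk, Ne.symm hyk]), map_zero, Finsupp.zero_apply,
      eq_comm, mul_eq_zero] at h3
    exact hw (h3.resolve_left hε)
  have hform : ∀ k w, (∀ w', c (Sum.inr k) (0, w') ≠ 0 → w' = w) →
      c (Sum.inr k) = c (Sum.inr k) (0, w) • mono (0, w) := by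
    intro k w hw
    ext ⟨α, w'⟩
    rw [Finsupp.smul_apply, mono_apply]
    by_cases h0 : (0, w) = (α, w')
    · rw [← h0]; simp
    · rw [if_neg h0, smul_zero]
      by_contra hne
      have h1 : α = 0 := by
        by_contra h2
        exact hne (apply_eq_zero_of_dEven (fun i => hc0 i _) h2)
      subst h1
      exact h0 (by rw [hw w' hne])
  let k : Fin n := ⟨0, by omega⟩
  have hz : ∀ k l : Fin n, k ≠ l → (mono (0, {k, l}) : O F m n) ∈ mspan F (parSet m n 0) :=
    fun k l hkl => mono_mem (even_parSet (even_card_pair hkl))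
  by_cases hne : Even n
  · have hω : (mono (0, univ) : O F m n) ∈ mspan F (parSet m n 0) :=
      mono_mem (even_parSet (by simpa using hne))
    refine Or.inr ⟨hne, ?_⟩
    have h3 : ∀ w', c (Sum.inr k) (0, w') ≠ 0 → w' = univ.erase k := by
      intro w' hw'
      refine (hsupp k w' hw').resolve_right ?_
      rintro rfl
      have := evenCoef_apply hc hw'
      rw [card_univ, Fintype.card_fin, (ZMod.natCast_eq_zero_iff_even).2 hne] at this
      simp [mu] at this
    have h4 := hform k _ h3
    have h5 : DHCoef (mono (0, univ) : O F m n) (Sum.inr k)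
        = (-1 : F) ^ #{l ∈ univ | l < k} • mono (0, univ.erase k) := by
      rw [DHCoef_inr hω, dOdd_mono, if_pos (mem_univ k)]
    obtain ⟨b, hb⟩ : ∃ b : F, c (Sum.inr k) = b • DHCoef (mono (0, univ)) (Sum.inr k) := by
      refine ⟨c (Sum.inr k) (0, univ.erase k) * (-1 : F) ^ #{l ∈ univ | l < k}, ?_⟩
      rw [h5, smul_smul, mul_assoc, neg_one_sq_pow, mul_one]
      exact h4
    refine ⟨b, ?_⟩
    have hDE := evenCoef_DHCoef hω
    have hsub : EvenCoef (c - b • DHCoef (mono (0, univ))) :=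
      fun j => sub_mem (hc j) (Submodule.smul_mem _ _ (hDE j))
    -- D_H(x^ω) is itself invariant, so the difference is an invariant field with vanishing k-th
    -- component, hence zero.
    refine sub_eq_zero.1 (eq_zero_of_invariant hsub ?_ ?_ (k := k) ?_)
    · intro i
      rw [Pi.sub_apply, Pi.smul_apply, hinl, DHCoef_inl, dEven_mono_of_eq_zero _ rfl]
      simp
    · intro x y hxy
      have h6 : ⁅(DH (mono (0, {x, y})) : Module.End F (O F m n)), 
          vf (DHCoef (mono (0, univ) : O F m n))⁆ = 0 := by
        rw [← DH_eq_vf, lie_DH (hz x y hxy) hω (by rw [DH_omega (hz x y hxy)]; exact zero_mem _),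
          DH_omega (hz x y hxy), map_zero]
      rw [lie_DH_vf (hz x y hxy) hsub]
      refine Eq.trans ?_ (map_zero vf)
      congr 1
      funext j
      have e1 := lie_rotation hc hxy (h x y hxy) j
      have e2 := lie_rotation hDE hxy h6 j
      simp only [Pi.sub_apply, Pi.smul_apply, map_sub, map_smul, LinearMap.sub_apply,
        LinearMap.smul_apply, e1, e2, Pi.zero_apply, sub_self]
    · rw [Pi.sub_apply, Pi.smul_apply, hb, sub_self]
  · left
    have h3 : ∀ k, c (Sum.inr k) = c (Sum.inr k) (0, univ) • mono (0, univ) := by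
      intro k
      refine hform k _ fun w' hw' => (hsupp k w' hw').resolve_left ?_
      rintro rfl
      have := evenCoef_apply hc hw'
      rw [card_erase_of_mem (mem_univ k), card_univ, Fintype.card_fin,
        (ZMod.natCast_eq_zero_iff_even).2] at this
      · simp [mu] at this
      · exact Nat.Odd.sub_odd (Nat.not_even_iff_odd.1 hne) odd_one
    let l : Fin n := ⟨1, by omega⟩
    -- For odd n, all c_k are multiples of x^ω. A rotation kills x^ω but carries c_l to a nonzero
    -- multiple of c_k, so c_k = 0.
    have hlk : l ≠ k := by simp [l, k]
    obtain ⟨ε, hε, h4⟩ := rotation_coef hc h hlk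
    rw [h3 l, map_smul, DH_omega (hz l k hlk), smul_zero, eq_comm, smul_eq_zero] at h4
    exact eq_zero_of_invariant hc hinl h (h4.resolve_left hε)

end Invariants

/-! ### Possible values at x_j^(q) and x_i x_j^(q) -/

section Special
variable {F : Type*} [Field F] {p m n : ℕ} {t : Y0 m → ℕ+}

/-- L kills x_k x_l, which has degree two and Poisson commutes with every monomial in the even
variables. Thus the values at such monomials are invariant under the rotations. -/
lemma NegDer.lie_rotation_pure [LargeParams p m n] {r : ℤ}
    {L : O F m n →ₗ[F] Module.End F (O F m n)} (hL : NegDer F p n t r L) {d : ℕ} (hd : 3 ≤ d)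
    (hk : KillsBelow p t d L) {α : Y0 m → ℕ} (ha : ((α, ∅) : Idx m n) ∈ NSet p n t)
    {k l : Fin n} (hkl : k ≠ l) :
    ⁅(DH (mono (0, {k, l})) : Module.End F (O F m n)), L (mono (α, ∅))⁆ = 0 := by
  have hm : 1 < m := LargeParams.one_lt_m p n
  have h3 := fun l => three_le_piTop (p := p) (n := n) (t := t) l
  have hz : ((0, {k, l}) : Idx m n) ∈ NSet p n t :=
    mem_NSet (fun l => by simp) (even_card_pair hkl) (i := Sum.inl ⟨0, by omega⟩)
      (by have := h3 (Sum.inl ⟨0, by omega⟩); simp only [Pi.zero_apply]; omega)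
  rw [← hL.bracket_left hz ha (hk _ hz (by rw [deg_mk, tot_zero, card_pair hkl]; omega)),
    DH_rotation_apply hkl, dOdd_mono_empty, dOdd_mono_empty]
  simp

lemma large_pow [Fact p.Prime] [h : LargeParams p m n] {s : ℕ} (hs : 1 ≤ s) : 4 ≤ p ^ s := by
  have h1 := h.three_lt_p
  calc 4 ≤ p ^ 1 := by rw [pow_one]; omega
    _ ≤ p ^ s := Nat.pow_le_pow_right (by omega) hs

lemma pow_cast_eq_zero [Fact p.Prime] [CharP F p] {s : ℕ} (hs : 1 ≤ s) :
    ((p ^ s : ℕ) : F) = 0 := by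
  rw [Nat.cast_pow, CharP.cast_eq_zero, zero_pow (by omega)]

/-- The value of `L` at `x_j^(q)` annihilates the quadratic elements of the exterior algebra. -/
lemma NegDer.power_annihilates [Fact p.Prime] [CharP F p] [LargeParams p m n] {r : ℤ}
    {L : O F m n →ₗ[F] Module.End F (O F m n)} (hL : NegDer F p n t r L) {s : ℕ} (hs : 1 ≤ s)
    (hk : KillsBelow p t (p ^ s) L) {j : Y0 m} (hj : p ^ s ≤ piTop p t j)
    {c : Y m n → O F m n} (hc : EvenCoef c) (hLc : L (mono (Pi.single j (p ^ s), ∅)) = vf c)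
    (hinl : ∀ i, c (Sum.inl i) = 0) {k l : Fin n} (hkl : k ≠ l) :
    vf c (mono (0, {k, l})) = 0 := by
  obtain ⟨b, hb, hb'⟩ := exists_not_mem_pair (p := p) (n := n) j
  have hjj := swap_ne j
  have hbb := swap_ne b
  have h1 : b.swap ≠ j := swap_ne_of hb'
  have h3 := fun l => three_le_piTop (p := p) (n := n) (t := t) l
  have h4 : 4 ≤ p ^ s := large_pow (p := p) (m := m) (n := n) hs
  have h0 : ((p ^ s : ℕ) : F) = 0 := pow_cast_eq_zero hs
  have he := even_card_pair hkl
  obtain ⟨q, hq⟩ : ∃ q, p ^ s = q + 1 := ⟨p ^ s - 1, by omega⟩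
  rw [hq] at hLc hk hj h4 h0
  have hcub : ∀ i, ((Pi.single i 1, {k, l}) : Idx m n) ∈ NSet p n t := by
    intro i
    refine mem_NSet (fun l => ?_) he (i := i) ?_
    · have := h3 l
      simp only [Pi.single_apply]
      grind
    · have := h3 i
      simp; omega
  have hLcub : ∀ i, L (mono (Pi.single i 1, {k, l})) = 0 := fun i =>
    hk _ (hcub i) (by rw [deg_mk, tot_single, card_pair hkl]; omega)
  have hg : ((Pi.single j (q + 1), ∅) : Idx m n) ∈ NSet p n t := by
    refine mem_NSet (fun l => ?_) (by simp) (i := j.swap) ?_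
    · simp only [Pi.single_apply]
      grind
    · have := h3 j.swap
      simp [hjj]; omega
  have hg' : ((Pi.single j q + Pi.single b.swap 1, ∅) : Idx m n) ∈ NSet p n t := by
    refine mem_NSet (fun l => ?_) (by simp) (i := j.swap) ?_
    · have := h3 l
      simp only [Pi.add_apply, Pi.single_apply]
      grind
    · have := h3 j.swap
      simp only [Pi.add_apply, Pi.single_apply]
      grind
  -- From here on q stands for p^s - 1, so q = -1 in F. The monomial has degree p^s, outside the
  -- reach of the hypothesis, but both pairs have weight -1.
  have hLg' : L (mono (Pi.single j q + Pi.single b.swap 1, ∅)) = 0 := by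
    refine hL.weight_pair (i := j) (k := b) (by omega) hk hg' ?_ hb hb' ?_ ?_
    · simp only [deg_mk, tot_add, tot_single, card_empty]
    · have : (q : F) = -1 := by
        push_cast at h0
        linear_combination h0
      have e2 : j.swap ≠ b.swap := swap_ne_swap hb.symm
      simp [hjj, h1.symm, e2, this]
    · simp [hb, hbb.symm, h1]
  -- This bracket is ± x_j^(q) x_k x_l, of degree p^s + 1, which is therefore killed as well.
  have key1 := hL.bracket_zero (hcub b) hg' (hLcub b) hLg'
  rw [DH_single_odd _ _ he (by simp), union_empty] at key1
  have key2 : L (mono (Pi.single j q, {k, l})) = 0 :=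
    eq_zero_of_map_smul key1 (mul_ne_zero (tau_cast_ne_zero _) (sgn_cast_ne_zero (by simp)))
  -- The same monomial is ± the bracket of x_{j'} x_k x_l and x_j^(p^s). Hence D_H(x_{j'} x_k x_l)
  -- commutes with the value there; as that field has ∂_j-component ± x_k x_l, the ∂_j-component of
  -- the commutator gives the claim.
  have key3 := hL.bracket_left (hcub j.swap) hg (hLcub j.swap)
  have h5 := DH_single_odd (F := F) j.swap (Pi.single j q) (u := {k, l}) (v := ∅) he (by simp)
  rw [Sum.swap_swap, ← Pi.single_add, union_empty] at h5
  rw [h5, map_smul, key2, smul_zero, hLc, lie_DH_vf (mono_mem (even_parSet he)) hc] at key3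
  have key4 := congrFun (vf_injective (key3.symm.trans (map_zero vf).symm)) (Sum.inl j)
  have h6 := dEven_mono_add (F := F) j.swap 0 ({k, l} : Finset (Fin n))
  rw [zero_add] at h6
  simp only [Pi.zero_apply] at key4
  rw [hinl, map_zero, zero_sub, neg_eq_zero, DHCoef_inl, h6, map_zsmul,
    ← Int.cast_smul_eq_zsmul F, smul_eq_zero] at key4
  refine key4.resolve_left ?_
  rw [Int.cast_neg, neg_eq_zero]
  exact tau_cast_ne_zero _

/-- All exponents are zero in F, so all weights vanish and no even ∂_i can occur. What remains is a
rotation invariant field in the odd directions that annihilates quadratic elements, and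
`invariant_field` applies. The degree of D_H(x^ω) is n - 2, that of the argument p^s - 2, which
determines r. -/
lemma NegDer.power_value [Fact p.Prime] [CharP F p] [LargeParams p m n] {r : ℤ}
    {L : O F m n →ₗ[F] Module.End F (O F m n)} (hL : NegDer F p n t r L) {s : ℕ} (hs : 1 ≤ s)
    (hk : KillsBelow p t (p ^ s) L) {j : Y0 m} (hj : p ^ s ≤ piTop p t j) :
    L (mono (Pi.single j (p ^ s), ∅)) = 0 ∨ ((n : ℤ) - (p ^ s : ℕ) = r ∧ Even n ∧
      ∃ b : F, L (mono (Pi.single j (p ^ s), ∅)) = b • DH (mono (0, univ))) := by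
  have hjj := swap_ne j
  have hn : 3 < n := LargeParams.three_lt_n p m
  have h3 := fun l => three_le_piTop (p := p) (n := n) (t := t) l
  have h4 : 4 ≤ p ^ s := large_pow (p := p) (m := m) (n := n) hs
  have h0 : ((p ^ s : ℕ) : F) = 0 := pow_cast_eq_zero hs
  have hg : ((Pi.single j (p ^ s), ∅) : Idx m n) ∈ NSet p n t := by
    refine mem_NSet (fun l => ?_) (by simp) (i := j.swap) ?_
    · simp only [Pi.single_apply]
      grind
    · have := h3 j.swap
      simp [hjj]; omega
  obtain ⟨c, hcd, hLc, hc0⟩ := hL.dEven_comm (by omega) hk hg (by simp [deg_mk, tot_single])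
  have hc := WCoefDeg_evenCoef hcd
  have hinl : ∀ i, c (Sum.inl i) = 0 := by
    intro i
    by_contra h
    have h1 := hL.weight (by omega) hk hg hc hLc hc0 h i
    have h2 : ∀ l, (((Pi.single j (p ^ s) : Y0 m → ℕ) l : ℕ) : F) = 0 := by
      intro l
      by_cases hl : l = j
      · subst hl; rw [Pi.single_eq_same, h0]
      · rw [Pi.single_eq_of_ne hl, Nat.cast_zero]
    rw [h2, h2] at h1
    simp [wt, (swap_ne i).symm] at h1
  rcases invariant_field (p := p) hc hinl hc0
    (fun k l hkl => by rw [← hLc]; exact hL.lie_rotation_pure (by omega) hk hg hkl)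
    (fun k l hkl => hL.power_annihilates hs hk hj hc hLc hinl hkl) with h | ⟨hne, b, hb⟩
  · left; rw [hLc, h, map_zero]
  · by_cases hb0 : b = 0
    · left; rw [hLc, hb, hb0, zero_smul, map_zero]
    · refine Or.inr ⟨?_, hne, b, by rw [hLc, hb, map_smul, DH_eq_vf]⟩
      let k : Fin n := ⟨0, by omega⟩
      have h5 : c (Sum.inr k) (0, univ.erase k) ≠ 0 := by
        rw [hb, Pi.smul_apply, DHCoef_inr (mono_mem (even_parSet (by simpa using hne))), dOdd_mono,
          if_pos (mem_univ k), Finsupp.smul_apply, Finsupp.smul_apply, mono_apply, if_pos rfl]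
        simp [hb0]
      have h6 := (WCoefDeg_apply hcd h5).2
      rw [deg_mk, tot_zero, card_erase_of_mem (mem_univ k), card_univ, Fintype.card_fin] at h6
      push_cast [show 1 ≤ n by omega] at h6 ⊢
      omega

/-- In F only the exponent of x_i is nonzero, so the weights leave only the component of ∂_{i'},
which is the direction of D_H(x_i). Its coefficient is a rotation invariant of the exterior algebra,
hence a combination of 1 and x^ω; the two terms have different degrees, and each fixes r. -/
lemma NegDer.mul_power_value [Fact p.Prime] [CharP F p] [LargeParams p m n] {r : ℤ}
    {L : O F m n →ₗ[F] Module.End F (O F m n)} (hL : NegDer F p n t r L) {s : ℕ} (hs : 1 ≤ s)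
    (hk : KillsBelow p t (p ^ s + 1) L) {i j : Y0 m} (hij : j ≠ i) (hij' : j ≠ i.swap)
    (hj : p ^ s ≤ piTop p t j) : ∃ a b : F,
      L (mono (Pi.single i 1 + Pi.single j (p ^ s), ∅)) = a • DH (mono (Pi.single i 1, ∅))
        + b • (mulO (mono (0, univ)) * DH (mono (Pi.single i 1, ∅)))
      ∧ (a ≠ 0 → r = -(p ^ s : ℕ)) ∧ (b ≠ 0 → Even n ∧ r = (n : ℤ) - (p ^ s : ℕ)) := by
  have hii := swap_ne i
  have hjj := swap_ne j
  have h1 : j.swap ≠ i := swap_ne_of hij'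
  have hn : 3 < n := LargeParams.three_lt_n p m
  have h3 := fun l => three_le_piTop (p := p) (n := n) (t := t) l
  have h4 : 4 ≤ p ^ s := large_pow (p := p) (m := m) (n := n) hs
  have h0 : ((p ^ s : ℕ) : F) = 0 := pow_cast_eq_zero hs
  have hg : ((Pi.single i 1 + Pi.single j (p ^ s), ∅) : Idx m n) ∈ NSet p n t := by
    refine mem_NSet (fun l => ?_) (by simp) (i := i) ?_
    · have := h3 l
      simp only [Pi.add_apply, Pi.single_apply]
      grind
    · have := h3 i
      simp [hij.symm]; omega
  obtain ⟨c, hcd, hLc, hc0⟩ := hL.dEven_comm (by omega) hk hg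
    (by simp [deg_mk, tot_add, tot_single, add_comm])
  have hc := WCoefDeg_evenCoef hcd
  have hcast : ∀ l, (((Pi.single i 1 + Pi.single j (p ^ s) : Y0 m → ℕ) l : ℕ) : F)
      = if l = i then 1 else 0 := by
    intro l
    rw [Pi.add_apply, Nat.cast_add]
    by_cases hl : l = j
    · subst hl; rw [Pi.single_eq_same, h0]; simp [hij]
    · rw [Pi.single_eq_of_ne hl, Pi.single_apply]; simp
  have hw : ∀ {y}, c y ≠ 0 → ∀ l : Y0 m, ((if l = i then 1 else 0 : F)
      - if l.swap = i then 1 else 0) = wt l y := by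
    intro y hy l
    rw [← hcast, ← hcast]
    exact hL.weight (by omega) hk hg hc hLc hc0 hy l
  have h2 : (2 : F) ≠ 0 := two_ne_zero_of_large (p := p) (m := m) (n := n)
  -- The weight on the pair of i must be 1. It is 1 for ∂_{i'}, -1 for ∂_i and 0 otherwise, and -1 ≠
  -- 1 in F.
  have hz : ∀ y, y ≠ Sum.inl i.swap → c y = 0 := by
    intro y hy
    by_contra h
    have hwi := hw h i
    rw [if_pos rfl, if_neg hii] at hwi
    rcases y with l | k
    · have hl : l ≠ i.swap := fun h => hy (by rw [h])
      simp only [wt, Sum.elim_inl, if_neg hl] at hwi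
      split_ifs at hwi with h5
      · refine h2 ?_
        push_cast at hwi
        linear_combination hwi
      · simp at hwi
    · simp [wt] at hwi
  have hinv := invariant_eq (hc0 · (Sum.inl i.swap)) (fun k l hkl => by
    have h6 := hL.lie_rotation_pure (by omega) hk hg hkl
    rw [hLc] at h6
    rw [lie_rotation hc hkl h6, DHCoef_inl, dEven_mono_of_eq_zero _ rfl]
    simp)
  replace hinv := hinv.resolve_right (by omega)
  have hvf : vf c = mulO (c (Sum.inl i.swap)) * dEven i.swap := by
    refine LinearMap.ext fun f => ?_
    rw [vf_apply, sum_eq_single (Sum.inl i.swap)]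
    · rfl
    · intro y _ hy; rw [hz y hy]; simp
    · simp
  have hone : mulO (mono (0, ∅)) = (1 : Module.End F (O F m n)) := by
    refine LinearMap.ext fun f => ?_
    rw [mulO_even_comm (mono_mem (by simp [parSet])), mulO_one]
    rfl
  refine ⟨((tau (Sum.inl i : Y m n) : ℤ) : F) * c (Sum.inl i.swap) (0, ∅),
    ((tau (Sum.inl i : Y m n) : ℤ) : F) * c (Sum.inl i.swap) (0, univ), ?_, ?_, ?_⟩
  · have htau : ((tau (Sum.inl i : Y m n) : ℤ) : F) * ((tau (Sum.inl i : Y m n) : ℤ) : F) = 1 := by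
      rw [← Int.cast_mul, tau_mul_self, Int.cast_one]
    rw [hLc, hvf, DH_mono_single, mul_smul_comm, smul_smul, smul_smul, mul_right_comm, htau,
      mul_right_comm, htau, one_mul, one_mul]
    conv_lhs => rw [hinv]
    rw [map_add, map_smul, map_smul, add_mul, smul_mul_assoc, smul_mul_assoc, hone, one_mul]
  · intro h
    have h6 := (WCoefDeg_apply hcd (right_ne_zero_of_mul h)).2
    rw [deg_mk, tot_zero, card_empty] at h6
    push_cast at h6 ⊢
    omega
  · intro h
    have h6 := WCoefDeg_apply hcd (right_ne_zero_of_mul h)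
    have h7 := h6.2
    have h8 := h6.1
    rw [card_univ, Fintype.card_fin] at h8
    refine ⟨by simpa [mu, ZMod.natCast_eq_zero_iff_even] using h8, ?_⟩
    rw [deg_mk, tot_zero, card_univ, Fintype.card_fin] at h7
    push_cast at h7 ⊢
    omega

end Special

/-! ### Compatibility with the grading, and passage from D to f ↦ D(D_H(f)) -/

section Grading
variable {F : Type*} [Field F] {p m n : ℕ} {t : Y0 m → ℕ+}

lemma mulO_mem_deg [Fact p.Prime] [CharP F p] {θ η : ZMod 2} {d e : ℤ} {f g : O F m n}
    (hf : f ∈ mspan F (truncSet p t n ∩ parSet m n θ ∩ degSet m n d))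
    (hg : g ∈ mspan F (truncSet p t n ∩ parSet m n η ∩ degSet m n e)) :
    mulO f g ∈ mspan F (truncSet p t n ∩ parSet m n (θ + η) ∩ degSet m n (d + e)) := by
  refine mspan_mul (R := truncSet p t n ∩ parSet m n (θ + η) ∩ degSet m n (d + e))
    (fun a ha b hb h1 h2 => ⟨⟨truncSet_mul (F := F) ha.1.1 hb.1.1 h1,
      parSet_mul ha.1.2 hb.1.2 h2⟩, ?_⟩) hf hg
  have h3 := ha.2
  have h4 := hb.2
  simp only [degSet, Set.mem_ofPred_eq] at h3 h4 ⊢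
  rw [card_union_of_disjoint h2, ← h3, ← h4]
  simp only [Pi.add_apply, sum_add_distrib]
  push_cast
  ring

lemma pd_mem_deg {θ : ZMod 2} {d : ℤ} {f : O F m n} (i : Y m n)
    (hf : f ∈ mspan F (truncSet p t n ∩ parSet m n θ ∩ degSet m n d)) :
    pd i f ∈ mspan F (truncSet p t n ∩ parSet m n (mu i + θ) ∩ degSet m n (d - 1)) := by
  have h1 := pd_mem i (mspan_mono Set.inter_subset_left hf)
  have h2 : pd i f ∈ mspan F (degSet m n (d - 1)) := by
    rcases i with i | k
    · refine mspan_dEven (R := degSet m n (d - 1)) i (fun a ha h0 => ?_) hf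
      obtain ⟨γ, hγ⟩ := exists_add_single h0
      have h3 := ha.2
      simp only [degSet, Set.mem_ofPred_eq] at h3 ⊢
      have h4 : Function.update a.1 i (a.1 i - 1) = γ := by
        rw [hγ]
        funext l
        by_cases hl : l = i
        · subst hl; simp
        · simp [hl]
      rw [h4, ← h3, hγ]
      simp only [Pi.add_apply, sum_add_distrib]
      have := tot_single i 1
      unfold tot at this
      rw [this]
      push_cast
      ring
    · refine mspan_dOdd (R := degSet m n (d - 1)) k (fun a ha h0 => ?_) hf
      have h3 := ha.2
      simp only [degSet, Set.mem_ofPred_eq] at h3 ⊢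
      rw [← h3, ← card_erase_add_one h0]
      push_cast
      ring
  rw [mspan_eq] at h1 h2 ⊢
  rw [Finsupp.supported_inter]
  exact ⟨h1, h2⟩

lemma DHCoef_mem_WCoefDeg {d : ℤ} {f : O F m n}
    (hf : f ∈ mspan F (truncSet p t n ∩ parSet m n 0 ∩ degSet m n d)) :
    DHCoef f ∈ WCoefDeg F p n t (d - 2) := by
  intro j _
  have h := pd_mem_deg (prm j) hf
  rw [add_zero, mu_prm, show d - 1 = d - 2 + 1 by ring] at h
  simp only [DHCoef]
  rw [sg_even (mspan_mono (fun a ha => ha.1.2) hf)]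
  exact zsmul_mem h _

lemma mono_mem_deg {a : Idx m n} (ha : a ∈ evenSet p n t) :
    (mono a : O F m n) ∈ mspan F (truncSet p t n ∩ parSet m n 0 ∩ degSet m n (deg a)) :=
  mono_mem ⟨ha, rfl⟩

lemma WCoefDeg_lie [Fact p.Prime] [CharP F p] {d e : ℤ} {b c : Y m n → O F m n}
    (hb : b ∈ WCoefDeg F p n t d) (hc : c ∈ WCoefDeg F p n t e) :
    (fun j => vf b (c j) - vf c (b j)) ∈ WCoefDeg F p n t (d + e) := by
  have key : ∀ {d e : ℤ} {b c : Y m n → O F m n}, b ∈ WCoefDeg F p n t d →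
      c ∈ WCoefDeg F p n t e → ∀ j, vf b (c j) ∈
        mspan F (truncSet p t n ∩ parSet m n (mu j) ∩ degSet m n (d + e + 1)) := by
    intro d e b c hb hc j
    rw [vf_apply]
    refine sum_mem fun i _ => ?_
    have := mulO_mem_deg (hb i (Set.mem_univ i)) (pd_mem_deg i (hc j (Set.mem_univ j)))
    rwa [zmod2_add_self, show d + 1 + (e + 1 - 1) = d + e + 1 by ring] at this
  intro j _
  refine sub_mem (key hb hc j) ?_
  rw [add_comm d e]
  exact key hc hb j

lemma mem_WDeg [Fact p.Prime] [CharP F p] {d : ℤ} {w : W F p n t} :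
    w ∈ WDeg F p n t d ↔ ∃ c ∈ WCoefDeg F p n t d, (w : Module.End F (O F m n)) = vf c := by
  constructor
  · rintro ⟨c, hc, h⟩
    exact ⟨c, hc, h.symm⟩
  · rintro ⟨c, hc, h⟩
    exact ⟨c, hc, h.symm⟩

lemma WDeg_lie [Fact p.Prime] [CharP F p] {d e : ℤ} {v w : W F p n t}
    (hv : v ∈ WDeg F p n t d) (hw : w ∈ WDeg F p n t e) : ⁅v, w⁆ ∈ WDeg F p n t (d + e) := by
  obtain ⟨b, hb, hvb⟩ := mem_WDeg.1 hv
  obtain ⟨c, hc, hwc⟩ := mem_WDeg.1 hw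
  refine mem_WDeg.2 ⟨_, WCoefDeg_lie hb hc, ?_⟩
  rw [LieSubalgebra.coe_bracket, hvb, hwc, lie_vf (WCoefDeg_evenCoef hb) (WCoefDeg_evenCoef hc)]

lemma NSet_par {f : O F m n} (hf : f ∈ mspan F (NSet p n t)) : f ∈ mspan F (parSet m n 0) :=
  evenSet_par (mspan_mono NSet_subset hf)

lemma DHN_coe [Fact p.Prime] [CharP F p] (f : mspan F (NSet p n t)) :
    ((DHN F p n t f : W F p n t) : Module.End F (O F m n)) = DH (f : O F m n) := rfl

lemma DHN_mono_mem_WDeg [Fact p.Prime] [CharP F p] {a : Idx m n} (ha : a ∈ NSet p n t) :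
    (DHN F p n t ⟨mono a, mono_mem ha⟩ : W F p n t) ∈ WDeg F p n t ((deg a : ℤ) - 2) :=
  mem_WDeg.2 ⟨_, DHCoef_mem_WCoefDeg (mono_mem_deg ha.1), by rw [DHN_coe, DH_eq_vf]⟩

lemma DHN_lie [Fact p.Prime] [CharP F p] (f g : mspan F (NSet p n t)) :
    ⁅DHN F p n t f, DHN F p n t g⁆ = DHN F p n t ⟨DH (f : O F m n) (g : O F m n),
      DH_mem_NSet (mspan_mono NSet_subset f.2) (mspan_mono NSet_subset g.2)⟩ := by
  refine Subtype.ext (Subtype.ext ?_)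
  rw [DHN_coe]
  exact lie_DH (NSet_par f.2) (NSet_par g.2) (NSet_par (DH_mem_NSet
    (mspan_mono NSet_subset f.2) (mspan_mono NSet_subset g.2)))

/-- The map `f ↦ D(D_H(f))`, extended by zero to the basis elements outside `NSet`. -/
noncomputable def symb [Fact p.Prime] [CharP F p] (D : N F p n t →ₗ[F] W F p n t) :
    O F m n →ₗ[F] Module.End F (O F m n) :=
  open Classical in
  Finsupp.linearCombination F fun a : Idx m n => if h : a ∈ NSet p n t then
    ((D (DHN F p n t ⟨mono a, mono_mem h⟩) : W F p n t) : Module.End F (O F m n)) else 0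

lemma symb_mono [Fact p.Prime] [CharP F p] (D : N F p n t →ₗ[F] W F p n t) {a : Idx m n}
    (h : a ∈ NSet p n t) : symb D (mono a) =
      ((D (DHN F p n t ⟨mono a, mono_mem h⟩) : W F p n t) : Module.End F (O F m n)) := by
  refine (Finsupp.linearCombination_single F 1 a).trans ?_
  rw [one_smul, dif_pos h]

lemma symb_apply [Fact p.Prime] [CharP F p] (D : N F p n t →ₗ[F] W F p n t)
    (f : mspan F (NSet p n t)) : symb D (f : O F m n) =
      ((D (DHN F p n t f) : W F p n t) : Module.End F (O F m n)) := by
  obtain ⟨f, hf⟩ := f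
  unfold mspan at hf
  induction hf using Submodule.span_induction with
  | mem x hx =>
    obtain ⟨a, ha, rfl⟩ := hx
    exact symb_mono D ha
  | zero =>
    have : (⟨0, zero_mem _⟩ : mspan F (NSet p n t)) = 0 := rfl
    simp [this]
  | add x y hx hy h1 h2 =>
    have : (⟨x + y, add_mem hx hy⟩ : mspan F (NSet p n t)) = ⟨x, hx⟩ + ⟨y, hy⟩ := rfl
    rw [this, map_add, map_add]
    change symb D (x + y) = _
    rw [map_add, h1, h2]
    rfl
  | smul c x hx h1 =>
    have : (⟨c • x, Submodule.smul_mem _ c hx⟩ : mspan F (NSet p n t)) = c • ⟨x, hx⟩ := rfl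
    rw [this, map_smul, map_smul]
    change symb D (c • x) = _
    rw [map_smul, h1]
    rfl

lemma eq_zero_of_symb [Fact p.Prime] [CharP F p] {D : N F p n t →ₗ[F] W F p n t}
    (h : ∀ a ∈ NSet p n t, symb D (mono a) = 0) : D = 0 := by
  refine LinearMap.ext fun x => ?_
  obtain ⟨f, rfl⟩ := DHN_surjective x
  refine Subtype.ext ?_
  rw [← symb_apply]
  have h1 : mspan F (NSet p n t) ≤ LinearMap.ker (symb D) := by
    refine Submodule.span_le.2 ?_
    rintro _ ⟨a, ha, rfl⟩
    exact h a ha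
  exact h1 f.2

lemma negDer_symb [Fact p.Prime] [CharP F p] {r : ℤ} {D : N F p n t →ₗ[F] W F p n t}
    (hD : D ∈ DerDeg F p n t r) : NegDer F p n t r (symb D) where
  coef a ha := by
    obtain ⟨c, hc, h⟩ := mem_WDeg.1 (hD.2 _ _ (DHN_mono_mem_WDeg ha))
    rw [add_comm] at hc
    exact ⟨c, hc, by rw [symb_mono D ha, h]⟩
  lie a ha b hb := by
    have h := hD.1 (DHN F p n t ⟨mono a, mono_mem ha⟩) (DHN F p n t ⟨mono b, mono_mem hb⟩)
    rw [DHN_lie] at h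
    have h1 := symb_apply D ⟨DH (mono a : O F m n) (mono b), DH_mem_NSet (mono_mem ha.1) (mono_mem hb.1)⟩
    rw [h] at h1
    rw [symb_mono D ha, symb_mono D hb]
    exact h1

lemma killsBelow_symb_sub [Fact p.Prime] [CharP F p] {d : ℕ} {D E : N F p n t →ₗ[F] W F p n t}
    (hD : KillsBelow p t d (symb D)) (hE : KillsBelow p t d (symb E)) :
    KillsBelow p t d (symb (D - E)) := by
  intro a ha hda
  have h1 := hD a ha hda
  have h2 := hE a ha hda
  rw [symb_mono _ ha] at h1 h2 ⊢
  rw [LinearMap.sub_apply]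
  have h3 : D (DHN F p n t ⟨mono a, mono_mem ha⟩) = 0 := Subtype.ext h1
  have h4 : E (DHN F p n t ⟨mono a, mono_mem ha⟩) = 0 := Subtype.ext h2
  rw [h3, h4, sub_zero]
  rfl

/-- No monomial of 𝔑 has degree above |π| + n, so the induction on the degree ends after finitely
many steps. -/
lemma eq_zero_of_killsBelow [Fact p.Prime] [CharP F p] {D : N F p n t →ₗ[F] W F p n t}
    (h : KillsBelow p t (∑ i, piTop p t i + n + 1) (symb D)) : D = 0 := by
  refine eq_zero_of_symb fun a ha => h a ha ?_
  have h1 : ∑ i, a.1 i ≤ ∑ i, piTop p t i := sum_le_sum fun i _ => le_piTop_of_mem ha i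
  have h2 : #a.2 ≤ n := by simpa using card_le_univ a.2
  unfold deg
  omega

end Grading

/-! ### Inner derivations and the powers (ad ∂_i)^(p^s) -/

lemma lie_lie_eq_sub {A : Type*} [Ring A] (a x y : A) :
    ⁅a, ⁅x, y⁆⁆ = ⁅x, ⁅a, y⁆⁆ - ⁅y, ⁅a, x⁆⁆ := by
  simp only [Ring.lie_def]
  noncomm_ring

/-- ad a is the difference of the commuting left and right multiplications by a, and the p^s-th
power of such a difference is the difference of the powers in characteristic p. -/
lemma ad_pow_apply_of_charP {K A : Type*} [Field K] [Ring A] [Nontrivial A] [Algebra K A] {p : ℕ}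
    [Fact p.Prime] [CharP K p] (a b : A) (s : ℕ) :
    ((LieAlgebra.ad K A a) ^ p ^ s) b = ⁅a ^ p ^ s, b⁆ := by
  have : CharP (Module.End K A) p :=
    charP_of_injective_algebraMap (algebraMap K (Module.End K A)).injective p
  rw [LieAlgebra.ad_eq_lmul_left_sub_lmul_right, Pi.sub_apply, sub_pow_char_pow_of_commute,
    LinearMap.pow_mulLeft, LinearMap.pow_mulRight]
  · rfl
  · exact LinearMap.commute_mulLeft_right a a

section Generators
variable {F : Type*} [Field F] {p m n : ℕ} {t : Y0 m → ℕ+}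

lemma adN_apply [Fact p.Prime] [CharP F p] (w : W F p n t) (x : N F p n t) :
    adN F p n t w x = ⁅w, (x : W F p n t)⁆ := rfl

lemma adN_mem [Fact p.Prime] [CharP F p] {d : ℤ} {w : W F p n t} (hw : w ∈ WDeg F p n t d) :
    adN F p n t w ∈ DerDeg F p n t d := by
  refine ⟨fun x y => ?_, fun i x hx => WDeg_lie hw hx⟩
  simp only [adN_apply, LieSubalgebra.coe_bracket, LieSubalgebra.coe_bracket_of_module]
  rw [leibniz_lie, ← lie_skew]
  abel

lemma dW_mem [Fact p.Prime] [CharP F p] (i : Y0 m) : dW F p n t i ∈ WDeg F p n t (-1) := by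
  refine mem_WDeg.2 ⟨_, fun j _ => ?_, dEven_eq_vf i⟩
  by_cases hj : j = Sum.inl i
  · subst hj
    rw [Pi.single_eq_same]
    exact mono_mem ⟨⟨fun _ => Nat.zero_le _, by simp [parSet, mu]⟩, by simp [degSet]⟩
  · rw [Pi.single_eq_of_ne hj]
    exact zero_mem _

lemma adPow_mem_WDeg [Fact p.Prime] [CharP F p] (i : Y0 m) (s : ℕ) {d : ℤ} {x : N F p n t}
    (hx : (x : W F p n t) ∈ WDeg F p n t d) :
    adPow F p n t i s x ∈ WDeg F p n t (-(p ^ s : ℕ) + d) := by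
  have key : ∀ q : ℕ, ((LieAlgebra.ad F (W F p n t) (dW F p n t i)) ^ q) (x : W F p n t)
      ∈ WDeg F p n t (-(q : ℤ) + d) := by
    intro q
    induction q with
    | zero => simpa using hx
    | succ q ih =>
      rw [pow_succ', Module.End.mul_apply]
      have := WDeg_lie (dW_mem (F := F) (p := p) (n := n) (t := t) i) ih
      rwa [show (-1 : ℤ) + (-(q : ℤ) + d) = -((q + 1 : ℕ) : ℤ) + d by push_cast; ring] at this
  exact key _

/-- Inside the endomorphism algebra the power becomes a single commutator with the operator
∂_i^(p^s), from which the derivation property is immediate. -/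
lemma adPow_coe [Fact p.Prime] [CharP F p] (i : Y0 m) (s : ℕ) (x : N F p n t) :
    ((adPow F p n t i s x : W F p n t) : Module.End F (O F m n))
      = ⁅(dEven i : Module.End F (O F m n)) ^ p ^ s, ((x : W F p n t) : Module.End F (O F m n))⁆ := by
  refine Eq.trans ?_ (ad_pow_apply_of_charP (K := F) (p := p) (dEven i : Module.End F (O F m n))
    ((x : W F p n t) : Module.End F (O F m n)) s)
  have key : ∀ (q : ℕ) (w : W F p n t),
      ((((LieAlgebra.ad F (W F p n t) (dW F p n t i)) ^ q) w : W F p n t) : Module.End F (O F m n))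
      = ((LieAlgebra.ad F (Module.End F (O F m n)) (dEven i)) ^ q) w := by
    intro q w
    induction q with
    | zero => rfl
    | succ q ih =>
      rw [pow_succ', pow_succ', Module.End.mul_apply, Module.End.mul_apply, ← ih]
      rfl
  exact key _ _

lemma adPow_mem [Fact p.Prime] [CharP F p] (i : Y0 m) (s : ℕ) :
    adPow F p n t i s ∈ DerDeg F p n t (-(p ^ s : ℕ)) := by
  refine ⟨fun x y => Subtype.ext ?_, fun d x hx => adPow_mem_WDeg i s hx⟩
  rw [adPow_coe]
  change ⁅(dEven i : Module.End F (O F m n)) ^ p ^ s, ⁅((x : W F p n t) : Module.End F (O F m n)), ((y : W F p n t) : Module.End F (O F m n))⁆⁆ = ⁅((x : W F p n t) : Module.End F (O F m n)), ((adPow F p n t i s y : W F p n t) : Module.End F (O F m n))⁆ - ⁅((y : W F p n t) : Module.End F (O F m n)), ((adPow F p n t i s x : W F p n t) : Module.End F (O F m n))⁆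
  rw [adPow_coe, adPow_coe]
  exact lie_lie_eq_sub _ _ _

end Generators

/-! ### The derivations Φ and Θ -/

section Exceptional
variable {F : Type*} [Field F] {p m n : ℕ} {t : Y0 m → ℕ+}

lemma dEven_sg (i : Y0 m) (j : Y m n) (f : O F m n) : dEven i (sg j f) = sg j (dEven i f) := by
  rcases j with j | k
  · rfl
  · exact (par_dEven i f).symm

lemma lie_dEven_DH (i : Y0 m) (f : O F m n) :
    ⁅(dEven i : Module.End F (O F m n)), DH f⁆ = DH (dEven i f) := by
  rw [DH_eq_vf f, lie_dEven_vf, DH_eq_vf]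
  congr 1
  funext j
  simp only [DHCoef]
  rw [map_zsmul, dEven_pd, dEven_sg]

lemma lie_dEven_pow_DH [Fact p.Prime] [CharP F p] (i : Y0 m) (s : ℕ) (f : O F m n) :
    ⁅(dEven i : Module.End F (O F m n)) ^ p ^ s, DH f⁆ = DH ((dEven i ^ p ^ s) f) := by
  refine (ad_pow_apply_of_charP (K := F) (p := p) (dEven i : Module.End F (O F m n))
    (DH f) s).symm.trans ?_
  generalize p ^ s = q
  induction q with
  | zero => rfl
  | succ q ih =>
    rw [pow_succ', pow_succ', Module.End.mul_apply, Module.End.mul_apply, ih]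
    exact lie_dEven_DH i _

/-- The commutator of ∂_i^(p^s) with D_H(f) is D_H(∂_i^(p^s) f), so ∂_i^(p^s) is a derivation of the
Poisson bracket. -/
lemma dEven_pow_DH [Fact p.Prime] [CharP F p] (i : Y0 m) (s : ℕ) (f g : O F m n) :
    (dEven i ^ p ^ s) (DH f g) = DH ((dEven i ^ p ^ s) f) g + DH f ((dEven i ^ p ^ s) g) := by
  rw [← lie_dEven_pow_DH, lie_eq, LinearMap.sub_apply, Module.End.mul_apply, Module.End.mul_apply,
    sub_add_cancel]

lemma DH_antisymm {f g : O F m n} (hf : f ∈ mspan F (parSet m n 0))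
    (hg : g ∈ mspan F (parSet m n 0)) : DH f g = -DH g f := by
  rw [DH_even_apply hf, DH_even_apply hg, neg_add, ← sum_neg_distrib, ← sum_neg_distrib]
  congr 1
  · refine Fintype.sum_equiv (Equiv.sumComm _ _) _ _ fun i => ?_
    rw [show (Equiv.sumComm (Fin m) (Fin m)) i = i.swap from rfl, Sum.swap_swap, tau_swap, neg_smul,
      neg_neg, mulO_even_comm (f := dEven i f) (pd_par_even hf (Sum.inl i))]
  · refine sum_congr rfl fun k _ => ?_
    have := mulO_eps (i := Sum.inr k) (j := Sum.inr k) (pd_par_even hf (Sum.inr k))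
      (pd_par_even hg (Sum.inr k))
    simpa [eps, pd] using this

lemma lie_mulO_mul {c : Y m n → O F m n} (hc : EvenCoef c) (a : O F m n)
    (A : Module.End F (O F m n)) :
    ⁅vf c, mulO a * A⁆ = mulO (vf c a) * A + mulO a * ⁅vf c, A⁆ := by
  refine LinearMap.ext fun f => ?_
  rw [lie_eq, lie_eq, LinearMap.sub_apply, LinearMap.add_apply]
  simp only [Module.End.mul_apply]
  rw [vf_mul hc, LinearMap.sub_apply, map_sub]
  simp only [Module.End.mul_apply]
  abel

lemma lie_DH_mulO_omega {f : O F m n} (hf : f ∈ mspan F (parSet m n 0))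
    (A : Module.End F (O F m n)) :
    ⁅DH f, mulO (mono (0, univ)) * A⁆ = mulO (mono (0, univ)) * ⁅DH f, A⁆ := by
  rw [DH_eq_vf, lie_mulO_mul (evenCoef_DHCoef hf), ← DH_eq_vf, DH_omega hf, map_zero, zero_mul,
    zero_add]

lemma lie_DH_mul_DH_omega (hn : Even n) {f : O F m n} (hf : f ∈ mspan F (parSet m n 0))
    (a : O F m n) :
    ⁅DH f, mulO a * DH (mono (0, univ))⁆ = mulO (DH f a) * DH (mono (0, univ)) := by
  have h0 : (0 : O F m n) ∈ mspan F (parSet m n 0) := zero_mem _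
  have h1 : ⁅DH f, (DH (mono (0, univ)) : Module.End F (O F m n))⁆ = 0 := by
    rw [lie_DH hf (mono_mem (even_parSet (by simpa using hn))) (by rwa [DH_omega hf]), DH_omega hf,
      map_zero]
  rw [DH_eq_vf f, lie_mulO_mul (evenCoef_DHCoef hf), ← DH_eq_vf, h1, mul_zero, add_zero]

lemma mem_Der_iff [Fact p.Prime] [CharP F p] {D : N F p n t →ₗ[F] W F p n t} :
    D ∈ Der F (N F p n t) (W F p n t) ↔ ∀ f g : mspan F (NSet p n t),
      ((D ⁅DHN F p n t f, DHN F p n t g⁆ : W F p n t) : Module.End F (O F m n)) =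
      ⁅(DH (f : O F m n) : Module.End F (O F m n)), ((D (DHN F p n t g) : W F p n t) : Module.End F (O F m n))⁆
      - ⁅(DH (g : O F m n) : Module.End F (O F m n)), ((D (DHN F p n t f) : W F p n t) : Module.End F (O F m n))⁆ := by
  constructor
  · intro hD f g
    rw [hD]
    rfl
  · intro h x y
    obtain ⟨f, rfl⟩ := DHN_surjective x
    obtain ⟨g, rfl⟩ := DHN_surjective y
    exact Subtype.ext (h f g)

lemma Θ_coe [Fact p.Prime] [CharP F p] (hn : Even n) (i : Y0 m) (s : ℕ) (x : N F p n t) :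
    ((Θ F p n t hn i s x : W F p n t) : Module.End F (O F m n))
      = mulO (mono (0, univ)) * ((adPow F p n t i s x : W F p n t) : Module.End F (O F m n)) := rfl

lemma omega_mem_deg (hn : Even n) : (mono (0, univ) : O F m n) ∈
    mspan F (truncSet p t n ∩ parSet m n 0 ∩ degSet m n n) := by
  have h := mono_mem_deg (F := F) (omega_mem (p := p) (t := t) hn)
  rwa [deg_mk, tot_zero, zero_add, card_univ, Fintype.card_fin] at h

/-- D_H(x^ω) commutes with all Hamiltonian fields, so bracketing D_H(f) with a D_H(x^ω) only
replaces a by {f, a}. The derivation rule for Φ thus reduces to that of ∂_i^(p^s) for the Poisson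
bracket. -/
lemma Φ_mem [Fact p.Prime] [CharP F p] (hn : Even n) (i : Y0 m) (s : ℕ) :
    Φ F p n t hn i s ∈ DerDeg F p n t ((n : ℤ) - (p ^ s : ℕ)) := by
  constructor
  · rw [mem_Der_iff]
    intro f g
    have hf := NSet_par f.2
    have hg := NSet_par g.2
    have hq : ∀ f : mspan F (NSet p n t), (dEven i ^ p ^ s) (f : O F m n) ∈ mspan F (parSet m n 0) :=
      fun f => evenSet_par (dEven_pow_mem i _ (mspan_mono NSet_subset f.2))
    rw [DHN_lie, Φ_DHN, Φ_DHN, Φ_DHN, lie_DH_mul_DH_omega hn hf, lie_DH_mul_DH_omega hn hg,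
      dEven_pow_DH, DH_antisymm (hq f) hg, map_add, map_neg]
    refine LinearMap.ext fun x => ?_
    simp only [LinearMap.sub_apply, Module.End.mul_apply, LinearMap.add_apply, LinearMap.neg_apply]
    rw [neg_add_eq_sub]
  · intro d x hx
    obtain ⟨f, rfl⟩ := DHN_surjective x
    obtain ⟨c, hc, h⟩ := mem_WDeg.1 hx
    rw [DHN_coe, DH_eq_vf] at h
    rw [← vf_injective h] at hc
    -- Homogeneity of D_H(f) says nothing about the constant term of f. Only the derivatives of f
    -- are known to be homogeneous, which suffices because p^s ≥ 1.
    have h1 : ∀ l, dEven l (f : O F m n) ∈ mspan F (truncSet p t n ∩ parSet m n 0 ∩ degSet m n (d + 1)) := by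
      intro l
      have h2 := hc (Sum.inl l.swap) (Set.mem_univ _)
      rw [DHCoef_inl, Sum.swap_swap, ← Int.cast_smul_eq_zsmul F] at h2
      refine (Submodule.smul_mem_iff _ ?_).1 h2
      rw [Int.cast_neg, neg_ne_zero]
      exact tau_cast_ne_zero _
    have h3 : ∀ q : ℕ, (dEven i ^ (q + 1)) (f : O F m n) ∈
        mspan F (truncSet p t n ∩ parSet m n 0 ∩ degSet m n (d + 1 - q)) := by
      intro q
      induction q with
      | zero => simpa using h1 i
      | succ q ih =>
        rw [pow_succ', Module.End.mul_apply]
        have := pd_mem_deg (Sum.inl i) ih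
        rw [add_zero, show d + 1 - (q : ℤ) - 1 = d + 1 - ((q + 1 : ℕ) : ℤ) by push_cast; ring] at this
        exact this
    obtain ⟨q, hq⟩ := Nat.exists_eq_succ_of_ne_zero (pow_ne_zero s (Fact.out : p.Prime).ne_zero)
    refine mem_WDeg.2 ⟨fun j => mulO ((dEven i ^ p ^ s) (f : O F m n)) (DHCoef (mono (0, univ)) j), ?_, ?_⟩
    · intro j _
      have h4 := mulO_mem_deg (h3 q) (DHCoef_mem_WCoefDeg (omega_mem_deg (F := F) (p := p) (t := t) hn)
        j (Set.mem_univ j))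
      rw [zero_add] at h4
      rw [show d + 1 - (q : ℤ) + ((n : ℤ) - 2 + 1) = (n : ℤ) - (p ^ s : ℕ) + d + 1 by
        rw [hq]; push_cast; ring, ← Nat.succ_eq_add_one, ← hq] at h4
      exact h4
    · rw [Φ_DHN, DH_eq_vf, mulO_vf]

/-- Hamiltonian fields of even elements annihilate x^ω, so multiplication by x^ω commutes with their
adjoint action and carries the derivation (ad ∂_i)^(p^s) to a derivation. -/
lemma Θ_mem [Fact p.Prime] [CharP F p] (hn : Even n) (i : Y0 m) (s : ℕ) :
    Θ F p n t hn i s ∈ DerDeg F p n t ((n : ℤ) - (p ^ s : ℕ)) := by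
  constructor
  · rw [mem_Der_iff]
    intro f g
    rw [Θ_coe, Θ_coe, Θ_coe, lie_DH_mulO_omega (NSet_par f.2), lie_DH_mulO_omega (NSet_par g.2),
      mem_Der_iff.1 (adPow_mem i s).1]
    refine LinearMap.ext fun x => ?_
    simp only [LinearMap.sub_apply, Module.End.mul_apply, map_sub]
  · intro d x hx
    obtain ⟨c, hc, h⟩ := mem_WDeg.1 (adPow_mem_WDeg i s hx)
    refine mem_WDeg.2 ⟨fun j => mulO (mono (0, univ)) (c j), ?_, ?_⟩
    · intro j _
      have h4 := mulO_mem_deg (omega_mem_deg (F := F) (p := p) (t := t) hn) (hc j (Set.mem_univ j))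
      rw [zero_add, show (n : ℤ) + (-(p ^ s : ℕ) + d + 1) = (n : ℤ) - (p ^ s : ℕ) + d + 1 by ring]
        at h4
      exact h4
    · rw [Θ_coe, h, mulO_vf]

lemma symb_adPow [Fact p.Prime] [CharP F p] (j : Y0 m) (s : ℕ) {a : Idx m n}
    (ha : a ∈ NSet p n t) : symb (adPow F p n t j s) (mono a) = DH ((dEven j ^ p ^ s) (mono a)) := by
  rw [symb_mono _ ha, adPow_coe, DHN_coe, lie_dEven_pow_DH]

lemma symb_Φ [Fact p.Prime] [CharP F p] (hn : Even n) (j : Y0 m) (s : ℕ) {a : Idx m n}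
    (ha : a ∈ NSet p n t) : symb (Φ F p n t hn j s) (mono a)
      = mulO ((dEven j ^ p ^ s) (mono a)) * DH (mono (0, univ)) := by
  rw [symb_mono _ ha, Φ_DHN]

lemma symb_Θ [Fact p.Prime] [CharP F p] (hn : Even n) (j : Y0 m) (s : ℕ) {a : Idx m n}
    (ha : a ∈ NSet p n t) : symb (Θ F p n t hn j s) (mono a)
      = mulO (mono (0, univ)) * DH ((dEven j ^ p ^ s) (mono a)) := by
  rw [symb_mono _ ha, Θ_coe, adPow_coe, DHN_coe, lie_dEven_pow_DH]

lemma dEven_pow_mono_of_lt {j : Y0 m} {q : ℕ} {a : Idx m n} (h : a.1 j < q) :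
    (dEven j ^ q) (mono a : O F m n) = 0 := by
  induction q generalizing a with
  | zero => omega
  | succ q ih =>
    rw [pow_succ, Module.End.mul_apply]
    obtain ⟨α, u⟩ := a
    by_cases h0 : α j = 0
    · rw [dEven_mono_of_eq_zero _ h0, map_zero]
    · obtain ⟨γ, rfl⟩ := exists_add_single h0
      rw [dEven_mono_add]
      refine ih ?_
      simp at h ⊢
      omega

lemma dEven_pow_mono_add (j : Y0 m) (q : ℕ) (α : Y0 m → ℕ) (u : Finset (Fin n)) :
    (dEven j ^ q) (mono (α + Pi.single j q, u) : O F m n) = mono (α, u) := by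
  induction q with
  | zero => simp
  | succ q ih =>
    rw [pow_succ, Module.End.mul_apply, Pi.single_add, ← add_assoc, dEven_mono_add, ih]

end Exceptional

/-! ### Degree at most two: inner derivations -/

section LowDegrees
variable {F : Type*} [Field F] {p m n : ℕ} {t : Y0 m → ℕ+}

lemma symb_sub_mono [Fact p.Prime] [CharP F p] (D E : N F p n t →ₗ[F] W F p n t) {a : Idx m n}
    (ha : a ∈ NSet p n t) {A B : Module.End F (O F m n)} (hD : symb D (mono a) = A)
    (hE : symb E (mono a) = B) : symb (D - E) (mono a) = A - B := by
  rw [symb_mono _ ha] at hD hE ⊢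
  rw [← hD, ← hE, LinearMap.sub_apply]
  rfl

lemma symb_smul_mono [Fact p.Prime] [CharP F p] (b : F) (D : N F p n t →ₗ[F] W F p n t)
    {a : Idx m n} (ha : a ∈ NSet p n t) : symb (b • D) (mono a) = b • symb D (mono a) := by
  rw [symb_mono _ ha, symb_mono _ ha, LinearMap.smul_apply]
  rfl

lemma symb_add_mono [Fact p.Prime] [CharP F p] (D E : N F p n t →ₗ[F] W F p n t)
    {a : Idx m n} (ha : a ∈ NSet p n t) :
    symb (D + E) (mono a) = symb D (mono a) + symb E (mono a) := by
  rw [symb_mono _ ha, symb_mono _ ha, symb_mono _ ha, LinearMap.add_apply]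
  rfl

lemma symb_sum_mono [Fact p.Prime] [CharP F p] {ι : Type*} (s : Finset ι)
    (D : ι → N F p n t →ₗ[F] W F p n t) {a : Idx m n} (ha : a ∈ NSet p n t) :
    symb (∑ j ∈ s, D j) (mono a) = ∑ j ∈ s, symb (D j) (mono a) := by
  classical
  induction s using Finset.induction_on with
  | empty =>
    rw [sum_empty, sum_empty, symb_mono _ ha]
    rfl
  | insert j s hj ih => rw [sum_insert hj, sum_insert hj, symb_add_mono _ _ ha, ih]

/-- The values would lie in degree at most -2, where 𝒲 is zero. -/
lemma NegDer.killsBelow_two {r : ℤ} (hr : r ≤ -1) {L : O F m n →ₗ[F] Module.End F (O F m n)}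
    (hL : NegDer F p n t r L) : KillsBelow p t 2 L := by
  intro a ha hda
  obtain ⟨c, hc, h⟩ := hL.coef a ha
  rw [h, WCoefDeg_eq_zero (by omega) hc, map_zero]

/-- The weight of `∂_j` with respect to `∑ i, x_i x_{i'}`. -/
def totalWt (j : Y m n) : ℤ := ∑ i : Fin m, wt (Sum.inl i) j

lemma totalWt_inl (l : Y0 m) : totalWt (Sum.inl l : Y m n) = 1 ∨ totalWt (Sum.inl l : Y m n) = -1 := by
  rcases l with l | l
  · right
    unfold totalWt
    rw [sum_eq_single l]
    · simp [wt]
    · intro i _ hi; simp [wt, hi.symm]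
    · simp
  · left
    unfold totalWt
    rw [sum_eq_single l]
    · simp [wt]
    · intro i _ hi; simp [wt, hi.symm]
    · simp

lemma WCoefDeg_neg_one_inr {c : Y m n → O F m n} (hc : c ∈ WCoefDeg F p n t (-1)) (k : Fin n) :
    c (Sum.inr k) = 0 := by
  ext a
  by_contra h
  have h1 := WCoefDeg_apply hc h
  have h2 : #a.2 = 0 := by
    have := h1.2
    unfold deg at this
    omega
  rw [h2] at h1
  simp [mu] at h1

lemma WCoefDeg_neg_one_dEven {c : Y m n → O F m n} (hc : c ∈ WCoefDeg F p n t (-1)) (i : Y0 m)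
    (j : Y m n) : dEven i (c j) = 0 := by
  ext ⟨α, u⟩
  rw [dEven_apply]
  by_contra h
  have := (WCoefDeg_apply hc h).2
  rw [deg_mk, tot_add, tot_single] at this
  omega

/-- The element `x_i x_{i'}` has degree two. -/
lemma deg_pair (i : Y0 m) : deg ((Pi.single i 1 + Pi.single i.swap 1, ∅) : Idx m n) = 2 := by
  rw [deg_mk, tot_add, tot_single, tot_single, card_empty]

lemma lie_pair_vf {c : Y m n → O F m n} (hc : c ∈ WCoefDeg F p n t (-1)) (i : Fin m) :
    ⁅(DH (mono (Pi.single (Sum.inl i) 1 + Pi.single (Sum.inr i) 1, ∅)) : Module.End F (O F m n)), vf c⁆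
      = vf fun j => (-(wt (Sum.inl i) j : F)) • c j := by
  rw [lie_pure_vf _ (WCoefDeg_evenCoef hc) (WCoefDeg_neg_one_dEven hc)]
  congr 1
  funext j
  have := vf_DHCoef_pair (Sum.inl i) c j
  rw [Sum.swap_inl] at this
  rw [this]
  simp [tau]

/-- A derivation of degree `-1` that vanishes at `∑ i, x_i x_{i'}` vanishes in degree two. -/
lemma NegDer.killsBelow_three [LargeParams p m n] [CharP F p]
    {L : O F m n →ₗ[F] Module.End F (O F m n)}
    (hL : NegDer F p n t (-1) L)
    (hh : ∑ i : Fin m, L (mono (Pi.single (Sum.inl i) 1 + Pi.single (Sum.inr i) 1, ∅)) = 0) :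
    KillsBelow p t 3 L := by
  intro a ha hda
  have hp : 3 < p := LargeParams.three_lt_p m n
  by_cases hda' : deg a < 2
  · exact hL.killsBelow_two le_rfl a ha hda'
  replace hda : deg a = 2 := by omega
  obtain ⟨c, hc, hLc⟩ := hL.coef a ha
  rw [hda, show ((2 : ℕ) : ℤ) - 2 + -1 = -1 by norm_num] at hc
  -- This is the derivation rule for x_i x_{i'} and the given monomial. Summed over i, the last
  -- commutators cancel by hypothesis, and an eigenvalue equation for ∑ x_i x_{i'} remains.
  have hp1 : ∀ i : Fin m, (((a.1 (Sum.inr i) : F) - a.1 (Sum.inl i)) • vf c : Module.End F (O F m n))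
      = vf (fun j => (-(wt (Sum.inl i) j : F)) • c j) -
        ⁅(DH (mono a) : Module.End F (O F m n)),
          L (mono (Pi.single (Sum.inl i) 1 + Pi.single (Sum.inr i) 1, ∅))⁆ := by
    intro i
    have h1 := hL.lie _ (pair_mem_NSet (Sum.inl i)) a ha
    rw [DH_pair] at h1
    simp only [Sum.swap_inl] at h1
    rw [hLc, lie_pair_vf hc, map_smul, map_smul, hLc] at h1
    simpa [tau] using h1
  have hsum : ∀ f, ∑ i : Fin m, ⁅(DH (mono a) : Module.End F (O F m n)),
      L (mono (Pi.single (Sum.inl i) 1 + Pi.single (Sum.inr i) 1, ∅))⁆ f = 0 := by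
    intro f
    have h1 : ∀ g, ∑ i : Fin m, L (mono (Pi.single (Sum.inl i) 1 + Pi.single (Sum.inr i) 1, ∅)) g
        = 0 := by
      intro g
      rw [← LinearMap.sum_apply, hh, LinearMap.zero_apply]
    simp only [lie_eq, LinearMap.sub_apply, Module.End.mul_apply]
    rw [sum_sub_distrib, h1, ← map_sum, h1, map_zero, sub_zero]
  have hc0 : c = 0 := by
    funext j
    rcases j with l | k
    · have h2 : ∑ i : Fin m, ((a.1 (Sum.inr i) : F) - a.1 (Sum.inl i)) • c (Sum.inl l)
          = ∑ i : Fin m, (-(wt (Sum.inl i) (Sum.inl l : Y m n) : F)) • c (Sum.inl l) := by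
        rw [← sub_zero (∑ i : Fin m, (-(wt (Sum.inl i) (Sum.inl l : Y m n) : F)) • c (Sum.inl l)),
          ← hsum (var (Sum.inl l)), ← sum_sub_distrib]
        refine sum_congr rfl fun i _ => ?_
        have h3 := congrArg (fun A : Module.End F (O F m n) => A (var (Sum.inl l))) (hp1 i)
        simpa only [LinearMap.sub_apply, LinearMap.smul_apply, vf_var] using h3
      rw [← sum_smul, ← sum_smul, ← sub_eq_zero, ← sub_smul, smul_eq_zero] at h2
      refine h2.resolve_left fun h3 => ?_
      have h4 : ((∑ i : Fin m, (a.1 (Sum.inr i) : ℤ) - ∑ i : Fin m, (a.1 (Sum.inl i) : ℤ)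
          + totalWt (Sum.inl l : Y m n) : ℤ) : F) = 0 := by
        rw [← h3, totalWt]
        push_cast
        rw [sum_sub_distrib, sum_neg_distrib]
        ring
      rw [CharP.intCast_eq_zero_iff F p] at h4
      have h5 : ∑ i : Fin m, a.1 (Sum.inl i) + ∑ i : Fin m, a.1 (Sum.inr i) + #a.2 = 2 := by
        rw [← Fintype.sum_sum_type]
        exact hda
      obtain ⟨e, he⟩ := even_of_mem ha
      rw [← Nat.cast_sum, ← Nat.cast_sum] at h4
      obtain ⟨z, hz⟩ := h4
      -- The quadratic monomial contributes -2, 0 or 2 and ∂_l contributes ±1. The total is odd and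
      -- of absolute value at most 3 < p, so it cannot vanish modulo p.
      have hz0 : z = 0 := by
        by_contra hz0
        have : (p : ℤ) ≤ |(p : ℤ) * z| := by
          rw [abs_mul, Nat.abs_cast]
          exact le_mul_of_one_le_right (by positivity) (Int.one_le_abs hz0)
        rw [← hz, le_abs] at this
        rcases totalWt_inl (n := n) l with h | h <;> omega
      rw [hz0, mul_zero] at hz
      rcases totalWt_inl (n := n) l with h | h <;> omega
    · exact WCoefDeg_neg_one_inr hc k
  rw [hLc, hc0, map_zero]

lemma WCoefDeg_le {d : ℤ} {c : Y m n → O F m n} (hc : c ∈ WCoefDeg F p n t d) :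
    c ∈ WCoef F p n t :=
  fun j _ => mspan_mono Set.inter_subset_left (hc j (Set.mem_univ j))

/-- For r ≤ -2 the values in degree two vanish already. For r = -1 they lie in 𝒲_[-1], where ∑ x_i
x_{i'} acts invertibly, so some w there reproduces the value of D at this element; after subtracting
ad w, `NegDer.killsBelow_three` applies. -/
lemma exists_adN_killsBelow_three [Fact p.Prime] [CharP F p] [LargeParams p m n] {r : ℤ}
    (hr : r ≤ -1) {D : N F p n t →ₗ[F] W F p n t} (hD : D ∈ DerDeg F p n t r) :
    ∃ w ∈ WDeg F p n t (-1), adN F p n t w ∈ DerDeg F p n t r ∧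
      KillsBelow p t 3 (symb (D - adN F p n t w)) := by
  have hL := negDer_symb hD
  rcases eq_or_ne r (-1) with rfl | hr'
  · have h1 : ∀ i : Fin m, ∃ c ∈ WCoefDeg F p n t (-1),
        symb D (mono (Pi.single (Sum.inl i) 1 + Pi.single (Sum.inr i) 1, ∅)) = vf c := by
      intro i
      obtain ⟨c, hc, h⟩ := hL.coef _ (pair_mem_NSet (Sum.inl i))
      rw [deg_pair] at hc
      exact ⟨c, hc, h⟩
    choose c hc h using h1
    have hc' : (fun j => (totalWt j : F) • ∑ i, c i j) ∈ WCoefDeg F p n t (-1) := fun j _ =>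
      Submodule.smul_mem _ _ (sum_mem fun i _ => hc i j (Set.mem_univ j))
    -- Bracketing with ∑ x_i x_{i'} multiplies the ∂_j-component by its total weight, which is ±1
    -- for even j. The factor `totalWt j` is its own inverse; odd components are absent in degree
    -- -1.
    let w : W F p n t := ⟨vf fun j => (totalWt j : F) • ∑ i, c i j,
      Submodule.mem_map_of_mem (WCoefDeg_le hc')⟩
    have hw : w ∈ WDeg F p n t (-1) := mem_WDeg.2 ⟨_, hc', rfl⟩
    refine ⟨w, hw, adN_mem hw, (negDer_symb (sub_mem hD (adN_mem hw))).killsBelow_three ?_⟩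
    have h2 : ∀ i : Fin m, symb (adN F p n t w)
        (mono (Pi.single (Sum.inl i) 1 + Pi.single (Sum.inr i) 1, ∅))
          = vf fun j => (wt (Sum.inl i) j : F) • (totalWt j : F) • ∑ i, c i j := by
      intro i
      have h3 := lie_pair_vf hc' i
      have h4 := pair_mem_NSet (p := p) (n := n) (t := t) (Sum.inl i)
      rw [Sum.swap_inl] at h4
      rw [symb_mono _ h4]
      have h5 : ∀ A B : Module.End F (O F m n), ⁅B, A⁆ = -⁅A, B⁆ := fun A B =>
        LinearMap.ext fun f => by
          rw [LinearMap.neg_apply, lie_eq, lie_eq, LinearMap.sub_apply, LinearMap.sub_apply, neg_sub]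
      refine (h5 (DH (mono (Pi.single (Sum.inl i) 1 + Pi.single (Sum.inr i) 1, ∅))) (vf _)).trans ?_
      rw [h3]
      refine LinearMap.ext fun f => ?_
      rw [LinearMap.neg_apply, vf_apply, vf_apply, ← sum_neg_distrib]
      exact sum_congr rfl fun j _ => by rw [neg_smul, map_neg, LinearMap.neg_apply, neg_neg]
    have h3 : ∀ i : Fin m, symb (D - adN F p n t w)
        (mono (Pi.single (Sum.inl i) 1 + Pi.single (Sum.inr i) 1, ∅))
          = vf (c i - fun j => (wt (Sum.inl i) j : F) • (totalWt j : F) • ∑ i, c i j) := by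
      intro i
      have h4 := pair_mem_NSet (p := p) (n := n) (t := t) (Sum.inl i)
      rw [Sum.swap_inl] at h4
      rw [symb_sub_mono _ _ h4 (h i) (h2 i), map_sub]
    rw [sum_congr rfl fun i _ => h3 i, ← map_sum]
    refine (congrArg vf ?_).trans (map_zero vf)
    funext j
    rw [Finset.sum_apply]
    simp only [Pi.sub_apply]
    rw [sum_sub_distrib, ← sum_smul, smul_smul, ← Int.cast_sum]
    change ∑ i, c i j - ((totalWt j : ℤ) * (totalWt j : ℤ) : F) • _ = 0
    rcases j with l | k
    · rcases totalWt_inl (n := n) l with h | h <;> simp [h]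
    · have h4 : ∑ i, c i (Sum.inr k) = 0 := sum_eq_zero fun i _ => WCoefDeg_neg_one_inr (hc i) k
      rw [h4, smul_zero, sub_zero]
  · refine ⟨0, zero_mem _, by rw [map_zero]; exact zero_mem _, fun a ha hda => ?_⟩
    rw [map_zero, sub_zero]
    obtain ⟨c, hc, h⟩ := hL.coef a ha
    rw [h, WCoefDeg_eq_zero (by omega) hc, map_zero]

end LowDegrees

/-! ### Subtracting the listed derivations, degree by degree -/

section Reduction
variable {F : Type*} [Field F] {p m n : ℕ} {t : Y0 m → ℕ+}

lemma exponent_le [Fact p.Prime] {s : ℕ} {j : Y0 m} (h : p ^ s ≤ piTop p t j) :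
    s ≤ (t j : ℕ) - 1 := by
  have hp : p.Prime := Fact.out
  have h1 : p ^ s < p ^ (t j : ℕ) := by
    have : 0 < p ^ (t j : ℕ) := pow_pos hp.pos _
    unfold piTop at h
    omega
  have := (Nat.pow_lt_pow_iff_right hp.one_lt).1 h1
  omega

lemma power_mem_NSet [Fact p.Prime] [LargeParams p m n] {q : ℕ} {j : Y0 m}
    (hj : q ≤ piTop p t j) : ((Pi.single j q, ∅) : Idx m n) ∈ NSet p n t := by
  have hjj := swap_ne j
  refine mem_NSet (fun l => ?_) (by simp) (i := j.swap) ?_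
  · simp only [Pi.single_apply]
    grind
  · have := three_le_piTop (p := p) (n := n) (t := t) j.swap
    simp [hjj]; omega

lemma mul_power_mem_NSet [Fact p.Prime] [LargeParams p m n] {q : ℕ} {i j : Y0 m} (hij : j ≠ i)
    (hj : q ≤ piTop p t j) :
    ((Pi.single i 1 + Pi.single j q, ∅) : Idx m n) ∈ NSet p n t := by
  have h3 := fun l => three_le_piTop (p := p) (n := n) (t := t) l
  refine mem_NSet (fun l => ?_) (by simp) (i := i) ?_
  · have := h3 l
    simp only [Pi.add_apply, Pi.single_apply]
    grind
  · have := h3 i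
    simp [hij.symm]; omega

lemma apply_le_deg (a : Idx m n) (j : Y0 m) : a.1 j ≤ deg a :=
  (le_tot a.1 j).trans (Nat.le_add_right _ _)

/-- In degree at most q the result of ∂_j^q is zero or constant, and D_H(1) = 0. For this reason (ad
∂_j)^q and Θ start one degree later than Φ. -/
lemma DH_dEven_pow_eq_zero {a : Idx m n} {j : Y0 m} {q : ℕ} (h : deg a < q + 1) :
    DH ((dEven j ^ q) (mono a : O F m n)) = 0 := by
  rcases lt_or_ge (a.1 j) q with h1 | h1
  · rw [dEven_pow_mono_of_lt h1, map_zero]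
  · obtain ⟨α, u⟩ := a
    obtain ⟨γ, hγ⟩ : ∃ γ : Y0 m → ℕ, α = γ + Pi.single j q := by
      refine ⟨α - Pi.single j q, ?_⟩
      funext l
      by_cases hl : l = j
      · subst hl
        simp only [Pi.add_apply, Pi.sub_apply, Pi.single_eq_same]
        exact (Nat.sub_add_cancel h1).symm
      · simp [hl]
    rw [hγ, deg_mk, tot_add, tot_single] at h
    have hγ0 : γ = 0 := by
      funext l
      have := le_tot γ l
      simp only [Pi.zero_apply]
      omega
    have hu : u = ∅ := card_eq_zero.1 (by omega)
    rw [hγ, dEven_pow_mono_add, hγ0, hu, DH_one]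

lemma killsBelow_adPow [Fact p.Prime] [CharP F p] (j : Y0 m) (s : ℕ) :
    KillsBelow p t (p ^ s + 1) (symb (adPow F p n t j s)) := fun a ha hda => by
  rw [symb_adPow _ _ ha, DH_dEven_pow_eq_zero hda]

lemma killsBelow_Θ [Fact p.Prime] [CharP F p] (hn : Even n) (j : Y0 m) (s : ℕ) :
    KillsBelow p t (p ^ s + 1) (symb (Θ F p n t hn j s)) := fun a ha hda => by
  rw [symb_Θ _ _ _ ha, DH_dEven_pow_eq_zero hda, mul_zero]

lemma killsBelow_Φ [Fact p.Prime] [CharP F p] (hn : Even n) (j : Y0 m) (s : ℕ) :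
    KillsBelow p t (p ^ s) (symb (Φ F p n t hn j s)) := fun a ha hda => by
  rw [symb_Φ _ _ _ ha, dEven_pow_mono_of_lt ((apply_le_deg a j).trans_lt hda), map_zero, zero_mul]

lemma killsBelow_sum [Fact p.Prime] [CharP F p] {d : ℕ} {R : Y0 m → N F p n t →ₗ[F] W F p n t}
    (h : ∀ j, KillsBelow p t d (symb (R j))) : KillsBelow p t d (symb (∑ j, R j)) :=
  fun a ha hda => by
    rw [symb_sum_mono _ _ ha]
    exact sum_eq_zero fun j _ => h j a ha hda

lemma mulO_one_left (f : O F m n) : mulO (mono (0, ∅)) f = f := by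
  rw [mulO_even_comm (mono_mem (by simp [parSet])), mulO_one]

/-- The value at `x_j^(q)` is that of a multiple of `Φ`. -/
lemma exists_sub_power [Fact p.Prime] [CharP F p] [LargeParams p m n] {r : ℤ} (hr : r ≤ -1)
    {D : N F p n t →ₗ[F] W F p n t} (hD : D ∈ DerDeg F p n t r)
    {S : Submodule F (N F p n t →ₗ[F] W F p n t)}
    (hΦ : ∀ (he : Even n) (j : Y0 m) (s : ℕ), 1 ≤ s → s ≤ (t j : ℕ) - 1 →
      (n : ℤ) - (p : ℤ) ^ s < 0 → Φ F p n t he j s ∈ S)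
    {s : ℕ} (hs : 1 ≤ s) (hk : KillsBelow p t (p ^ s) (symb D)) :
    ∃ R ∈ S, R ∈ DerDeg F p n t r ∧ KillsBelow p t (p ^ s) (symb R) ∧
      ∀ j, p ^ s ≤ piTop p t j →
        symb (D - R) (mono (Pi.single j (p ^ s), ∅)) = 0 := by
  have hL := negDer_symb hD
  have h4 : 4 ≤ p ^ s := large_pow (p := p) (m := m) (n := n) hs
  -- For each j one correction is chosen that matches D at x_j^(q) and vanishes at x_k^(q) for k ≠
  -- j, so that the sum over j corrects all of them simultaneously.
  have h1 : ∀ j, ∃ R ∈ S, R ∈ DerDeg F p n t r ∧ KillsBelow p t (p ^ s) (symb R) ∧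
      ∀ k, p ^ s ≤ piTop p t k → symb R (mono (Pi.single k (p ^ s), ∅))
        = if k = j then symb D (mono (Pi.single k (p ^ s), ∅)) else 0 := by
    intro j
    by_cases h0 : p ^ s ≤ piTop p t j → symb D (mono (Pi.single j (p ^ s), ∅)) = 0
    · refine ⟨0, zero_mem _, zero_mem _, fun a ha _ => by rw [symb_mono _ ha]; rfl, fun k hk => ?_⟩
      rw [symb_mono _ (power_mem_NSet hk)]
      split_ifs with h
      · subst h; rw [h0 hk]; rfl
      · rfl
    · push Not at h0
      obtain ⟨hj, h0⟩ := h0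
      obtain ⟨hr', hn, b, hb⟩ := (hL.power_value hs hk hj).resolve_left h0
      refine ⟨b • Φ F p n t hn j s, Submodule.smul_mem _ _ (hΦ hn j s hs (exponent_le hj) ?_),
        Submodule.smul_mem _ _ (hr' ▸ Φ_mem hn j s), fun a ha hda => ?_, fun k hk => ?_⟩
      -- A nonzero value forces r = n - p^s, and r ≤ -1 is the condition under which Φ belongs to
      -- the list.
      · push_cast at hr'
        omega
      · rw [symb_smul_mono _ _ ha, killsBelow_Φ hn j s a ha hda, smul_zero]
      · rw [symb_smul_mono _ _ (power_mem_NSet hk), symb_Φ _ _ _ (power_mem_NSet hk)]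
        split_ifs with h
        · subst h
          have h5 := dEven_pow_mono_add (F := F) k (p ^ s) 0 (∅ : Finset (Fin n))
          rw [zero_add] at h5
          rw [h5, hb]
          refine LinearMap.ext fun x => ?_
          rw [LinearMap.smul_apply, LinearMap.smul_apply, Module.End.mul_apply, mulO_one_left]
        · rw [dEven_pow_mono_of_lt (by simp [Ne.symm h]; omega), map_zero, zero_mul, smul_zero]
  choose R hRS hRD hRk hR using h1
  refine ⟨∑ j, R j, sum_mem fun j _ => hRS j, sum_mem fun j _ => hRD j, killsBelow_sum hRk,
    fun j hj => ?_⟩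
  have hm := power_mem_NSet (n := n) hj
  rw [symb_sub_mono D (∑ j, R j) hm rfl (symb_sum_mono univ R hm), sum_congr rfl fun k _ => hR k j hj,
    sum_ite_eq, if_pos (mem_univ j)]
  exact LinearMap.ext fun x => by rw [LinearMap.sub_apply, sub_self, LinearMap.zero_apply]

/-- At x_i x_j^(q) the derivations (ad ∂_j)^q and Θ take exactly the two values D_H(x_i) and x^ω
D_H(x_i) allowed by `NegDer.mul_power_value`. One companion index i is fixed for each j;
`NegDer.mul_power_of_one` transfers the result to the others. -/
lemma exists_sub_mul_power [Fact p.Prime] [CharP F p] [LargeParams p m n] {r : ℤ} (hr : r ≤ -1)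
    {D : N F p n t →ₗ[F] W F p n t} (hD : D ∈ DerDeg F p n t r)
    {S : Submodule F (N F p n t →ₗ[F] W F p n t)}
    (hA : ∀ (j : Y0 m) (s : ℕ), 1 ≤ s → s ≤ (t j : ℕ) - 1 → adPow F p n t j s ∈ S)
    (hΘ : ∀ (he : Even n) (j : Y0 m) (s : ℕ), 1 ≤ s → s ≤ (t j : ℕ) - 1 →
      (n : ℤ) - (p : ℤ) ^ s < 0 → Θ F p n t he j s ∈ S)
    {s : ℕ} (hs : 1 ≤ s) (hk : KillsBelow p t (p ^ s + 1) (symb D)) {i : Y0 m → Y0 m}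
    (hi : ∀ j, j ≠ i j) (hi' : ∀ j, j ≠ (i j).swap) :
    ∃ R ∈ S, R ∈ DerDeg F p n t r ∧ KillsBelow p t (p ^ s + 1) (symb R) ∧
      ∀ j, p ^ s ≤ piTop p t j →
        symb (D - R) (mono (Pi.single (i j) 1 + Pi.single j (p ^ s), ∅)) = 0 := by
  have hL := negDer_symb hD
  have h4 : 4 ≤ p ^ s := large_pow (p := p) (m := m) (n := n) hs
  have h1 : ∀ j, ∃ R ∈ S, R ∈ DerDeg F p n t r ∧ KillsBelow p t (p ^ s + 1) (symb R) ∧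
      ∀ k, p ^ s ≤ piTop p t k → symb R (mono (Pi.single (i k) 1 + Pi.single k (p ^ s), ∅))
        = if k = j then symb D (mono (Pi.single (i k) 1 + Pi.single k (p ^ s), ∅)) else 0 := by
    intro j
    by_cases hj : p ^ s ≤ piTop p t j
    · obtain ⟨a, b, hab, har, hbr⟩ := hL.mul_power_value hs hk (hi j) (hi' j) hj
      have hd1 : ∀ k, k ≠ j → (dEven j ^ p ^ s) (mono (Pi.single (i k) 1 + Pi.single k (p ^ s), ∅) : O F m n)
          = 0 := fun k hkj => by
        refine dEven_pow_mono_of_lt ?_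
        simp only [Pi.add_apply, Pi.single_apply, if_neg hkj.symm]
        split_ifs <;> omega
      have hA' : ∃ R ∈ S, R ∈ DerDeg F p n t r ∧ KillsBelow p t (p ^ s + 1) (symb R) ∧
          ∀ k, p ^ s ≤ piTop p t k → symb R (mono (Pi.single (i k) 1 + Pi.single k (p ^ s), ∅))
            = if k = j then a • DH (mono (Pi.single (i j) 1, ∅)) else 0 := by
        by_cases ha : a = 0
        · refine ⟨0, zero_mem _, zero_mem _, fun a ha _ => by rw [symb_mono _ ha]; rfl,
            fun k hk => ?_⟩
          rw [symb_mono _ (mul_power_mem_NSet (hi k) hk), ha, zero_smul, ite_self]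
          rfl
        · refine ⟨a • adPow F p n t j s, Submodule.smul_mem _ _ (hA j s hs (exponent_le hj)),
            Submodule.smul_mem _ _ (har ha ▸ adPow_mem j s), fun c hc hda => ?_, fun k hk => ?_⟩
          · rw [symb_smul_mono _ _ hc, killsBelow_adPow j s c hc hda, smul_zero]
          · have hm := mul_power_mem_NSet (n := n) (hi k) hk
            rw [symb_smul_mono _ _ hm, symb_adPow _ _ hm]
            split_ifs with h
            · subst h; rw [dEven_pow_mono_add]
            · rw [hd1 k h, map_zero, smul_zero]
      have hB' : ∃ R ∈ S, R ∈ DerDeg F p n t r ∧ KillsBelow p t (p ^ s + 1) (symb R) ∧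
          ∀ k, p ^ s ≤ piTop p t k → symb R (mono (Pi.single (i k) 1 + Pi.single k (p ^ s), ∅))
            = if k = j then b • (mulO (mono (0, univ)) * DH (mono (Pi.single (i j) 1, ∅))) else 0 := by
        by_cases hb : b = 0
        · refine ⟨0, zero_mem _, zero_mem _, fun a ha _ => by rw [symb_mono _ ha]; rfl,
            fun k hk => ?_⟩
          rw [symb_mono _ (mul_power_mem_NSet (hi k) hk), hb, zero_smul, ite_self]
          rfl
        · obtain ⟨hn, hr'⟩ := hbr hb
          refine ⟨b • Θ F p n t hn j s, Submodule.smul_mem _ _ (hΘ hn j s hs (exponent_le hj) ?_),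
            Submodule.smul_mem _ _ (hr' ▸ Θ_mem hn j s), fun c hc hda => ?_, fun k hk => ?_⟩
          · push_cast at hr'
            omega
          · rw [symb_smul_mono _ _ hc, killsBelow_Θ hn j s c hc hda, smul_zero]
          · have hm := mul_power_mem_NSet (n := n) (hi k) hk
            rw [symb_smul_mono _ _ hm, symb_Θ _ _ _ hm]
            split_ifs with h
            · subst h; rw [dEven_pow_mono_add]
            · rw [hd1 k h, map_zero, mul_zero, smul_zero]
      obtain ⟨A, hAS, hAD, hAk, hAv⟩ := hA'
      obtain ⟨B, hBS, hBD, hBk, hBv⟩ := hB'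
      refine ⟨A + B, add_mem hAS hBS, add_mem hAD hBD, fun a ha hda => ?_, fun k hk => ?_⟩
      · rw [symb_add_mono _ _ ha, hAk a ha hda, hBk a ha hda, add_zero]
      · rw [symb_add_mono _ _ (mul_power_mem_NSet (hi k) hk), hAv k hk, hBv k hk]
        split_ifs with h
        · subst h; rw [hab]
        · rw [add_zero]
    · refine ⟨0, zero_mem _, zero_mem _, fun a ha _ => by rw [symb_mono _ ha]; rfl, fun k hk => ?_⟩
      rw [if_neg (fun h : k = j => hj (h ▸ hk)), symb_mono _ (mul_power_mem_NSet (hi k) hk)]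
      rfl
  choose R hRS hRD hRk hR using h1
  refine ⟨∑ j, R j, sum_mem fun j _ => hRS j, sum_mem fun j _ => hRD j, killsBelow_sum hRk,
    fun j hj => ?_⟩
  have hm := mul_power_mem_NSet (n := n) (hi j) hj
  rw [symb_sub_mono D (∑ j, R j) hm rfl (symb_sum_mono univ R hm), sum_congr rfl fun k _ => hR k j hj,
    sum_ite_eq, if_pos (mem_univ j)]
  exact LinearMap.ext fun x => by rw [LinearMap.sub_apply, sub_self, LinearMap.zero_apply]

/-- The bracket with the killed quadratic element x_k x_{i'} replaces x_i by ± x_k and leaves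
x_j^(q) alone, j being outside both pairs. -/
lemma NegDer.mul_power_of_one [Fact p.Prime] [LargeParams p m n] {r : ℤ}
    {L : O F m n →ₗ[F] Module.End F (O F m n)} (hL : NegDer F p n t r L)
    (hk : KillsBelow p t 3 L) {q : ℕ} {i j k : Y0 m} (hj : q ≤ piTop p t j) (hij : j ≠ i)
    (hij' : j ≠ i.swap) (hkj : j ≠ k) (hkj' : j ≠ k.swap)
    (h : L (mono (Pi.single i 1 + Pi.single j q, ∅)) = 0) :
    L (mono (Pi.single k 1 + Pi.single j q, ∅)) = 0 := by
  have h3 := fun l => three_le_piTop (p := p) (n := n) (t := t) l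
  have hz : ((Pi.single k 1 + Pi.single i.swap 1, ∅) : Idx m n) ∈ NSet p n t := by
    refine mem_NSet (fun l => ?_) (by simp) (i := j) ?_
    · have := h3 l
      simp only [Pi.add_apply, Pi.single_apply]
      grind
    · have := h3 j
      simp [hij', hkj]; omega
  have h1 := hL.bracket_zero hz (mul_power_mem_NSet hij hj)
    (hk _ hz (by rw [deg_mk, tot_add, tot_single, tot_single, card_empty]; omega)) h
  have h2 := DH_pure_one_term (F := F) (n := n) i.swap (Pi.single k 1) (Pi.single j q) ∅ (fun l _ => by
    by_cases hl : l = k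
    · subst hl
      right
      rw [Pi.single_eq_of_ne hkj'.symm]
    · left; rw [Pi.single_eq_of_ne hl])
  rw [Sum.swap_swap, mulO_even_mono _ _ _ (fun l => by
    by_cases hl : l = k
    · subst hl
      right
      rw [Pi.single_eq_of_ne hkj.symm]
    · left; rw [Pi.single_eq_of_ne hl])] at h2
  rw [add_comm (Pi.single i 1), h2] at h1
  exact eq_zero_of_map_smul h1 (tau_cast_ne_zero _)

/-- A correction is needed only in the degrees q and q + 1, with q = p^s and s ≥ 1: by Φ in the
first, by (ad ∂_j)^q and Θ in the second. In all other degrees there are no special monomials and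
vanishing is automatic. -/
lemma exists_sub_killsBelow_succ [Fact p.Prime] [CharP F p] [LargeParams p m n] {r : ℤ}
    (hr : r ≤ -1) {D : N F p n t →ₗ[F] W F p n t} (hD : D ∈ DerDeg F p n t r)
    {S : Submodule F (N F p n t →ₗ[F] W F p n t)}
    (hA : ∀ (j : Y0 m) (s : ℕ), 1 ≤ s → s ≤ (t j : ℕ) - 1 → adPow F p n t j s ∈ S)
    (hΦΘ : ∀ (he : Even n) (j : Y0 m) (s : ℕ), 1 ≤ s → s ≤ (t j : ℕ) - 1 →
      (n : ℤ) - (p : ℤ) ^ s < 0 → Φ F p n t he j s ∈ S ∧ Θ F p n t he j s ∈ S)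
    {d : ℕ} (hd : 3 ≤ d) (hk : KillsBelow p t d (symb D)) :
    ∃ R ∈ S, R ∈ DerDeg F p n t r ∧ KillsBelow p t (d + 1) (symb (D - R)) := by
  have hp : p.Prime := Fact.out
  -- A degree cannot be of both special kinds, since p would divide 1.
  have hne : ∀ s s', 1 ≤ s → 1 ≤ s' → p ^ s ≠ p ^ s' + 1 := fun s s' hs hs' h => by
    have h1 : p ∣ p ^ s' + 1 := h ▸ dvd_pow_self p (by omega)
    exact hp.one_lt.ne' (Nat.dvd_one.1 ((Nat.dvd_add_right (dvd_pow_self p (by omega))).1 h1))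
  by_cases h1 : ∃ s, 1 ≤ s ∧ p ^ s = d
  · obtain ⟨s, hs, rfl⟩ := h1
    obtain ⟨R, hRS, hRD, hRk, hR⟩ := exists_sub_power hr hD
      (fun he j s h1 h2 h3 => (hΦΘ he j s h1 h2 h3).1) hs hk
    have hDR := sub_mem hD hRD
    refine ⟨R, hRS, hRD, (negDer_symb hDR).killsBelow_succ hr hd (killsBelow_symb_sub hk hRk)
      ⟨fun j s' hs' hj h => ?_, fun j s' hs' hj h => absurd h.symm (hne s s' hs hs')⟩⟩
    rw [h] at hj ⊢
    exact hR j hj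
  by_cases h2 : ∃ s, 1 ≤ s ∧ p ^ s + 1 = d
  · obtain ⟨s, hs, rfl⟩ := h2
    choose i hi hi' using fun j : Y0 m => exists_not_mem_pair (p := p) (n := n) j
    have hii : ∀ j, j ≠ (i j).swap := fun j h => hi' j (by rw [h, Sum.swap_swap, ← h])
    obtain ⟨R, hRS, hRD, hRk, hR⟩ := exists_sub_mul_power hr hD hA
      (fun he j s h1 h2 h3 => (hΦΘ he j s h1 h2 h3).2) hs hk (fun j => (hi j).symm) hii
    have hDR := sub_mem hD hRD
    have hk' := killsBelow_symb_sub hk hRk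
    refine ⟨R, hRS, hRD, (negDer_symb hDR).killsBelow_succ hr hd hk'
      ⟨fun j s' hs' hj h => absurd h (hne s' s hs' hs), fun j s' hs' hj h k hkj hkj' => ?_⟩⟩
    rw [Nat.succ_injective h] at hj ⊢
    exact (negDer_symb hDR).mul_power_of_one (fun a ha hda => hk' a ha (by omega)) hj (hi j).symm
      (hii j) hkj hkj' (hR j hj)
  · refine ⟨0, zero_mem _, zero_mem _, ?_⟩
    rw [sub_zero]
    exact (negDer_symb hD).killsBelow_succ hr hd hk
      ⟨fun j s hs _ h => absurd ⟨s, hs, h⟩ h1, fun j s hs _ h => absurd ⟨s, hs, h⟩ h2⟩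

lemma DerDeg_le [Fact p.Prime] [CharP F p] [LargeParams p m n] {r : ℤ} (hr : r ≤ -1)
    {S : Submodule F (N F p n t →ₗ[F] W F p n t)}
    (hW : (WDeg F p n t (-1)).map (adN F p n t) ≤ S)
    (hA : ∀ (j : Y0 m) (s : ℕ), 1 ≤ s → s ≤ (t j : ℕ) - 1 → adPow F p n t j s ∈ S)
    (hΦΘ : ∀ (he : Even n) (j : Y0 m) (s : ℕ), 1 ≤ s → s ≤ (t j : ℕ) - 1 →
      (n : ℤ) - (p : ℤ) ^ s < 0 → Φ F p n t he j s ∈ S ∧ Θ F p n t he j s ∈ S) :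
    DerDeg F p n t r ≤ S := by
  intro D hD
  obtain ⟨w, hw, hwD, hwk⟩ := exists_adN_killsBelow_three hr hD
  have key : ∀ d, ∃ R ∈ S, R ∈ DerDeg F p n t r ∧ KillsBelow p t (d + 3) (symb (D - R)) := by
    intro d
    induction d with
    | zero => exact ⟨_, hW (Submodule.mem_map_of_mem hw), hwD, hwk⟩
    | succ d ih =>
      obtain ⟨R, hRS, hRD, hRk⟩ := ih
      obtain ⟨R', hRS', hRD', hRk'⟩ := exists_sub_killsBelow_succ hr (sub_mem hD hRD) hA hΦΘ
        (by omega) hRk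
      refine ⟨R + R', add_mem hRS hRS', add_mem hRD hRD', ?_⟩
      rw [← sub_sub, show d + 1 + 3 = d + 3 + 1 by omega]
      exact hRk'
  -- Past the largest degree of a monomial the difference D - R vanishes altogether.
  obtain ⟨R, hRS, -, hRk⟩ := key (∑ i, piTop p t i + n + 1)
  have h0 := eq_zero_of_killsBelow (D := D - R) fun a ha hda => hRk a ha (by omega)
  rwa [sub_eq_zero.1 h0]

lemma DerDeg_le_DerNeg [Fact p.Prime] [CharP F p] {r : ℤ} (hr : r ≤ -1) :
    DerDeg F p n t r ≤ DerNeg F p n t :=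
  le_iSup (fun r : {r : ℤ // r ≤ -1} => DerDeg F p n t r) ⟨r, hr⟩

lemma map_adN_le_DerNeg [Fact p.Prime] [CharP F p] :
    (WDeg F p n t (-1)).map (adN F p n t) ≤ DerNeg F p n t := by
  rintro _ ⟨w, hw, rfl⟩
  exact DerDeg_le_DerNeg le_rfl (adN_mem hw)

lemma iSup_adPow_le_DerNeg [Fact p.Prime] [CharP F p] :
    (⨆ (r : Y0 m) (s : ℕ) (_ : 1 ≤ s ∧ s ≤ (t r : ℕ) - 1),
      Submodule.span F {adPow F p n t r s}) ≤ DerNeg F p n t := by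
  refine iSup_le fun j => iSup_le fun s => iSup_le fun _ => ?_
  rw [Submodule.span_singleton_le_iff_mem]
  have h : 0 < p ^ s := pow_pos (Fact.out : p.Prime).pos s
  exact DerDeg_le_DerNeg (by omega) (adPow_mem j s)

end Reduction

end HamSuper

theorem theorem4p10 (F : Type*) [Field F] (p : ℕ) [Fact p.Prime] [CharP F p] (hp : 3 < p)
    (m n : ℕ) (hm : 1 < m) (hn : 3 < n) (t : HamSuper.Y0 m → ℕ+) :
    (∀ he : Even n,
      HamSuper.DerNeg F p n t =
        (HamSuper.WDeg F p n t (-1)).map (HamSuper.adN F p n t)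
        ⊔ (⨆ (r : HamSuper.Y0 m) (s : ℕ) (_ : 1 ≤ s ∧ s ≤ (t r : ℕ) - 1 ∧ (n : ℤ) - (p : ℤ) ^ s < 0),
            Submodule.span F {HamSuper.Φ F p n t he r s}
              ⊔ Submodule.span F {HamSuper.Θ F p n t he r s})
        ⊔ (⨆ (r : HamSuper.Y0 m) (s : ℕ) (_ : 1 ≤ s ∧ s ≤ (t r : ℕ) - 1),
            Submodule.span F {HamSuper.adPow F p n t r s})) ∧
    (Odd n →
      HamSuper.DerNeg F p n t =
        (HamSuper.WDeg F p n t (-1)).map (HamSuper.adN F p n t)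
        ⊔ (⨆ (r : HamSuper.Y0 m) (s : ℕ) (_ : 1 ≤ s ∧ s ≤ (t r : ℕ) - 1),
            Submodule.span F {HamSuper.adPow F p n t r s})) := by
  have hLarge : HamSuper.LargeParams p m n := ⟨hp, hm, hn⟩
  refine ⟨fun he => le_antisymm ?_ ?_, fun ho => le_antisymm ?_ ?_⟩
  · refine iSup_le fun r => HamSuper.DerDeg_le r.2 (le_sup_left.trans le_sup_left) ?_ ?_
    · intro j s h1 h2
      refine Submodule.mem_sup_right ?_
      exact Submodule.mem_iSup_of_mem j (Submodule.mem_iSup_of_mem s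
        (Submodule.mem_iSup_of_mem ⟨h1, h2⟩ (Submodule.mem_span_singleton_self _)))
    · intro _ j s h1 h2 h3
      refine ⟨?_, ?_⟩
      all_goals
        rw [← Submodule.span_singleton_le_iff_mem]
        refine le_sup_of_le_left (le_sup_of_le_right ?_)
        refine le_iSup_of_le j (le_iSup_of_le s (le_iSup_of_le ⟨h1, h2, h3⟩ ?_))
      · exact le_sup_left
      · exact le_sup_right
  · refine sup_le (sup_le HamSuper.map_adN_le_DerNeg ?_) HamSuper.iSup_adPow_le_DerNeg
    refine iSup_le fun j => iSup_le fun s => iSup_le fun h => sup_le ?_ ?_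
    all_goals
      rw [Submodule.span_singleton_le_iff_mem]
      -- Both exceptional derivations are homogeneous of degree n - p^s, which is negative by the
      -- condition on s.
      refine HamSuper.DerDeg_le_DerNeg (r := (n : ℤ) - (p ^ s : ℕ)) (by push_cast; omega) ?_
    · exact HamSuper.Φ_mem he j s
    · exact HamSuper.Θ_mem he j s
  · refine iSup_le fun r => HamSuper.DerDeg_le r.2 le_sup_left ?_ ?_
    · intro j s h1 h2
      refine Submodule.mem_sup_right ?_
      exact Submodule.mem_iSup_of_mem j (Submodule.mem_iSup_of_mem s
        (Submodule.mem_iSup_of_mem ⟨h1, h2⟩ (Submodule.mem_span_singleton_self _)))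
    · intro he
      exact absurd he (Nat.not_even_iff_odd.2 ho)
  · exact sup_le HamSuper.map_adN_le_DerNeg HamSuper.iSup_adPow_le_DerNeg
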